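/- Let $m\ge 1$ and let $S^{2m+1}\subseteq\mathbb{R}^{2m+2}$ be the unit sphere with its round metric of radius $1$. Let $W\subseteq\hat W\subseteq\mathbb{R}^{2m+2}$ be linear subspaces of dimensions $m+1$ and $2m+1$, let $S=W\cap S^{2m+1}$ and $\hat S=\hat W\cap S^{2m+1}$, and let $N\in\hat W^\perp$ be a unit vector. For $\varepsilon>0$ let $$S_\varepsilon=\cos(\varepsilon)\,S+\sin(\varepsilon)\,N\subseteq S^{2m+1}$$ be the submanifold obtained by moving $S$ by the distance $\varepsilon$ orthogonally to $\hat S$. With $d$ the distance of the round metric, let $A_{\varepsilon,6\varepsilon}(\hat S)=\{x\in S^{2m+1} : \varepsilon<d(x,\hat S)<6\varepsilon\}$ and $B_\delta(S)=\{x\in S^{2m+1} : d(x,S)<\delta\}$. Then for every $\delta>0$ and all sufficiently small $\varepsilon>0$ there exists a smooth Riemannian metric $g$ of positive Ricci curvature on $S^{2m+1}$ such that 1. $g$ is the round metric of radius $1$ on the complement of $A_{\varepsilon,6\varepsilon}(\hat S)\cap B_\delta(S)$; 2. the submanifold $S_{3\varepsilon}$ of $(S^{2m+1},g)$ is round (with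 the metric induced by $g$ it is isometric to a round $m$-sphere of some radius) and totally geodesic. -/

import Mathlib

open scoped Manifold ContDiff

noncomputable section

namespace SphereUnlink

/-! ### Riemannian geometry in coordinates

`M` is a smooth manifold without boundary of dimension `n`.  At a point `p` we use the preferred
chart `extChartAt (𝓡 n) p`.  In Mathlib the tangent space `TangentSpace (𝓡 n) p` is the coordinate
space `EuclideanSpace ℝ (Fin n)`, a vector being identified with its components in that same
preferred chart at `p`; so tensors at `p` may be written in these components. -/

section Riemannian

variable {n : ℕ} {M : Type*} [TopologicalSpace M] [ChartedSpace (EuclideanSpace ℝ (Fin n)) M]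
  [IsManifold (𝓡 n) ∞ M]

/-- Smooth Riemannian metrics on the `n`-manifold `M`. -/
abbrev SmoothMetric (n : ℕ) (M : Type*) [TopologicalSpace M]
    [ChartedSpace (EuclideanSpace ℝ (Fin n)) M] [IsManifold (𝓡 n) ∞ M] :=
  Bundle.ContMDiffRiemannianMetric (𝓡 n) ∞ (EuclideanSpace ℝ (Fin n))
    (fun x : M => TangentSpace (𝓡 n) x)

/-- The `i`-th coordinate vector. -/
abbrev coordVec {n : ℕ} (i : Fin n) : EuclideanSpace ℝ (Fin n) := EuclideanSpace.single i (1 : ℝ)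

/-- The partial derivative `∂F/∂yⁱ` at `y`. -/
def partialDeriv {n : ℕ} (i : Fin n) (F : EuclideanSpace ℝ (Fin n) → ℝ)
    (y : EuclideanSpace ℝ (Fin n)) : ℝ :=
  fderiv ℝ F y (coordVec i)

/-- The scalar product `g_q` on the tangent space at `q`, as a form on components at `q`. -/
def metricForm (g : SmoothMetric n M) (q : M) :
    EuclideanSpace ℝ (Fin n) →L[ℝ] EuclideanSpace ℝ (Fin n) →L[ℝ] ℝ :=
  g.inner q

/-- The differential at `y` of the inverse of the preferred chart at `p`. -/
def chartSymmDeriv (n : ℕ) {M : Type*} [TopologicalSpace M]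
    [ChartedSpace (EuclideanSpace ℝ (Fin n)) M] (p : M) (y : EuclideanSpace ℝ (Fin n)) :
    EuclideanSpace ℝ (Fin n) →L[ℝ] EuclideanSpace ℝ (Fin n) :=
  mfderiv 𝓘(ℝ, EuclideanSpace ℝ (Fin n)) (𝓡 n) (extChartAt (𝓡 n) p).symm y

/-- The matrix `g_{ij}(y) = g(∂_i, ∂_j)` of the metric `g` at the point with coordinates `y` in the
preferred chart at `p`; here `∂_i` is the image of the `i`-th coordinate vector under the
differential of the inverse of the chart. -/
def metricMatrix (g : SmoothMetric n M) (p : M) (y : EuclideanSpace ℝ (Fin n)) :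
    Matrix (Fin n) (Fin n) ℝ :=
  Matrix.of fun i j =>
    metricForm g ((extChartAt (𝓡 n) p).symm y)
      (chartSymmDeriv n p y (coordVec i)) (chartSymmDeriv n p y (coordVec j))

/-- The Christoffel symbol `Γᵏ_{ij} = ½ ∑ₗ gᵏˡ (∂_i g_{jl} + ∂_j g_{il} - ∂_l g_{ij})` of the
Levi-Civita connection of `g` in the preferred chart at `p`. -/
def christoffel (g : SmoothMetric n M) (p : M) (k i j : Fin n)
    (y : EuclideanSpace ℝ (Fin n)) : ℝ :=
  (1 / 2 : ℝ) * ∑ l, (metricMatrix g p y)⁻¹ k l *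
    (partialDeriv i (fun z => metricMatrix g p z j l) y
      + partialDeriv j (fun z => metricMatrix g p z i l) y
      - partialDeriv l (fun z => metricMatrix g p z i j) y)

/-- The components
`Ric_{ij} = ∑ₖ (∂_k Γᵏ_{ij} - ∂_j Γᵏ_{ik}) + ∑ₖₗ (Γᵏ_{kl} Γˡ_{ij} - Γᵏ_{jl} Γˡ_{ik})`
of the Ricci tensor of `g` in the preferred chart at `p`. -/
def ricciMatrix (g : SmoothMetric n M) (p : M) (i j : Fin n)
    (y : EuclideanSpace ℝ (Fin n)) : ℝ :=
  ∑ k, (partialDeriv k (christoffel g p k i j) y - partialDeriv j (christoffel g p k i k) y)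
    + ∑ k, ∑ l, (christoffel g p k k l y * christoffel g p l i j y
        - christoffel g p k j l y * christoffel g p l i k y)

/-- The Ricci curvature `Ric(v, v)` of `g` at `p` in the direction of the tangent vector `v`. -/
def ricci (g : SmoothMetric n M) (p : M) (v : EuclideanSpace ℝ (Fin n)) : ℝ :=
  ∑ i, ∑ j, ricciMatrix g p i j (extChartAt (𝓡 n) p p) * v i * v j

/-- `Ric > 0`: the Ricci curvature of every non-zero tangent vector is positive. -/
def HasPositiveRicci (g : SmoothMetric n M) : Prop :=
  ∀ (p : M) (v : EuclideanSpace ℝ (Fin n)), v ≠ 0 → 0 < ricci g p v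

/-- The velocity `c'(t)` of a curve `c`, in components at `c t`. -/
def velocity (c : ℝ → M) (t : ℝ) : EuclideanSpace ℝ (Fin n) :=
  deriv (fun s => extChartAt (𝓡 n) (c t) (c s)) t

/-- The covariant acceleration `∇_{c'} c'` of a curve `c` at time `t`, in components at `c t`: its
`k`-th component is `(cᵏ)'' + ∑ᵢⱼ Γᵏ_{ij} (cⁱ)' (cʲ)'`. -/
def covAcceleration (g : SmoothMetric n M) (c : ℝ → M) (t : ℝ) : EuclideanSpace ℝ (Fin n) :=
  WithLp.toLp 2 fun k =>
    deriv (deriv fun s => extChartAt (𝓡 n) (c t) (c s)) t k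
      + ∑ i, ∑ j, christoffel g (c t) k i j (extChartAt (𝓡 n) (c t) (c t))
          * velocity (n := n) c t i * velocity (n := n) c t j

/-- The vectors tangent to the (embedded) submanifold `N` at the point `p`: the velocities at `p`
of the smooth curves in `N` through `p`, in components at `p`. -/
def tangentVectors (n : ℕ) {M : Type*} [TopologicalSpace M]
    [ChartedSpace (EuclideanSpace ℝ (Fin n)) M] (N : Set M) (p : M) :
    Set (EuclideanSpace ℝ (Fin n)) :=
  {v | ∃ c : ℝ → M, ContMDiff 𝓘(ℝ, ℝ) (𝓡 n) ∞ c ∧ (∀ t, c t ∈ N) ∧ c 0 = p ∧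
    velocity (n := n) c 0 = v}

/-- The (embedded) submanifold `N` is totally geodesic in `(M, g)`: its second fundamental form
`II(c', c') = (∇_{c'} c')^⊥` vanishes, i.e. the covariant acceleration of every smooth curve in `N`
is tangent to `N`. -/
def IsTotallyGeodesic (g : SmoothMetric n M) (N : Set M) : Prop :=
  ∀ c : ℝ → M, ContMDiff 𝓘(ℝ, ℝ) (𝓡 n) ∞ c → (∀ t, c t ∈ N) →
    ∀ t, covAcceleration g c t ∈ tangentVectors n N (c t)

end Riemannian

/-! ### Round spheres -/

/-- The unit sphere `S^n` in `ℝ^{n+1}`. -/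
abbrev Sph (n : ℕ) : Type := Metric.sphere (0 : EuclideanSpace ℝ (Fin (n + 1))) 1

/-- The differential at `p` of the inclusion of `S^n` in `ℝ^{n+1}`. -/
def inclDeriv {n : ℕ} (p : Sph n) :
    EuclideanSpace ℝ (Fin n) →L[ℝ] EuclideanSpace ℝ (Fin (n + 1)) :=
  mfderiv (𝓡 n) 𝓘(ℝ, EuclideanSpace ℝ (Fin (n + 1)))
    (fun x : Sph n => (x : EuclideanSpace ℝ (Fin (n + 1)))) p

/-- The round metric of radius `1` on `S^n`: the metric induced from `ℝ^{n+1}`. -/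
def roundForm {n : ℕ} (p : Sph n) (v w : EuclideanSpace ℝ (Fin n)) : ℝ :=
  inner ℝ (inclDeriv p v) (inclDeriv p w)

/-- The differential at `x` of a map `f` from `S^m` to the `n`-manifold `M`. -/
def sphereMapDeriv {m : ℕ} (n : ℕ) {M : Type*} [TopologicalSpace M]
    [ChartedSpace (EuclideanSpace ℝ (Fin n)) M] (f : Sph m → M) (x : Sph m) :
    EuclideanSpace ℝ (Fin m) →L[ℝ] EuclideanSpace ℝ (Fin n) :=
  mfderiv (𝓡 m) (𝓡 n) f x

/-- The submanifold `N` of `(M, g)` is a round `m`-sphere: with the metric induced by `g` it is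
isometric to the round `m`-sphere of some radius `r`, that is, to `S^m` with the metric
`r²·(round metric of radius 1)`. (The map `f` below is a smooth embedding, because it is injective
and, by the last condition, an immersion of a compact manifold.) -/
def IsRoundSphere {n : ℕ} {M : Type*} [TopologicalSpace M]
    [ChartedSpace (EuclideanSpace ℝ (Fin n)) M] [IsManifold (𝓡 n) ∞ M]
    (g : SmoothMetric n M) (m : ℕ) (N : Set M) : Prop :=
  ∃ r : ℝ, 0 < r ∧ ∃ f : Sph m → M,
    ContMDiff (𝓡 m) (𝓡 n) ∞ f ∧ Function.Injective f ∧ Set.range f = N ∧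
    ∀ (x : Sph m) (u v : EuclideanSpace ℝ (Fin m)),
      metricForm g (f x) (sphereMapDeriv n f x u) (sphereMapDeriv n f x v)
        = r ^ 2 * roundForm x u v

/-- The distance of `x` from the set `K` for the round metric of radius `1` on `S^n`, in which the
distance of two points is the angle between them. -/
def roundDist {n : ℕ} (x : Sph n) (K : Set (Sph n)) : ℝ :=
  ⨅ y : K, InnerProductGeometry.angle (x : EuclideanSpace ℝ (Fin (n + 1)))
    ((y : Sph n) : EuclideanSpace ℝ (Fin (n + 1)))

/-- The annulus `A_{a,b}(K)` around `K` with inner radius `a` and outer radius `b`. -/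
def annulus {n : ℕ} (a b : ℝ) (K : Set (Sph n)) : Set (Sph n) :=
  {x | a < roundDist x K ∧ roundDist x K < b}

/-- The `δ`-neighbourhood `B_δ(K)` of `K`. -/
def nbhd {n : ℕ} (δ : ℝ) (K : Set (Sph n)) : Set (Sph n) :=
  {x | roundDist x K < δ}

/-- The unit sphere `W ∩ S^n` of a linear subspace `W`. -/
def subSphere {n : ℕ} (W : Submodule ℝ (EuclideanSpace ℝ (Fin (n + 1)))) : Set (Sph n) :=
  {x | (x : EuclideanSpace ℝ (Fin (n + 1))) ∈ W}

/-- The shifted sphere `cos(ε) S + sin(ε) ν`. -/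
def shift {n : ℕ} (S : Set (Sph n)) (ν : EuclideanSpace ℝ (Fin (n + 1))) (ε : ℝ) : Set (Sph n) :=
  {x | ∃ y ∈ S, (x : EuclideanSpace ℝ (Fin (n + 1)))
    = Real.cos ε • (y : EuclideanSpace ℝ (Fin (n + 1))) + Real.sin ε • ν}

end SphereUnlink

end

/-! Put n = 2m+1, let P be the orthogonal projection onto W, and perturb the round metric to g(v,w)
= ⟨v,w⟩ + F(x)⟨Pv,Pw⟩ with F(x) = φ(⟨ν,x⟩) η(x). Here η is a cutoff in the directions orthogonal to
both W and ν, equal to 1 near span(W,ν) and supported close to it.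

The parallel sphere at angle θ is then round with squared radius cos²θ (1 + φ(sin θ)). It is totally
geodesic when this radius is critical, that is, when 2(1+φ) sin θ = φ' cos²θ (`isRoundSphere_shift`,
`isTotallyGeodesic_shift`). At height s = sin 3ε this asks for a slope φ' close to 2s.

Take φ(t) = c s² χ(t/s). As s → 0 the function and its slope tend to 0, but φ'' = cχ'' does not. In
the limit the Ricci curvature at the equator is 2m|v|² - (φ''/2)(η|Pv|² + ⟨ν,v⟩² η tr P), with P
restricted to the tangent space (`pertRicci_eq`). On the support of η this trace is at most m + 1/9,
so φ''(m + 1/9) < 4m suffices. Only an upper bound on φ'' is needed. Distance ε from the equator is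
height about s/3, so the slope must grow from 0 to 2s on an interval of length about 2s/3. This
needs φ'' of about 3, below 4m/(m + 1/9) ≥ 3.6. Afterwards φ' may drop as sharply as one likes, and
φ is back to 0 before height 2s, that is, distance 6ε. `exists_profile` provides such a χ, with
bound 3.3 and support in [0.36, 1.89].

The limit is made rigorous by compactness (`exists_pertRicci_pos`): in stereographic coordinates the
Ricci curvature depends continuously on the point, the orthonormal frame, the vector and the two-jet
of φ. The constant c, close to 1, is finally chosen so that the criticality equation holds exactly
(`exists_coupling`). -/

open scoped Manifold ContDiff

noncomputable section

namespace SphereUnlink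

/-! ### Stereographic charts of the unit sphere -/

section Charts

variable {n : ℕ}

/-- The orthonormal basis of `p^⊥` used by the preferred chart at `p`. -/
def sphFrame (p : Sph n) (k : Fin n) : EuclideanSpace ℝ (Fin (n + 1)) :=
  haveI := Fact.mk (@finrank_euclideanSpace_fin ℝ _ (n + 1))
  ((OrthonormalBasis.fromOrthogonalSpanSingleton (𝕜 := ℝ) n
    (ne_zero_of_mem_unit_sphere (-p)) k : (ℝ ∙ ((-p : Sph n) : EuclideanSpace ℝ (Fin (n + 1))))ᗮ) :
      EuclideanSpace ℝ (Fin (n + 1)))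

/-- `e` is an orthonormal basis of the orthogonal complement of the unit vector `p`. -/
structure IsFrame {E : Type*} [NormedAddCommGroup E] [InnerProductSpace ℝ E]
    (p : E) (e : Fin n → E) : Prop where
  norm_base : ‖p‖ = 1
  inner_eq : ∀ i j, inner ℝ (e i) (e j) = if i = j then (1 : ℝ) else 0
  inner_base : ∀ i, inner ℝ (e i) p = (0 : ℝ)
  -- Completeness of the frame in the form of Parseval's identity: a closed condition on (p, e), so
  -- that the set of all frames is compact.
  parseval : ∀ x y : E, ∑ k, inner ℝ (e k) x * inner ℝ (e k) y
    = inner ℝ x y - inner ℝ x p * inner ℝ y p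

lemma IsFrame.sum_smul {E : Type*} [NormedAddCommGroup E] [InnerProductSpace ℝ E]
    {p : E} {e : Fin n → E} (h : IsFrame p e) (x : E) :
    ∑ k, (inner ℝ (e k) x : ℝ) • e k = x - (inner ℝ x p : ℝ) • p := by
  refine ext_inner_right ℝ fun y => ?_
  simp only [sum_inner, inner_sub_left, real_inner_smul_left, h.parseval, real_inner_comm y p]

lemma coe_orthogonalProjectionOnto_orthogonal_unit {E : Type*} [NormedAddCommGroup E]
    [InnerProductSpace ℝ E] {v : E} (hv : ‖v‖ = 1) (z : E) :
    ((ℝ ∙ v)ᗮ.orthogonalProjectionOnto z : E) = z - (inner ℝ v z : ℝ) • v := by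
  have h := (ℝ ∙ v).starProjection_add_starProjection_orthogonal z
  rw [Submodule.starProjection_unit_singleton ℝ hv] at h
  exact eq_sub_of_add_eq' h

lemma isFrame_sphFrame (p : Sph n) :
    IsFrame (p : EuclideanSpace ℝ (Fin (n + 1))) (sphFrame p) := by
  have := Fact.mk (@finrank_euclideanSpace_fin ℝ _ (n + 1))
  have hp : ‖(p : EuclideanSpace ℝ (Fin (n + 1)))‖ = 1 := norm_eq_of_mem_sphere p
  set b := OrthonormalBasis.fromOrthogonalSpanSingleton (𝕜 := ℝ) n
    (ne_zero_of_mem_unit_sphere (-p)) with hb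
  have hcoe : ∀ k, sphFrame p k = (b k : EuclideanSpace ℝ (Fin (n + 1))) := fun k => rfl
  refine ⟨hp, fun i j => ?_, fun i => ?_, fun x y => ?_⟩
  · rw [hcoe, hcoe, ← Submodule.coe_inner]
    exact orthonormal_iff_ite.1 b.orthonormal i j
  · have := Submodule.mem_orthogonal_singleton_iff_inner_left.1 (b i).2
    rw [hcoe]
    simpa using this
  · have h2 : ∀ k z, (inner ℝ (sphFrame p k) z : ℝ) = inner ℝ (b k)
        ((ℝ ∙ ((-p : Sph n) : EuclideanSpace ℝ (Fin (n + 1))))ᗮ.orthogonalProjectionOnto z) := by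
      intro k z
      rw [hcoe]
      exact (Submodule.inner_orthogonalProjectionOnto_eq_of_mem_left (b k) z).symm
    have h3 := b.sum_inner_mul_inner
      ((ℝ ∙ ((-p : Sph n) : EuclideanSpace ℝ (Fin (n + 1))))ᗮ.orthogonalProjectionOnto x)
      ((ℝ ∙ ((-p : Sph n) : EuclideanSpace ℝ (Fin (n + 1))))ᗮ.orthogonalProjectionOnto y)
    rw [Submodule.coe_inner, coe_orthogonalProjectionOnto_orthogonal_unit (by simp),
      coe_orthogonalProjectionOnto_orthogonal_unit (by simp)] at h3
    have h5 : ∀ z : EuclideanSpace ℝ (Fin (n + 1)), (inner ℝ (p : EuclideanSpace ℝ (Fin (n + 1))) z : ℝ)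
        = inner ℝ z (p : EuclideanSpace ℝ (Fin (n + 1))) := fun z => real_inner_comm _ _
    calc ∑ k, inner ℝ (sphFrame p k) x * inner ℝ (sphFrame p k) y = _ := by
          refine Finset.sum_congr rfl fun k _ => ?_
          rw [h2, h2, real_inner_comm (b k)]
      _ = _ := h3
      _ = _ := by
          simp [inner_sub_left, inner_sub_right, real_inner_smul_left, real_inner_smul_right, h5]

/-- The parametrization of the unit sphere inverse to stereographic projection, sending `0` to `p`,
in the coordinates given by the frame `e` of `p^⊥`. -/
def stereoParam {E : Type*} [NormedAddCommGroup E] [InnerProductSpace ℝ E] (p : E) (e : Fin n → E)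
    (y : EuclideanSpace ℝ (Fin n)) : E :=
  (‖y‖ ^ 2 + 4)⁻¹ • ((4 : ℝ) • ∑ k, y k • e k + (4 - ‖y‖ ^ 2) • p)

lemma contDiff_stereoParam {E : Type*} [NormedAddCommGroup E] [InnerProductSpace ℝ E] (p : E)
    (e : Fin n → E) : ContDiff ℝ ∞ (stereoParam p e) := by
  have h : ContDiff ℝ ∞ fun y : EuclideanSpace ℝ (Fin n) => ‖y‖ ^ 2 := contDiff_norm_sq ℝ
  unfold stereoParam
  refine ContDiff.smul (ContDiff.inv (h.add contDiff_const) fun y => by positivity) ?_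
  exact (contDiff_const.smul (by fun_prop)).add ((contDiff_const.sub h).smul contDiff_const)

/-- The preferred chart at p projects stereographically from -p. Hence p has coordinates 0 and the
inverse chart is given by one formula on the whole coordinate space. -/
lemma coe_extChartAt_symm (p : Sph n) (y : EuclideanSpace ℝ (Fin n)) :
    (((extChartAt (𝓡 n) p).symm y : Sph n) : EuclideanSpace ℝ (Fin (n + 1)))
      = stereoParam (p : EuclideanSpace ℝ (Fin (n + 1))) (sphFrame p) y := by
  have := Fact.mk (@finrank_euclideanSpace_fin ℝ _ (n + 1))
  have h : ((extChartAt (𝓡 n) p).symm y : Sph n) = (stereographic' n (-p)).symm y := rfl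
  rw [h, stereographic'_symm_apply]
  set U := (OrthonormalBasis.fromOrthogonalSpanSingleton (𝕜 := ℝ) n
    (ne_zero_of_mem_unit_sphere (-p))) with hU
  have h1 : (U.repr.symm y : EuclideanSpace ℝ (Fin (n + 1))) = ∑ k, y k • sphFrame p k := by
    rw [← U.sum_repr_symm, Submodule.coe_sum]
    rfl
  have h2 : ‖(U.repr.symm y : EuclideanSpace ℝ (Fin (n + 1)))‖ = ‖y‖ := by
    rw [← Submodule.coe_norm, U.repr.symm.norm_map]
  change (‖(U.repr.symm y : EuclideanSpace ℝ (Fin (n + 1)))‖ ^ 2 + 4)⁻¹ •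
      (4 : ℝ) • (U.repr.symm y : EuclideanSpace ℝ (Fin (n + 1))) +
    (‖(U.repr.symm y : EuclideanSpace ℝ (Fin (n + 1)))‖ ^ 2 + 4)⁻¹ •
      (‖(U.repr.symm y : EuclideanSpace ℝ (Fin (n + 1)))‖ ^ 2 - 4) •
        (-(p : EuclideanSpace ℝ (Fin (n + 1)))) = _
  rw [h2, h1]
  simp only [stereoParam]
  module

lemma extChartAt_apply_eq (p q : Sph n) (k : Fin n) :
    extChartAt (𝓡 n) p q k = 2 * inner ℝ (sphFrame p k) (q : EuclideanSpace ℝ (Fin (n + 1)))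
      / (1 + inner ℝ (p : EuclideanSpace ℝ (Fin (n + 1))) (q : EuclideanSpace ℝ (Fin (n + 1)))) := by
  have := Fact.mk (@finrank_euclideanSpace_fin ℝ _ (n + 1))
  set U := (OrthonormalBasis.fromOrthogonalSpanSingleton (𝕜 := ℝ) n
    (ne_zero_of_mem_unit_sphere (-p))) with hU
  have h : extChartAt (𝓡 n) p q = U.repr (stereoToFun ((-p : Sph n) : EuclideanSpace ℝ (Fin (n + 1))) q) := rfl
  rw [h, U.repr_apply_apply, stereoToFun_apply, real_inner_smul_right]
  have h2 : (inner ℝ (U k) ((ℝ ∙ ((-p : Sph n) : EuclideanSpace ℝ (Fin (n + 1))))ᗮ.orthogonalProjectionOnto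
      (q : EuclideanSpace ℝ (Fin (n + 1)))) : ℝ) = inner ℝ (sphFrame p k) (q : EuclideanSpace ℝ (Fin (n + 1))) :=
    Submodule.inner_orthogonalProjectionOnto_eq_of_mem_left (U k) _
  rw [h2]
  simp
  ring

lemma extChartAt_self_eq_zero (p : Sph n) : extChartAt (𝓡 n) p p = 0 := by
  ext k
  rw [extChartAt_apply_eq, (isFrame_sphFrame p).inner_base]
  simp

lemma mem_extChartAt_target (p : Sph n) (y : EuclideanSpace ℝ (Fin n)) :
    y ∈ (extChartAt (𝓡 n) p).target := by
  have := Fact.mk (@finrank_euclideanSpace_fin ℝ _ (n + 1))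
  rw [extChartAt_target]
  have : (chartAt (EuclideanSpace ℝ (Fin n)) p).target = Set.univ := stereographic'_target (-p)
  simp [this]

lemma contMDiff_coe_sph : ContMDiff (𝓡 n) 𝓘(ℝ, EuclideanSpace ℝ (Fin (n + 1))) ∞
    (fun x : Sph n => (x : EuclideanSpace ℝ (Fin (n + 1)))) := by
  have := Fact.mk (@finrank_euclideanSpace_fin ℝ _ (n + 1))
  exact contMDiff_coe_sphere

/-- By this chain rule the metric coefficients can be computed from the ordinary derivative of an
explicit map into Euclidean space. -/
lemma inclDeriv_chartSymmDeriv (p : Sph n) (y v : EuclideanSpace ℝ (Fin n)) :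
    inclDeriv ((extChartAt (𝓡 n) p).symm y) (chartSymmDeriv n p y v)
      = fderiv ℝ (stereoParam (p : EuclideanSpace ℝ (Fin (n + 1))) (sphFrame p)) y v := by
  have h1 : (fun x : Sph n => (x : EuclideanSpace ℝ (Fin (n + 1)))) ∘ (extChartAt (𝓡 n) p).symm
      = stereoParam (p : EuclideanSpace ℝ (Fin (n + 1))) (sphFrame p) := by
    funext y; exact coe_extChartAt_symm p y
  rw [← mfderiv_eq_fderiv, ← h1, mfderiv_comp y (I' := 𝓡 n)]
  · rfl
  · exact (contMDiff_coe_sph _).mdifferentiableAt (by simp)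
  · refine ((contMDiffOn_extChartAt_symm (n := ∞) p).contMDiffAt ?_).mdifferentiableAt (by simp)
    have : (extChartAt (𝓡 n) p).target = Set.univ := Set.eq_univ_of_forall (mem_extChartAt_target p)
    rw [this]; exact Filter.univ_mem

end Charts

/-! ### Perturbations of the round metric -/

section PerturbedMetric

variable {n : ℕ}

lemma hasFDerivAt_stereoParam_zero {E : Type*} [NormedAddCommGroup E] [InnerProductSpace ℝ E] (p : E)
    (e : Fin n → E) (v : EuclideanSpace ℝ (Fin n)) :
    fderiv ℝ (stereoParam p e) 0 v = ∑ k, v k • e k := by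
  have h0 : HasFDerivAt (fun y : EuclideanSpace ℝ (Fin n) => ‖y‖ ^ 2)
      (0 : EuclideanSpace ℝ (Fin n) →L[ℝ] ℝ) 0 := by
    convert! (hasStrictFDerivAt_norm_sq (0 : EuclideanSpace ℝ (Fin n))).hasFDerivAt
    simp
  have h1 : HasFDerivAt (fun y : EuclideanSpace ℝ (Fin n) => (‖y‖ ^ 2 + 4)⁻¹)
      (0 : EuclideanSpace ℝ (Fin n) →L[ℝ] ℝ) 0 := by
    convert! (hasFDerivAt_inv _).comp _ (h0.add (hasFDerivAt_const (4 : ℝ) 0)) <;> simp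
  let A : EuclideanSpace ℝ (Fin n) →L[ℝ] E :=
    ∑ k, (EuclideanSpace.proj k : EuclideanSpace ℝ (Fin n) →L[ℝ] ℝ).smulRight (e k)
  have hA : ∀ y, ∑ k, y k • e k = A y := fun y => by simp [A]
  have h2 : HasFDerivAt (fun y : EuclideanSpace ℝ (Fin n) =>
      (4 : ℝ) • ∑ k, y k • e k + (4 - ‖y‖ ^ 2) • p) ((4 : ℝ) • A) 0 := by
    simp only [hA]
    convert! (A.hasFDerivAt.const_smul (4 : ℝ)).add
      (((hasFDerivAt_const (4 : ℝ) 0).sub h0).smul (hasFDerivAt_const p 0)) using 1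
    ext w
    simp
  have h3 := h1.smul h2
  have h4 : fderiv ℝ (stereoParam p e) 0 = _ := h3.fderiv
  rw [h4, hA, norm_zero]
  simp only [add_apply, smul_apply,
    ContinuousLinearMap.smulRight_apply, zero_apply, zero_smul, add_zero,
    smul_smul]
  norm_num
  exact (hA v).symm

lemma stereoParam_zero {E : Type*} [NormedAddCommGroup E] [InnerProductSpace ℝ E] (p : E)
    (e : Fin n → E) : stereoParam p e 0 = p := by
  simp [stereoParam]

/-- Tangent vectors at p are components in the chart centred at p, and there the differential of the
inverse chart is the isometry given by the frame. The round metric at p is therefore the standard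
scalar product on components. -/
lemma inclDeriv_apply (p : Sph n) (v : EuclideanSpace ℝ (Fin n)) :
    inclDeriv p v = ∑ k, v k • sphFrame p k := by
  have h : inclDeriv p = fderiv ℝ (stereoParam (p : EuclideanSpace ℝ (Fin (n + 1))) (sphFrame p)) 0 := by
    refine ((contMDiff_coe_sph p).mdifferentiableAt (by simp)).mfderiv.trans ?_
    have h1 : writtenInExtChartAt (𝓡 n) 𝓘(ℝ, EuclideanSpace ℝ (Fin (n + 1))) p
        (fun x : Sph n => (x : EuclideanSpace ℝ (Fin (n + 1))))
          = stereoParam (p : EuclideanSpace ℝ (Fin (n + 1))) (sphFrame p) := by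
      funext y; exact coe_extChartAt_symm p y
    rw [h1, extChartAt_self_eq_zero]
    simp only [modelWithCornersSelf_coe, Set.range_id, fderivWithin_univ]
    rfl
  rw [h, hasFDerivAt_stereoParam_zero]

lemma IsFrame.inner_sum_smul {E : Type*} [NormedAddCommGroup E] [InnerProductSpace ℝ E]
    {p : E} {e : Fin n → E} (h : IsFrame p e) (v w : EuclideanSpace ℝ (Fin n)) :
    inner ℝ (∑ k, v k • e k) (∑ k, w k • e k) = (inner ℝ v w : ℝ) := by
  simp only [sum_inner, inner_sum, real_inner_smul_left, real_inner_smul_right, h.inner_eq]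
  simp [PiLp.inner_apply, mul_comm]

lemma roundForm_eq (p : Sph n) (v w : EuclideanSpace ℝ (Fin n)) :
    roundForm p v w = inner ℝ v w := by
  rw [roundForm, inclDeriv_apply, inclDeriv_apply, (isFrame_sphFrame p).inner_sum_smul]

variable {E' : Type*} [NormedAddCommGroup E'] [InnerProductSpace ℝ E']

/-- The form `⟨A v, A w⟩ + c ⟨L A v, L A w⟩`. -/
def pullForm (c : ℝ) (L : EuclideanSpace ℝ (Fin (n + 1)) →L[ℝ] E')
    (A : EuclideanSpace ℝ (Fin n) →L[ℝ] EuclideanSpace ℝ (Fin (n + 1))) :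
    EuclideanSpace ℝ (Fin n) →L[ℝ] EuclideanSpace ℝ (Fin n) →L[ℝ] ℝ :=
  (innerSL ℝ (E := EuclideanSpace ℝ (Fin (n + 1)))).bilinearComp A A
    + c • (innerSL ℝ (E := E')).bilinearComp (L.comp A) (L.comp A)

lemma pullForm_apply (c : ℝ) (L : EuclideanSpace ℝ (Fin (n + 1)) →L[ℝ] E')
    (A : EuclideanSpace ℝ (Fin n) →L[ℝ] EuclideanSpace ℝ (Fin (n + 1))) (v w) :
    pullForm c L A v w = inner ℝ (A v) (A w) + c * inner ℝ (L (A v)) (L (A w)) := by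
  simp [pullForm]

lemma contDiff_pullForm (F : EuclideanSpace ℝ (Fin (n + 1)) → ℝ) (hF : ContDiff ℝ ∞ F)
    (L : EuclideanSpace ℝ (Fin (n + 1)) →L[ℝ] E') (p : Sph n) :
    ContDiff ℝ ∞ fun y => pullForm (F (stereoParam (p : EuclideanSpace ℝ (Fin (n + 1))) (sphFrame p) y)) L
      (fderiv ℝ (stereoParam (p : EuclideanSpace ℝ (Fin (n + 1))) (sphFrame p)) y) := by
  have hX := contDiff_stereoParam (p : EuclideanSpace ℝ (Fin (n + 1))) (sphFrame p)
  have hD := hX.fderiv_right (m := ∞) (by simp)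
  refine contDiff_clm_apply_iff.2 fun v => contDiff_clm_apply_iff.2 fun w => ?_
  simp only [pullForm_apply]
  have h1 := hD.clm_apply (contDiff_const (c := v))
  have h2 := hD.clm_apply (contDiff_const (c := w))
  exact (h1.inner ℝ h2).add ((hF.comp hX).mul
    ((L.contDiff.comp h1).inner ℝ (L.contDiff.comp h2)))

/-- The form `pullForm` on the tangent spaces of the sphere. -/
def tangentForm (F : EuclideanSpace ℝ (Fin (n + 1)) → ℝ) (L : EuclideanSpace ℝ (Fin (n + 1)) →L[ℝ] E')
    (b : Sph n) : TangentSpace (𝓡 n) b →L[ℝ] TangentSpace (𝓡 n) b →L[ℝ] ℝ :=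
  pullForm (F b) L (inclDeriv b)

/-- The inverse of the tangent trivialization at p is the differential of the inverse chart, so the
local expression of the form is `pullForm` evaluated on `fderiv` of `stereoParam`, which is smooth
in the coordinates. -/
lemma contMDiff_tangentForm (F : EuclideanSpace ℝ (Fin (n + 1)) → ℝ) (hF : ContDiff ℝ ∞ F)
    (L : EuclideanSpace ℝ (Fin (n + 1)) →L[ℝ] E') :
    ContMDiff (𝓡 n) ((𝓡 n).prod 𝓘(ℝ, EuclideanSpace ℝ (Fin n) →L[ℝ] EuclideanSpace ℝ (Fin n) →L[ℝ] ℝ)) ∞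
      (fun b : Sph n => Bundle.TotalSpace.mk' (EuclideanSpace ℝ (Fin n) →L[ℝ] EuclideanSpace ℝ (Fin n) →L[ℝ] ℝ)
        (E := fun x : Sph n => TangentSpace (𝓡 n) x →L[ℝ] TangentSpace (𝓡 n) x →L[ℝ] ℝ) b
        (tangentForm F L b)) := by
  intro p
  rw [contMDiffAt_hom_bundle]
  refine ⟨contMDiffAt_id, ?_⟩
  have h1 : ContMDiffAt (𝓡 n) 𝓘(ℝ, EuclideanSpace ℝ (Fin n) →L[ℝ] EuclideanSpace ℝ (Fin n) →L[ℝ] ℝ) ∞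
      ((fun y => pullForm (F (stereoParam (p : EuclideanSpace ℝ (Fin (n + 1))) (sphFrame p) y)) L
      (fderiv ℝ (stereoParam (p : EuclideanSpace ℝ (Fin (n + 1))) (sphFrame p)) y)) ∘ extChartAt (𝓡 n) p) p :=
    ((contDiff_pullForm F hF L p).contMDiff.contMDiffAt).comp p (contMDiffAt_extChartAt (n := ∞))
  refine h1.congr_of_eventuallyEq ?_
  filter_upwards [(chartAt (EuclideanSpace ℝ (Fin n)) p).open_source.mem_nhds (mem_chart_source _ p)] with x hx
  ext v w
  have hbase : x ∈ (trivializationAt (EuclideanSpace ℝ (Fin n)) (TangentSpace (𝓡 n)) p).baseSet := by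
    simpa using hx
  refine (inCoordinates_apply_eq₂ (E₃ := Bundle.Trivial (Sph n) ℝ) hbase hbase (by simp)).trans ?_
  have hx' : (extChartAt (𝓡 n) p).symm (extChartAt (𝓡 n) p x) = x :=
    (extChartAt (𝓡 n) p).left_inv (by simpa using hx)
  have key : ∀ u : EuclideanSpace ℝ (Fin n), inclDeriv x
      ((trivializationAt (EuclideanSpace ℝ (Fin n)) (TangentSpace (𝓡 n)) p).symm x u)
      = fderiv ℝ (stereoParam (p : EuclideanSpace ℝ (Fin (n + 1))) (sphFrame p)) (extChartAt (𝓡 n) p x) u := by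
    intro u
    have h2 := congrArg (fun A => A u) (TangentBundle.symmL_trivializationAt (I := 𝓡 n) hx)
    have h3 := inclDeriv_chartSymmDeriv p (extChartAt (𝓡 n) p x) u
    rw [hx'] at h3
    refine Eq.trans ?_ h3
    have h4 : (trivializationAt (EuclideanSpace ℝ (Fin n)) (TangentSpace (𝓡 n)) p).symmL ℝ x u
        = (trivializationAt (EuclideanSpace ℝ (Fin n)) (TangentSpace (𝓡 n)) p).symm x u :=
      Bundle.Trivialization.symmL_apply _ hbase _
    refine congrArg (inclDeriv x) (h4.symm.trans (h2.trans ?_))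
    simp only [chartSymmDeriv, modelWithCornersSelf_coe, Set.range_id, mfderivWithin_univ]
    rfl
  have hX : (x : EuclideanSpace ℝ (Fin (n + 1))) = stereoParam (p : EuclideanSpace ℝ (Fin (n + 1)))
      (sphFrame p) (extChartAt (𝓡 n) p x) := by
    rw [← coe_extChartAt_symm, hx']
  have e1 : ∀ z : ℝ, (trivializationAt ℝ (Bundle.Trivial (Sph n) ℝ) p).linearMapAt ℝ x z = z :=
    fun z => by simp
  refine (e1 _).trans ?_
  simp only [Function.comp_apply]
  rw [pullForm_apply, ← key v, ← key w, ← hX]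
  exact pullForm_apply _ _ _ _ _

lemma norm_sq_le_pullForm {c : ℝ} (hc : 0 ≤ c) (L : EuclideanSpace ℝ (Fin (n + 1)) →L[ℝ] E')
    (p : Sph n) (v : EuclideanSpace ℝ (Fin n)) : ‖v‖ ^ 2 ≤ pullForm c L (inclDeriv p) v v := by
  have h : inner ℝ (inclDeriv p v) (inclDeriv p v) = (inner ℝ v v : ℝ) := roundForm_eq p v v
  have h2 : (0 : ℝ) ≤ inner ℝ (L (inclDeriv p v)) (L (inclDeriv p v)) := real_inner_self_nonneg
  rw [pullForm_apply, h, real_inner_self_eq_norm_sq v]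
  nlinarith [mul_nonneg hc h2]

/-- The metric `⟨v, w⟩ + F ⟨L v, L w⟩` on the sphere. -/
def pertMetric (F : EuclideanSpace ℝ (Fin (n + 1)) → ℝ) (hF : ContDiff ℝ ∞ F) (hF0 : ∀ x, 0 ≤ F x)
    (L : EuclideanSpace ℝ (Fin (n + 1)) →L[ℝ] E') : SmoothMetric n (Sph n) where
  inner := tangentForm F L
  symm b v w := by
    refine (pullForm_apply _ _ _ _ _).trans (Eq.trans ?_ (pullForm_apply _ _ _ _ _).symm)
    rw [real_inner_comm, real_inner_comm (L _)]
  pos b v hv :=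
    lt_of_lt_of_le (pow_pos (norm_pos_iff.2 (show (show EuclideanSpace ℝ (Fin n) from v) ≠ 0 from hv)) 2)
      (norm_sq_le_pullForm (hF0 b) L b v)
  isVonNBounded b := by
    refine Bornology.IsVonNBounded.subset (fun v hv => ?_)
      (NormedSpace.isVonNBounded_ball ℝ (EuclideanSpace ℝ (Fin n)) 1)
    have h := (norm_sq_le_pullForm (hF0 b) L b v).trans_lt hv
    exact mem_ball_zero_iff.2 ((sq_lt_one_iff₀ (norm_nonneg _)).1 h)
  contMDiff := contMDiff_tangentForm F hF L

lemma metricForm_pertMetric (F : EuclideanSpace ℝ (Fin (n + 1)) → ℝ) (hF : ContDiff ℝ ∞ F)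
    (hF0 : ∀ x, 0 ≤ F x) (L : EuclideanSpace ℝ (Fin (n + 1)) →L[ℝ] E') (q : Sph n)
    (v w : EuclideanSpace ℝ (Fin n)) :
    metricForm (pertMetric F hF hF0 L) q v w = inner ℝ (inclDeriv q v) (inclDeriv q w)
      + F q * inner ℝ (L (inclDeriv q v)) (L (inclDeriv q w)) :=
  pullForm_apply _ _ _ _ _

lemma metricMatrix_pertMetric (F : EuclideanSpace ℝ (Fin (n + 1)) → ℝ) (hF : ContDiff ℝ ∞ F)
    (hF0 : ∀ x, 0 ≤ F x) (L : EuclideanSpace ℝ (Fin (n + 1)) →L[ℝ] E') (p : Sph n)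
    (y : EuclideanSpace ℝ (Fin n)) (i j : Fin n) :
    metricMatrix (pertMetric F hF hF0 L) p y i j =
      inner ℝ (fderiv ℝ (stereoParam (p : EuclideanSpace ℝ (Fin (n + 1))) (sphFrame p)) y (coordVec i))
        (fderiv ℝ (stereoParam (p : EuclideanSpace ℝ (Fin (n + 1))) (sphFrame p)) y (coordVec j))
      + F (stereoParam (p : EuclideanSpace ℝ (Fin (n + 1))) (sphFrame p) y) *
        inner ℝ (L (fderiv ℝ (stereoParam (p : EuclideanSpace ℝ (Fin (n + 1))) (sphFrame p)) y (coordVec i)))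
        (L (fderiv ℝ (stereoParam (p : EuclideanSpace ℝ (Fin (n + 1))) (sphFrame p)) y (coordVec j))) := by
  rw [metricMatrix, Matrix.of_apply, metricForm_pertMetric, inclDeriv_chartSymmDeriv,
    inclDeriv_chartSymmDeriv, coe_extChartAt_symm]

end PerturbedMetric

/-! ### The Ricci tensor in terms of the two-jet of the metric -/

section Jets

variable {n : ℕ}

lemma differentiableAt_det {V ι : Type*} [NormedAddCommGroup V] [NormedSpace ℝ V] [Fintype ι]
    [DecidableEq ι] {G : V → Matrix ι ι ℝ} {y : V} (h : ∀ i j, DifferentiableAt ℝ (fun z => G z i j) y) :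
    DifferentiableAt ℝ (fun z => (G z).det) y := by
  simp only [Matrix.det_apply]
  refine DifferentiableAt.fun_sum fun σ _ => DifferentiableAt.const_smul ?_ _
  have h1 : ∀ s : Finset ι, DifferentiableAt ℝ (fun z => ∏ i ∈ s, G z (σ i) i) y := by
    intro s
    induction s using Finset.cons_induction with
    | empty => simp
    | cons a s ha ih => simpa only [Finset.prod_cons] using (h _ _).fun_mul ih
  exact h1 _

lemma differentiableAt_matrix_inv {V ι : Type*} [NormedAddCommGroup V] [NormedSpace ℝ V] [Fintype ι]
    [DecidableEq ι] {G : V → Matrix ι ι ℝ} {y : V} (h : ∀ i j, DifferentiableAt ℝ (fun z => G z i j) y)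
    (hdet : (G y).det ≠ 0) (i j : ι) : DifferentiableAt ℝ (fun z => (G z)⁻¹ i j) y := by
  simp only [Matrix.inv_def, Ring.inverse_eq_inv', Matrix.smul_apply, smul_eq_mul]
  refine ((differentiableAt_det h).inv hdet).mul ?_
  simp only [Matrix.adjugate_apply]
  refine differentiableAt_det fun a b => ?_
  by_cases hab : a = j
  · subst hab; simp
  · simpa [Matrix.updateRow_ne hab] using h a b

/-- Differentiate G⁻¹G = 1, which holds near y because the determinant stays nonzero there. -/
lemma fderiv_matrix_inv {V ι : Type*} [NormedAddCommGroup V] [NormedSpace ℝ V] [Fintype ι]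
    [DecidableEq ι] {G : V → Matrix ι ι ℝ} {y : V} (h : ∀ i j, DifferentiableAt ℝ (fun z => G z i j) y)
    (hdet : (G y).det ≠ 0) (i j : ι) (v : V) :
    fderiv ℝ (fun z => (G z)⁻¹ i j) y v
      = -∑ a, ∑ b, (G y)⁻¹ i a * fderiv ℝ (fun z => G z a b) y v * (G y)⁻¹ b j := by
  have hi := differentiableAt_matrix_inv h hdet
  have hev : ∀ᶠ z in nhds y, (G z).det ≠ 0 :=
    (differentiableAt_det h).continuousAt.eventually_ne hdet
  let D : Matrix ι ι ℝ := Matrix.of fun a b => fderiv ℝ (fun z => (G z)⁻¹ a b) y v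
  let B : Matrix ι ι ℝ := Matrix.of fun a b => fderiv ℝ (fun z => G z a b) y v
  have key : D * G y + (G y)⁻¹ * B = 0 := by
    ext a c
    have h1 : (fun z => ∑ b, (G z)⁻¹ a b * G z b c) =ᶠ[nhds y] fun _ => (1 : Matrix ι ι ℝ) a c := by
      filter_upwards [hev] with z hz
      rw [← Matrix.mul_apply, Matrix.nonsing_inv_mul _ (isUnit_iff_ne_zero.2 hz)]
    have h2 := h1.fderiv_eq (𝕜 := ℝ)
    rw [fderiv_fun_sum fun b _ => (hi a b).fun_mul (h b c)] at h2
    have h3 := congrArg (fun T => T v) h2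
    simp only [fderiv_fun_const, Pi.zero_apply, sum_apply, zero_apply] at h3
    rw [Matrix.zero_apply, ← h3]
    simp only [Matrix.add_apply, Matrix.mul_apply, D, B, Matrix.of_apply, ← Finset.sum_add_distrib]
    refine Finset.sum_congr rfl fun b _ => ?_
    rw [fderiv_fun_mul (hi a b) (h b c)]
    simp only [add_apply, smul_apply, smul_eq_mul]
    ring
  have hu : IsUnit (G y).det := isUnit_iff_ne_zero.2 hdet
  have h4 : D = -((G y)⁻¹ * B * (G y)⁻¹) := by
    have h5 : D * G y = -((G y)⁻¹ * B) := eq_neg_of_add_eq_zero_left key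
    have h6 : D * G y * (G y)⁻¹ = D := by rw [mul_assoc, Matrix.mul_nonsing_inv _ hu, mul_one]
    rw [← h6, h5, neg_mul]
  have h7 := congrFun (congrFun h4 i) j
  rw [Matrix.neg_apply, Matrix.mul_apply] at h7
  refine h7.trans (congrArg _ ?_)
  simp only [Matrix.mul_apply, Finset.sum_mul]
  rw [Finset.sum_comm]
  rfl

/-- The Christoffel symbols as functions of the inverse metric and the first derivatives
`B k i j = ∂ₖ gᵢⱼ`. -/
def christoffelJet (A : Matrix (Fin n) (Fin n) ℝ) (B : Fin n → Fin n → Fin n → ℝ) (k i j : Fin n) : ℝ :=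
  (1 / 2 : ℝ) * ∑ l, A k l * (B i j l + B j i l - B l i j)

/-- The derivatives of the Christoffel symbols as functions of the inverse metric, the first
derivatives `B k i j = ∂ₖ gᵢⱼ` and the second derivatives `C l k i j = ∂ₗ∂ₖ gᵢⱼ`. -/
def christoffelDerivJet (A : Matrix (Fin n) (Fin n) ℝ) (B : Fin n → Fin n → Fin n → ℝ)
    (C : Fin n → Fin n → Fin n → Fin n → ℝ) (m k i j : Fin n) : ℝ :=
  (1 / 2 : ℝ) * ∑ l, ((-∑ a, ∑ b, A k a * B m a b * A b l) * (B i j l + B j i l - B l i j)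
    + A k l * (C m i j l + C m j i l - C m l i j))

/-- The Ricci tensor as a function of the inverse metric and the derivatives of the metric. -/
def ricciJet (A : Matrix (Fin n) (Fin n) ℝ) (B : Fin n → Fin n → Fin n → ℝ)
    (C : Fin n → Fin n → Fin n → Fin n → ℝ) (i j : Fin n) : ℝ :=
  ∑ k, (christoffelDerivJet A B C k k i j - christoffelDerivJet A B C j k i k)
    + ∑ k, ∑ l, (christoffelJet A B k k l * christoffelJet A B l i j
      - christoffelJet A B k j l * christoffelJet A B l i k)

variable {M : Type*} [TopologicalSpace M] [ChartedSpace (EuclideanSpace ℝ (Fin n)) M]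
  [IsManifold (𝓡 n) ∞ M]

lemma christoffel_eq_jet (g : SmoothMetric n M) (p : M) (y : EuclideanSpace ℝ (Fin n)) (k i j : Fin n) :
    christoffel g p k i j y = christoffelJet (metricMatrix g p y)⁻¹
      (fun k i j => partialDeriv k (fun z => metricMatrix g p z i j) y) k i j := rfl

lemma contDiff_partialDeriv {f : EuclideanSpace ℝ (Fin n) → ℝ} (hf : ContDiff ℝ ∞ f) (i : Fin n) :
    ContDiff ℝ ∞ (partialDeriv i f) :=
  (hf.fderiv_right (m := ∞) (by simp)).clm_apply contDiff_const

lemma partialDeriv_christoffel (g : SmoothMetric n M) (p : M) (y : EuclideanSpace ℝ (Fin n))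
    (hG : ∀ i j, ContDiff ℝ ∞ fun z => metricMatrix g p z i j)
    (hdet : (metricMatrix g p y).det ≠ 0) (m k i j : Fin n) :
    partialDeriv m (christoffel g p k i j) y = christoffelDerivJet (metricMatrix g p y)⁻¹
      (fun k i j => partialDeriv k (fun z => metricMatrix g p z i j) y)
      (fun l k i j => partialDeriv l (partialDeriv k fun z => metricMatrix g p z i j) y) m k i j := by
  have hd : ∀ i j, DifferentiableAt ℝ (fun z => metricMatrix g p z i j) y := fun i j =>
    (hG i j).differentiable (by simp) y
  have hB : ∀ k i j, DifferentiableAt ℝ (partialDeriv k fun z => metricMatrix g p z i j) y :=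
    fun k i j => (contDiff_partialDeriv (hG i j) k).differentiable (by simp) y
  have hi := differentiableAt_matrix_inv hd hdet
  have hS : ∀ l, DifferentiableAt ℝ (fun z => partialDeriv i (fun z => metricMatrix g p z j l) z
      + partialDeriv j (fun z => metricMatrix g p z i l) z
      - partialDeriv l (fun z => metricMatrix g p z i j) z) y := fun l =>
    ((hB i j l).fun_add (hB j i l)).fun_sub (hB l i j)
  have h1 := (HasFDerivAt.fun_sum (u := Finset.univ) fun l _ =>
    ((hi k l).fun_mul (hS l)).hasFDerivAt).const_mul (1 / 2 : ℝ)
  have h2 : partialDeriv m (christoffel g p k i j) y = _ :=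
    congrArg (fun T => T (coordVec m)) h1.fderiv
  rw [h2]
  simp only [smul_apply, smul_eq_mul, sum_apply, christoffelDerivJet]
  congr 1
  refine Finset.sum_congr rfl fun l _ => ?_
  rw [fderiv_fun_mul (hi k l) (hS l)]
  simp only [add_apply, smul_apply, smul_eq_mul]
  rw [fderiv_matrix_inv hd hdet, fderiv_fun_sub ((hB i j l).fun_add (hB j i l)) (hB l i j),
    fderiv_fun_add (hB i j l) (hB j i l)]
  simp only [add_apply, sub_apply]
  rw [add_comm]
  congr 1
  exact mul_comm _ _

/-- Turns curvature into an explicit algebraic expression in the inverse metric and the derivatives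
of the metric, which may then be treated as independent variables. -/
lemma ricciMatrix_eq_jet (g : SmoothMetric n M) (p : M) (y : EuclideanSpace ℝ (Fin n))
    (hG : ∀ i j, ContDiff ℝ ∞ fun z => metricMatrix g p z i j)
    (hdet : (metricMatrix g p y).det ≠ 0) (i j : Fin n) :
    ricciMatrix g p i j y = ricciJet (metricMatrix g p y)⁻¹
      (fun k i j => partialDeriv k (fun z => metricMatrix g p z i j) y)
      (fun l k i j => partialDeriv l (partialDeriv k fun z => metricMatrix g p z i j) y) i j := by
  simp only [ricciMatrix, ricciJet, partialDeriv_christoffel g p y hG hdet, christoffel_eq_jet]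

end Jets

/-! ### The two-jet of the perturbed metric -/

section StereoJets

variable {n : ℕ} {E : Type*} [NormedAddCommGroup E] [InnerProductSpace ℝ E]

/-- The linear map with matrix columns `e`. -/
def frameMap (e : Fin n → E) : EuclideanSpace ℝ (Fin n) →L[ℝ] E :=
  ∑ k, (EuclideanSpace.proj k : EuclideanSpace ℝ (Fin n) →L[ℝ] ℝ).smulRight (e k)

lemma frameMap_apply (e : Fin n → E) (v : EuclideanSpace ℝ (Fin n)) :
    frameMap e v = ∑ k, v k • e k := by
  simp [frameMap]

lemma frameMap_coordVec (e : Fin n → E) (i : Fin n) : frameMap e (coordVec i) = e i := by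
  simp [frameMap_apply, PiLp.single_apply]

lemma stereoParam_eq (p : E) (e : Fin n → E) (y : EuclideanSpace ℝ (Fin n)) :
    stereoParam p e y = (‖y‖ ^ 2 + 4)⁻¹ • ((4 : ℝ) • frameMap e y + (4 - ‖y‖ ^ 2) • p) := by
  rw [frameMap_apply]; rfl

lemma hasFDerivAt_norm_sq_add_inv (y : EuclideanSpace ℝ (Fin n)) :
    HasFDerivAt (fun y : EuclideanSpace ℝ (Fin n) => (‖y‖ ^ 2 + 4)⁻¹)
      ((-2 * (‖y‖ ^ 2 + 4)⁻¹ ^ 2) • innerSL ℝ y) y := by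
  have h0 : HasFDerivAt (fun y : EuclideanSpace ℝ (Fin n) => ‖y‖ ^ 2 + 4) (2 • innerSL ℝ y) y :=
    (hasStrictFDerivAt_norm_sq y).hasFDerivAt.add_const 4
  refine ((hasDerivAt_inv (by positivity : ‖y‖ ^ 2 + 4 ≠ 0)).comp_hasFDerivAt y h0).congr_fderiv ?_
  ext v
  simp only [smul_apply, smul_eq_mul, inv_pow, nsmul_eq_mul, Nat.cast_ofNat]
  ring

lemma fderiv_stereoParam (p : E) (e : Fin n → E) (y v : EuclideanSpace ℝ (Fin n)) :
    fderiv ℝ (stereoParam p e) y v = (4 * (‖y‖ ^ 2 + 4)⁻¹) • frameMap e v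
      - (8 * (‖y‖ ^ 2 + 4)⁻¹ ^ 2 * inner ℝ y v) • frameMap e y
      - (16 * (‖y‖ ^ 2 + 4)⁻¹ ^ 2 * inner ℝ y v) • p := by
  have h0 : HasFDerivAt (fun y : EuclideanSpace ℝ (Fin n) => ‖y‖ ^ 2) (2 • innerSL ℝ y) y :=
    (hasStrictFDerivAt_norm_sq y).hasFDerivAt
  have h1 := hasFDerivAt_norm_sq_add_inv y
  have h2 : HasFDerivAt (fun y : EuclideanSpace ℝ (Fin n) =>
      (4 : ℝ) • frameMap e y + (4 - ‖y‖ ^ 2) • p) _ y :=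
    ((frameMap e).hasFDerivAt.const_smul (4 : ℝ)).add ((h0.const_sub 4).smul_const p)
  have h3 : HasFDerivAt (stereoParam p e) _ y :=
    (h1.smul h2).congr_of_eventuallyEq (Filter.Eventually.of_forall fun z => stereoParam_eq p e z)
  rw [h3.fderiv]
  have hc : (‖y‖ ^ 2 + 4) * (‖y‖ ^ 2 + 4)⁻¹ = 1 := mul_inv_cancel₀ (by positivity)
  set c := (‖y‖ ^ 2 + 4)⁻¹ with hcdef
  have hr : ‖y‖ ^ 2 * c = 1 - 4 * c := by linarith
  clear_value c
  simp only [add_apply, smul_apply, ContinuousLinearMap.smulRight_apply, neg_apply,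
    innerSL_apply_apply, smul_eq_mul, nsmul_eq_mul, Nat.cast_ofNat]
  match_scalars
  · ring
  · linear_combination (2 * c * inner ℝ y v) * hr
  · ring

lemma IsFrame.inner_frameMap {p : E} {e : Fin n → E} (h : IsFrame p e) (v w : EuclideanSpace ℝ (Fin n)) :
    inner ℝ (frameMap e v) (frameMap e w) = (inner ℝ v w : ℝ) := by
  rw [frameMap_apply, frameMap_apply, h.inner_sum_smul]

lemma IsFrame.inner_frameMap_base {p : E} {e : Fin n → E} (h : IsFrame p e)
    (v : EuclideanSpace ℝ (Fin n)) : inner ℝ (frameMap e v) p = (0 : ℝ) := by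
  simp [frameMap_apply, sum_inner, real_inner_smul_left, h.inner_base]

lemma IsFrame.inner_fderiv_stereoParam {p : E} {e : Fin n → E} (h : IsFrame p e)
    (y u v : EuclideanSpace ℝ (Fin n)) :
    inner ℝ (fderiv ℝ (stereoParam p e) y u) (fderiv ℝ (stereoParam p e) y v)
      = 16 * (‖y‖ ^ 2 + 4)⁻¹ ^ 2 * (inner ℝ u v : ℝ) := by
  have hb : ∀ v, (inner ℝ p (frameMap e v) : ℝ) = 0 := fun v => by
    rw [real_inner_comm, h.inner_frameMap_base]
  have hp : (inner ℝ p p : ℝ) = 1 := by rw [real_inner_self_eq_norm_sq, h.norm_base]; norm_num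
  have hc : (‖y‖ ^ 2 + 4) * (‖y‖ ^ 2 + 4)⁻¹ = 1 := mul_inv_cancel₀ (by positivity)
  simp only [fderiv_stereoParam, inner_sub_left, inner_sub_right, real_inner_smul_left,
    real_inner_smul_right, h.inner_frameMap, h.inner_frameMap_base, hb, hp,
    real_inner_self_eq_norm_sq y, real_inner_comm y u]
  set c := (‖y‖ ^ 2 + 4)⁻¹ with hcdef
  have hr : ‖y‖ ^ 2 * c = 1 - 4 * c := by linarith
  clear_value c
  linear_combination (64 * c ^ 3 * inner ℝ y u * inner ℝ y v) * hr

/-- This is the second fundamental form of the unit sphere: the second derivative at the centre has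
no tangential part. -/
lemma fderiv_fderiv_stereoParam_zero (p : E) (e : Fin n → E) (u v : EuclideanSpace ℝ (Fin n)) :
    fderiv ℝ (fun y => fderiv ℝ (stereoParam p e) y u) 0 v = -(inner ℝ u v : ℝ) • p := by
  have h1 := hasFDerivAt_norm_sq_add_inv (0 : EuclideanSpace ℝ (Fin n))
  have h2 : HasFDerivAt (fun y : EuclideanSpace ℝ (Fin n) => (inner ℝ y u : ℝ)) (innerSL ℝ u) 0 := by
    simp only [real_inner_comm u]
    exact (innerSL ℝ u).hasFDerivAt
  have h3 := (frameMap e).hasFDerivAt (x := 0)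
  have h4 := (((h1.const_mul 4).smul_const (frameMap e u)).sub
    ((((h1.pow 2).const_mul 8).mul h2).smul h3)).sub
    ((((h1.pow 2).const_mul 16).mul h2).smul_const p)
  have h5 : HasFDerivAt (fun y => fderiv ℝ (stereoParam p e) y u) _ 0 :=
    h4.congr_of_eventuallyEq (Filter.Eventually.of_forall fun z => by
      simp [fderiv_stereoParam])
  rw [h5.fderiv]
  simp [-neg_smul]
  norm_num

lemma partialDeriv_conformal (k : Fin n) (d : ℝ) (y : EuclideanSpace ℝ (Fin n)) :
    partialDeriv k (fun z => 16 * (‖z‖ ^ 2 + 4)⁻¹ ^ 2 * d) y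
      = (-64 * d) * ((‖y‖ ^ 2 + 4)⁻¹ ^ 3 * y k) := by
  have h := (((hasFDerivAt_norm_sq_add_inv y).pow 2).const_mul 16).mul_const d
  rw [partialDeriv, h.fderiv]
  simp only [smul_apply, innerSL_apply_apply, smul_eq_mul, PiLp.inner_apply]
  simp [PiLp.single_apply, -inv_pow]
  ring

lemma partialDeriv_partialDeriv_conformal_zero (l k : Fin n) (d : ℝ) :
    partialDeriv l (partialDeriv k fun z : EuclideanSpace ℝ (Fin n) =>
      16 * (‖z‖ ^ 2 + 4)⁻¹ ^ 2 * d) 0 = -(if l = k then d else 0) := by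
  rw [funext (partialDeriv_conformal k d)]
  have h := (((hasFDerivAt_norm_sq_add_inv (0 : EuclideanSpace ℝ (Fin n))).pow 3).mul
    (EuclideanSpace.proj (𝕜 := ℝ) k).hasFDerivAt).const_mul (-64 * d)
  have h' : fderiv ℝ (fun y : EuclideanSpace ℝ (Fin n) => (-64 * d) * ((‖y‖ ^ 2 + 4)⁻¹ ^ 3 * y k)) 0
    = _ := h.fderiv
  rw [partialDeriv, h']
  simp [PiLp.single_apply, eq_comm (a := k)]
  split_ifs <;> ring

end StereoJets

/-! ### The perturbation in stereographic coordinates and its dependence on point and frame -/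

section PerturbationJets

variable {n : ℕ} {E E' : Type*} [NormedAddCommGroup E] [InnerProductSpace ℝ E]
  [NormedAddCommGroup E'] [InnerProductSpace ℝ E']

lemma partialDeriv_add {f g : EuclideanSpace ℝ (Fin n) → ℝ} (hf : ContDiff ℝ ∞ f) (hg : ContDiff ℝ ∞ g)
    (k : Fin n) (y : EuclideanSpace ℝ (Fin n)) :
    partialDeriv k (fun z => f z + g z) y = partialDeriv k f y + partialDeriv k g y := by
  rw [partialDeriv, fderiv_fun_add (hf.differentiable (by simp) y) (hg.differentiable (by simp) y)]
  rfl

lemma partialDeriv_mul {f g : EuclideanSpace ℝ (Fin n) → ℝ} (hf : ContDiff ℝ ∞ f) (hg : ContDiff ℝ ∞ g)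
    (k : Fin n) (y : EuclideanSpace ℝ (Fin n)) :
    partialDeriv k (fun z => f z * g z) y = partialDeriv k f y * g y + f y * partialDeriv k g y := by
  rw [partialDeriv, fderiv_fun_mul (hf.differentiable (by simp) y) (hg.differentiable (by simp) y)]
  simp only [add_apply, smul_apply, smul_eq_mul, partialDeriv]
  ring

lemma partialDeriv_comp {φ : ℝ → ℝ} {s : EuclideanSpace ℝ (Fin n) → ℝ} (hφ : ContDiff ℝ ∞ φ)
    (hs : ContDiff ℝ ∞ s) (k : Fin n) (y : EuclideanSpace ℝ (Fin n)) :
    partialDeriv k (fun z => φ (s z)) y = deriv φ (s y) * partialDeriv k s y := by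
  have h := (hφ.differentiable (by simp) (s y)).hasDerivAt.comp_hasFDerivAt y
    (hs.differentiable (by simp) y).hasFDerivAt
  have h' : fderiv ℝ (fun z => φ (s z)) y = _ := h.fderiv
  rw [partialDeriv, h']
  rfl

/-- The tensor `η ⟨L ·, L ·⟩` in the stereographic coordinates given by `p` and `e`. -/
def stereoTensor (η : E → ℝ) (L : E →L[ℝ] E') (p : E) (e : Fin n → E) (i j : Fin n)
    (y : EuclideanSpace ℝ (Fin n)) : ℝ :=
  η (stereoParam p e y) * inner ℝ (L (fderiv ℝ (stereoParam p e) y (coordVec i)))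
    (L (fderiv ℝ (stereoParam p e) y (coordVec j)))

/-- The linear function `⟨ν, ·⟩` in the stereographic coordinates given by `p` and `e`. -/
def stereoHeight (ν : E) (p : E) (e : Fin n → E) (y : EuclideanSpace ℝ (Fin n)) : ℝ :=
  inner ℝ ν (stereoParam p e y)

/-- The frame of the preferred chart is a mere choice at each point, with no continuity in p
available. Base point and frame are therefore independent variables, and smoothness is proved
jointly in all of them. -/
lemma contDiff_stereoParam_uncurry :
    ContDiff ℝ ∞ fun z : (E × (Fin n → E)) × EuclideanSpace ℝ (Fin n) => stereoParam z.1.1 z.1.2 z.2 := by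
  have h : ContDiff ℝ ∞ fun z : (E × (Fin n → E)) × EuclideanSpace ℝ (Fin n) => ‖z.2‖ ^ 2 :=
    (contDiff_norm_sq ℝ).comp contDiff_snd
  unfold stereoParam
  refine ContDiff.smul (ContDiff.inv (h.add contDiff_const) fun y => by positivity) ?_
  refine (contDiff_const.smul (ContDiff.sum fun k _ => ?_)).add
    ((contDiff_const.sub h).smul (by fun_prop))
  fun_prop

lemma contDiff_fderiv_snd {Z V G : Type*} [NormedAddCommGroup Z] [NormedSpace ℝ Z]
    [NormedAddCommGroup V] [NormedSpace ℝ V] [NormedAddCommGroup G] [NormedSpace ℝ G]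
    {f : Z × V → G} (hf : ContDiff ℝ ∞ f) (v : V) :
    ContDiff ℝ ∞ fun z : Z × V => fderiv ℝ (fun y => f (z.1, y)) z.2 v := by
  have h : ContDiff ℝ ∞ (Function.uncurry fun (z : Z × V) (y : V) => f (z.1, y)) := by
    exact hf.comp ((contDiff_fst.comp contDiff_fst).prodMk contDiff_snd)
  exact (ContDiff.fderiv (n := ∞) h contDiff_snd (by simp)).clm_apply contDiff_const

lemma contDiff_stereoTensor_uncurry {η : E → ℝ} (hη : ContDiff ℝ ∞ η) (L : E →L[ℝ] E') (i j : Fin n) :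
    ContDiff ℝ ∞ fun z : (E × (Fin n → E)) × EuclideanSpace ℝ (Fin n) =>
      stereoTensor η L z.1.1 z.1.2 i j z.2 := by
  have hX := contDiff_stereoParam_uncurry (E := E) (n := n)
  have hD := fun i : Fin n => contDiff_fderiv_snd hX (coordVec i)
  exact (hη.comp hX).mul ((L.contDiff.comp (hD i)).inner ℝ (L.contDiff.comp (hD j)))

lemma contDiff_stereoHeight_uncurry (ν : E) :
    ContDiff ℝ ∞ fun z : (E × (Fin n → E)) × EuclideanSpace ℝ (Fin n) =>
      stereoHeight ν z.1.1 z.1.2 z.2 :=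
  contDiff_const.inner ℝ contDiff_stereoParam_uncurry

lemma contDiff_partialDeriv_uncurry {Z : Type*} [NormedAddCommGroup Z] [NormedSpace ℝ Z]
    {f : Z → EuclideanSpace ℝ (Fin n) → ℝ}
    (hf : ContDiff ℝ ∞ fun z : Z × EuclideanSpace ℝ (Fin n) => f z.1 z.2) (k : Fin n) :
    ContDiff ℝ ∞ fun z : Z × EuclideanSpace ℝ (Fin n) => partialDeriv k (f z.1) z.2 :=
  contDiff_fderiv_snd hf (coordVec k)

lemma contDiff_uncurry_right {Z V G : Type*} [NormedAddCommGroup Z] [NormedSpace ℝ Z]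
    [NormedAddCommGroup V] [NormedSpace ℝ V] [NormedAddCommGroup G] [NormedSpace ℝ G]
    {f : Z → V → G} (hf : ContDiff ℝ ∞ fun z : Z × V => f z.1 z.2) (z : Z) : ContDiff ℝ ∞ (f z) :=
  hf.comp (contDiff_const.prodMk contDiff_id)

lemma continuous_uncurry_left {Z V G : Type*} [NormedAddCommGroup Z] [NormedSpace ℝ Z]
    [NormedAddCommGroup V] [NormedSpace ℝ V] [NormedAddCommGroup G] [NormedSpace ℝ G]
    {f : Z → V → G} (hf : ContDiff ℝ ∞ fun z : Z × V => f z.1 z.2) (y : V) :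
    Continuous fun z => f z y :=
  (hf.comp (contDiff_id.prodMk contDiff_const)).continuous

/-- The matrix at the centre of the chart of the round metric plus `x ⟨L ·, L ·⟩ η`. -/
def pertMatrix (η : E → ℝ) (L : E →L[ℝ] E') (p : E) (e : Fin n → E) (x : ℝ) : Matrix (Fin n) (Fin n) ℝ :=
  Matrix.of fun i j => (if i = j then 1 else 0) + x * stereoTensor η L p e i j 0

/-- The first derivatives at the centre of the chart of the round metric plus
`φ(⟨ν, ·⟩) η ⟨L ·, L ·⟩`, where `φ` has the one-jet `x`. -/
def pertJetOne (η : E → ℝ) (L : E →L[ℝ] E') (ν p : E) (e : Fin n → E) (x : Fin 3 → ℝ) (k i j : Fin n) : ℝ :=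
  x 1 * partialDeriv k (stereoHeight ν p e) 0 * stereoTensor η L p e i j 0
    + x 0 * partialDeriv k (stereoTensor η L p e i j) 0

/-- The second derivatives at the centre of the chart of the round metric plus
`φ(⟨ν, ·⟩) η ⟨L ·, L ·⟩`, where `φ` has the two-jet `x`. -/
def pertJetTwo (η : E → ℝ) (L : E →L[ℝ] E') (ν p : E) (e : Fin n → E) (x : Fin 3 → ℝ)
    (l k i j : Fin n) : ℝ :=
  -(if l = k then if i = j then 1 else 0 else 0)
    + ((x 2 * partialDeriv l (stereoHeight ν p e) 0 * partialDeriv k (stereoHeight ν p e) 0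
      + x 1 * partialDeriv l (partialDeriv k (stereoHeight ν p e)) 0) * stereoTensor η L p e i j 0
      + x 1 * partialDeriv k (stereoHeight ν p e) 0 * partialDeriv l (stereoTensor η L p e i j) 0
      + x 1 * partialDeriv l (stereoHeight ν p e) 0 * partialDeriv k (stereoTensor η L p e i j) 0
      + x 0 * partialDeriv l (partialDeriv k (stereoTensor η L p e i j)) 0)

/-- The two-jet of a function. -/
def twoJet (φ : ℝ → ℝ) (s : ℝ) : Fin 3 → ℝ := ![φ s, deriv φ s, deriv (deriv φ) s]

section

variable {η : EuclideanSpace ℝ (Fin (n + 1)) → ℝ} {φ : ℝ → ℝ} {ν : EuclideanSpace ℝ (Fin (n + 1))}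

lemma contDiff_profile (hφ : ContDiff ℝ ∞ φ) (hη : ContDiff ℝ ∞ η) :
    ContDiff ℝ ∞ fun x : EuclideanSpace ℝ (Fin (n + 1)) => φ (inner ℝ ν x) * η x :=
  (hφ.comp (contDiff_const.inner ℝ contDiff_id)).mul hη

variable (hφ : ContDiff ℝ ∞ φ) (hη : ContDiff ℝ ∞ η)
  (h0 : ∀ x : EuclideanSpace ℝ (Fin (n + 1)), 0 ≤ φ (inner ℝ ν x) * η x)
  (L : EuclideanSpace ℝ (Fin (n + 1)) →L[ℝ] E')

lemma metricMatrix_pertMetric_profile (p : Sph n) (i j : Fin n) :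
    (fun y => metricMatrix (pertMetric _ (contDiff_profile hφ hη) h0 L) p y i j)
      = fun y => 16 * (‖y‖ ^ 2 + 4)⁻¹ ^ 2 * (if i = j then 1 else 0)
        + φ (stereoHeight ν (p : EuclideanSpace ℝ (Fin (n + 1))) (sphFrame p) y)
          * stereoTensor η L (p : EuclideanSpace ℝ (Fin (n + 1))) (sphFrame p) i j y := by
  funext y
  rw [metricMatrix_pertMetric, (isFrame_sphFrame p).inner_fderiv_stereoParam, stereoTensor, stereoHeight]
  have : (inner ℝ (coordVec i) (coordVec j) : ℝ) = if i = j then 1 else 0 := by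
    simp [EuclideanSpace.inner_single_left, PiLp.single_apply]
  rw [this]
  ring

lemma contDiff_conformal (d : ℝ) :
    ContDiff ℝ ∞ fun z : EuclideanSpace ℝ (Fin n) => 16 * (‖z‖ ^ 2 + 4)⁻¹ ^ 2 * d := by
  have h : ContDiff ℝ ∞ fun y : EuclideanSpace ℝ (Fin n) => (‖y‖ ^ 2 + 4)⁻¹ :=
    ((contDiff_norm_sq ℝ).add contDiff_const).inv fun y => by positivity
  exact (contDiff_const.mul (h.pow 2)).mul contDiff_const

lemma contDiff_stereoTensor (hη : ContDiff ℝ ∞ η) (p : EuclideanSpace ℝ (Fin (n + 1)))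
    (e : Fin n → EuclideanSpace ℝ (Fin (n + 1))) (i j : Fin n) :
    ContDiff ℝ ∞ (stereoTensor η L p e i j) :=
  contDiff_uncurry_right (f := fun z : EuclideanSpace ℝ (Fin (n + 1)) ×
    (Fin n → EuclideanSpace ℝ (Fin (n + 1))) => stereoTensor η L z.1 z.2 i j)
    (contDiff_stereoTensor_uncurry hη L i j) (p, e)

lemma contDiff_stereoHeight (p : EuclideanSpace ℝ (Fin (n + 1)))
    (e : Fin n → EuclideanSpace ℝ (Fin (n + 1))) : ContDiff ℝ ∞ (stereoHeight ν p e) :=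
  contDiff_uncurry_right (f := fun z : EuclideanSpace ℝ (Fin (n + 1)) ×
    (Fin n → EuclideanSpace ℝ (Fin (n + 1))) => stereoHeight ν z.1 z.2)
    (contDiff_stereoHeight_uncurry ν) (p, e)

lemma stereoHeight_zero (ν p : E) (e : Fin n → E) : stereoHeight ν p e 0 = inner ℝ ν p := by
  rw [stereoHeight, stereoParam_zero]

lemma contDiff_metricMatrix_pertMetric (p : Sph n) (i j : Fin n) :
    ContDiff ℝ ∞ fun y => metricMatrix (pertMetric _ (contDiff_profile hφ hη) h0 L) p y i j := by
  rw [metricMatrix_pertMetric_profile hφ hη h0]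
  exact (contDiff_conformal _).add ((hφ.comp (contDiff_stereoHeight _ _)).mul
    (contDiff_stereoTensor L hη _ _ i j))

lemma metricMatrix_pertMetric_zero (p : Sph n) :
    metricMatrix (pertMetric _ (contDiff_profile hφ hη) h0 L) p 0
      = pertMatrix η L (p : EuclideanSpace ℝ (Fin (n + 1))) (sphFrame p)
        (φ (inner ℝ ν (p : EuclideanSpace ℝ (Fin (n + 1))))) := by
  ext i j
  have h := congrFun (metricMatrix_pertMetric_profile hφ hη h0 L p i j) 0
  refine h.trans ?_
  rw [stereoHeight_zero, pertMatrix, Matrix.of_apply]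
  norm_num

lemma partialDeriv_metricMatrix_pertMetric (p : Sph n) (k i j : Fin n) :
    (partialDeriv k fun z => metricMatrix (pertMetric _ (contDiff_profile hφ hη) h0 L) p z i j)
      = fun y => partialDeriv k (fun z => 16 * (‖z‖ ^ 2 + 4)⁻¹ ^ 2 * (if i = j then 1 else 0)) y
        + (deriv φ (stereoHeight ν (p : EuclideanSpace ℝ (Fin (n + 1))) (sphFrame p) y)
          * partialDeriv k (stereoHeight ν (p : EuclideanSpace ℝ (Fin (n + 1))) (sphFrame p)) y
          * stereoTensor η L (p : EuclideanSpace ℝ (Fin (n + 1))) (sphFrame p) i j y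
        + φ (stereoHeight ν (p : EuclideanSpace ℝ (Fin (n + 1))) (sphFrame p) y)
          * partialDeriv k (stereoTensor η L (p : EuclideanSpace ℝ (Fin (n + 1))) (sphFrame p) i j) y) := by
  funext y
  rw [metricMatrix_pertMetric_profile hφ hη h0]
  have hs := contDiff_stereoHeight (ν := ν) (p : EuclideanSpace ℝ (Fin (n + 1))) (sphFrame p)
  have hH := contDiff_stereoTensor L hη (p : EuclideanSpace ℝ (Fin (n + 1))) (sphFrame p) i j
  have hφs : ContDiff ℝ ∞ fun z => φ (stereoHeight ν (p : EuclideanSpace ℝ (Fin (n + 1))) (sphFrame p) z) :=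
    hφ.comp hs
  rw [partialDeriv_add (contDiff_conformal _) (hφs.mul hH), partialDeriv_mul hφs hH, partialDeriv_comp hφ hs]

lemma partialDeriv_metricMatrix_pertMetric_zero (p : Sph n) (k i j : Fin n) :
    partialDeriv k (fun z => metricMatrix (pertMetric _ (contDiff_profile hφ hη) h0 L) p z i j) 0
      = pertJetOne η L ν (p : EuclideanSpace ℝ (Fin (n + 1))) (sphFrame p)
        (twoJet φ (inner ℝ ν (p : EuclideanSpace ℝ (Fin (n + 1))))) k i j := by
  refine (congrFun (partialDeriv_metricMatrix_pertMetric hφ hη h0 L p k i j) 0).trans ?_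
  rw [partialDeriv_conformal]
  simp [pertJetOne, twoJet, stereoHeight_zero]

lemma partialDeriv_partialDeriv_metricMatrix_pertMetric_zero (p : Sph n) (l k i j : Fin n) :
    partialDeriv l (partialDeriv k fun z =>
        metricMatrix (pertMetric _ (contDiff_profile hφ hη) h0 L) p z i j) 0
      = pertJetTwo η L ν (p : EuclideanSpace ℝ (Fin (n + 1))) (sphFrame p)
        (twoJet φ (inner ℝ ν (p : EuclideanSpace ℝ (Fin (n + 1))))) l k i j := by
  have hs := contDiff_stereoHeight (ν := ν) (p : EuclideanSpace ℝ (Fin (n + 1))) (sphFrame p)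
  have hH := contDiff_stereoTensor L hη (p : EuclideanSpace ℝ (Fin (n + 1))) (sphFrame p) i j
  have hφ' : ContDiff ℝ ∞ (deriv φ) := (contDiff_infty_iff_deriv.1 hφ).2
  have hsk := contDiff_partialDeriv hs k
  have hHk := contDiff_partialDeriv hH k
  have hφs : ContDiff ℝ ∞ fun z => φ (stereoHeight ν (p : EuclideanSpace ℝ (Fin (n + 1))) (sphFrame p) z) :=
    hφ.comp hs
  have hφs' : ContDiff ℝ ∞ fun z =>
      deriv φ (stereoHeight ν (p : EuclideanSpace ℝ (Fin (n + 1))) (sphFrame p) z) := hφ'.comp hs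
  rw [partialDeriv_metricMatrix_pertMetric hφ hη h0,
    partialDeriv_add (contDiff_partialDeriv (contDiff_conformal _) k)
      (((hφs'.mul hsk).mul hH).add (hφs.mul hHk)),
    partialDeriv_add ((hφs'.mul hsk).mul hH) (hφs.mul hHk),
    partialDeriv_mul (hφs'.mul hsk) hH, partialDeriv_mul hφs' hsk,
    partialDeriv_mul hφs hHk, partialDeriv_comp hφ hs, partialDeriv_comp hφ' hs]
  have hc := partialDeriv_partialDeriv_conformal_zero l k (if i = j then 1 else 0)
  rw [hc]
  simp only [pertJetTwo, twoJet, stereoHeight_zero]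
  simp
  ring

end

end PerturbationJets

/-! ### Positivity of the Ricci curvature -/

section Positivity

variable {n : ℕ} {E E' : Type*} [NormedAddCommGroup E] [InnerProductSpace ℝ E]
  [NormedAddCommGroup E'] [InnerProductSpace ℝ E']

/-- The Ricci curvature in the direction `v` at the centre of the chart of the round metric plus
`φ(⟨ν, ·⟩) η ⟨L ·, L ·⟩`, where `φ` has the two-jet `x`. -/
def pertRicci (η : E → ℝ) (L : E →L[ℝ] E') (ν p : E) (e : Fin n → E) (x : Fin 3 → ℝ)
    (v : EuclideanSpace ℝ (Fin n)) : ℝ :=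
  ∑ i, ∑ j, ricciJet (pertMatrix η L p e (x 0))⁻¹ (pertJetOne η L ν p e x)
    (pertJetTwo η L ν p e x) i j * v i * v j

lemma stereoTensor_zero (η : E → ℝ) (L : E →L[ℝ] E') (p : E) (e : Fin n → E) (i j : Fin n) :
    stereoTensor η L p e i j 0 = η p * inner ℝ (L (e i)) (L (e j)) := by
  simp only [stereoTensor, stereoParam_zero, hasFDerivAt_stereoParam_zero, ← frameMap_apply,
    frameMap_coordVec]

lemma partialDeriv_stereoHeight_zero (ν p : E) (e : Fin n → E) (k : Fin n) :
    partialDeriv k (stereoHeight ν p e) 0 = inner ℝ ν (e k) := by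
  have h := (innerSL ℝ ν).hasFDerivAt.comp (0 : EuclideanSpace ℝ (Fin n))
    ((contDiff_stereoParam p e).differentiable (by simp) 0).hasFDerivAt
  have h' : fderiv ℝ (stereoHeight ν p e) 0 = _ := h.fderiv
  rw [partialDeriv, h', ContinuousLinearMap.comp_apply, hasFDerivAt_stereoParam_zero,
    ← frameMap_apply, frameMap_coordVec, innerSL_apply_apply]

lemma det_pertMatrix_pos {η : E → ℝ} {p : E} (hη : 0 ≤ η p) (L : E →L[ℝ] E') (e : Fin n → E) {x : ℝ}
    (hx : 0 ≤ x) : 0 < (pertMatrix η L p e x).det := by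
  refine Matrix.PosDef.det_pos (Matrix.PosDef.of_dotProduct_mulVec_pos ?_ fun v hv => ?_)
  · ext i j
    simp only [pertMatrix, Matrix.conjTranspose_apply, Matrix.of_apply, star_trivial,
      stereoTensor_zero, real_inner_comm (L (e i)), eq_comm (a := i)]
  · have h1 : star v ⬝ᵥ Matrix.mulVec (pertMatrix η L p e x) v
        = ∑ i, v i ^ 2 + x * (η p * ‖L (∑ i, v i • e i)‖ ^ 2) := by
      rw [← real_inner_self_eq_norm_sq]
      simp only [map_sum, map_smul, sum_inner, inner_sum, real_inner_smul_left, real_inner_smul_right,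
        dotProduct, Matrix.mulVec, pertMatrix, Matrix.of_apply, stereoTensor_zero, Pi.star_apply,
        star_trivial, add_mul, Finset.sum_add_distrib, Finset.mul_sum, mul_add, ite_mul, one_mul,
        zero_mul, Finset.sum_ite_eq, Finset.mem_univ, if_true]
      congr 1
      · exact Finset.sum_congr rfl fun i _ => by ring
      · rw [Finset.sum_comm]
        refine Finset.sum_congr rfl fun i _ => Finset.sum_congr rfl fun j _ => ?_
        ring
    rw [h1]
    obtain ⟨i, hi⟩ := Function.ne_iff.1 hv
    have h2 : 0 < ∑ i, v i ^ 2 :=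
      Finset.sum_pos' (fun i _ => sq_nonneg _) ⟨i, Finset.mem_univ _, sq_pos_iff.2 hi⟩
    positivity

/-- The curvature at p sees φ only through its two-jet at the height of p, so all metrics of the
family, whatever φ is, are governed by the single function `pertRicci`. -/
lemma ricci_pertMetric {η : EuclideanSpace ℝ (Fin (n + 1)) → ℝ} {φ : ℝ → ℝ}
    {ν : EuclideanSpace ℝ (Fin (n + 1))} (hφ : ContDiff ℝ ∞ φ) (hη : ContDiff ℝ ∞ η)
    (h0 : ∀ x : EuclideanSpace ℝ (Fin (n + 1)), 0 ≤ φ (inner ℝ ν x) * η x)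
    (hφ0 : ∀ s, 0 ≤ φ s) (hη0 : ∀ x, 0 ≤ η x)
    (L : EuclideanSpace ℝ (Fin (n + 1)) →L[ℝ] E') (p : Sph n) (v : EuclideanSpace ℝ (Fin n)) :
    ricci (pertMetric _ (contDiff_profile hφ hη) h0 L) p v
      = pertRicci η L ν (p : EuclideanSpace ℝ (Fin (n + 1))) (sphFrame p)
        (twoJet φ (inner ℝ ν (p : EuclideanSpace ℝ (Fin (n + 1))))) v := by
  have hdet : (metricMatrix (pertMetric _ (contDiff_profile hφ hη) h0 L) p 0).det ≠ 0 := by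
    rw [metricMatrix_pertMetric_zero hφ hη h0]
    exact (det_pertMatrix_pos (hη0 _) L _ (hφ0 _)).ne'
  simp only [ricci, extChartAt_self_eq_zero,
    ricciMatrix_eq_jet _ p 0 (contDiff_metricMatrix_pertMetric hφ hη h0 L p) hdet,
    metricMatrix_pertMetric_zero hφ hη h0, partialDeriv_metricMatrix_pertMetric_zero hφ hη h0,
    partialDeriv_partialDeriv_metricMatrix_pertMetric_zero hφ hη h0]
  rfl

/-- With vanishing first derivatives the Ricci tensor is linear in the second derivatives. The
Kronecker part is the unit sphere and gives (n-1)δ. In the part c s s h, the relation ∑ s h = 0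
removes the mixed terms and ∑ s² = 1 normalizes the rest; for c = 0 nothing is needed. -/
lemma ricciJet_one_zero (s : Fin n → ℝ) (h : Fin n → Fin n → ℝ) (hsymm : ∀ i j, h i j = h j i) (c : ℝ)
    (hs : c = 0 ∨ (∑ k, s k ^ 2 = 1 ∧ ∀ j, ∑ k, s k * h k j = 0)) (i j : Fin n) :
    ricciJet 1 (fun _ _ _ => 0) (fun l k i j => -(if l = k then if i = j then 1 else 0 else 0)
      + c * s l * s k * h i j) i j
      = (n - 1) * (if i = j then 1 else 0) - c / 2 * (h i j + s i * s j * ∑ k, h k k) := by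
  have hd : ∀ (C : Fin n → Fin n → Fin n → Fin n → ℝ) m k i j,
      christoffelDerivJet 1 (fun _ _ _ => 0) C m k i j
        = (1 / 2) * (C m i j k + C m j i k - C m k i j) := by
    intro C m k i j
    simp [christoffelDerivJet, Matrix.one_apply]
  have hc : ∀ k i j, christoffelJet (n := n) 1 (fun _ _ _ => 0) k i j = 0 := by
    intro k i j
    simp [christoffelJet]
  simp only [ricciJet, hd, hc, mul_zero, sub_zero, Finset.sum_const_zero, add_zero]
  have hcs : c * ∑ k, s k ^ 2 = c := by rcases hs with rfl | ⟨h1, -⟩ <;> simp [*]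
  have hch : ∀ j, c * ∑ k, s k * h k j = 0 := by
    intro j
    rcases hs with rfl | ⟨-, h1⟩
    · rw [zero_mul]
    · rw [h1, mul_zero]
  calc _ = ∑ k, (-(1 / 2) * (if k = i then if j = k then (1 : ℝ) else 0 else 0)
        - (1 / 2) * (if k = j then if i = k then (1 : ℝ) else 0 else 0)
        + (1 / 2) * (if i = j then (1 : ℝ) else 0) + (1 / 2) * (if j = i then (1 : ℝ) else 0)
        + (1 / 2) * s i * (c * (s k * h k j)) + (1 / 2) * s j * (c * (s k * h k i))
        - (1 / 2) * h i j * (c * s k ^ 2) - c / 2 * s i * s j * h k k) := by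
          refine Finset.sum_congr rfl fun k _ => ?_
          rw [hsymm j k, hsymm i k]
          simp only [if_true]
          ring
    _ = _ := by
          simp only [Finset.sum_add_distrib, Finset.sum_sub_distrib, ← Finset.mul_sum, hch, hcs]
          simp only [Finset.sum_ite_eq', Finset.mem_univ, if_true, Finset.sum_const, Finset.card_univ,
            Fintype.card_fin, nsmul_eq_mul, eq_comm (a := j)]
          ring

/-- The limiting curvature. On the equator ν is tangent to the sphere, so its components in the
frame have square sum 1, and L ν = 0 makes ν a null direction of the perturbation. This verifies the
hypotheses of `ricciJet_one_zero`. -/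
lemma pertRicci_eq {η : E → ℝ} {L : E →L[ℝ] E'} {ν p : E} {e : Fin n → E} (hpe : IsFrame p e)
    (hν : ‖ν‖ = 1) (hL : L ν = 0) {x : Fin 3 → ℝ} (hx0 : x 0 = 0) (hx1 : x 1 = 0)
    (hx2 : x 2 = 0 ∨ inner ℝ ν p = (0 : ℝ)) (v : EuclideanSpace ℝ (Fin n)) :
    pertRicci η L ν p e x v = (n - 1) * ‖v‖ ^ 2 - x 2 / 2 * (η p * ‖L (frameMap e v)‖ ^ 2
      + inner ℝ ν (frameMap e v) ^ 2 * (η p * ∑ k, ‖L (e k)‖ ^ 2)) := by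
  have hA : (pertMatrix η L p e (x 0))⁻¹ = 1 := by
    have : pertMatrix η L p e (x 0) = 1 := by
      ext i j
      simp [pertMatrix, hx0, Matrix.one_apply]
    rw [this, inv_one]
  have hB : pertJetOne η L ν p e x = fun _ _ _ => 0 := by
    funext k i j
    simp [pertJetOne, hx0, hx1]
  have hC : pertJetTwo η L ν p e x = fun l k i j => -(if l = k then if i = j then 1 else 0 else 0)
      + x 2 * inner ℝ ν (e l) * inner ℝ ν (e k) * (η p * inner ℝ (L (e i)) (L (e j))) := by
    funext l k i j
    simp [pertJetTwo, hx0, hx1, partialDeriv_stereoHeight_zero, stereoTensor_zero]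
  have hs : x 2 = 0 ∨ (∑ k, (inner ℝ ν (e k) : ℝ) ^ 2 = 1 ∧
      ∀ j, ∑ k, (inner ℝ ν (e k) : ℝ) * (η p * inner ℝ (L (e k)) (L (e j))) = 0) := by
    refine hx2.imp_right fun h => ⟨?_, fun j => ?_⟩
    · have := hpe.parseval ν ν
      simp only [real_inner_comm ν] at this ⊢
      simp only [sq, this]
      rw [real_inner_self_eq_norm_sq, hν, h]
      norm_num
    · have h1 := congrArg L (hpe.sum_smul ν)
      rw [h, zero_smul, sub_zero, hL, map_sum] at h1
      have h2 := congrArg (fun w => η p * inner ℝ w (L (e j))) h1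
      simp only [map_smul, sum_inner, real_inner_smul_left, inner_zero_left, mul_zero,
        Finset.mul_sum] at h2
      rw [← h2]
      refine Finset.sum_congr rfl fun k _ => ?_
      rw [real_inner_comm ν]
      ring
  have hv : ∑ i, v i ^ 2 = ‖v‖ ^ 2 := by
    rw [EuclideanSpace.norm_sq_eq]; simp
  have hLv : ∑ i, ∑ j, (inner ℝ (L (e i)) (L (e j)) : ℝ) * v i * v j = ‖L (frameMap e v)‖ ^ 2 := by
    rw [← real_inner_self_eq_norm_sq, frameMap_apply]
    simp only [map_sum, map_smul, sum_inner, inner_sum, real_inner_smul_left, real_inner_smul_right]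
    rw [Finset.sum_comm]
    exact Finset.sum_congr rfl fun i _ => Finset.sum_congr rfl fun j _ => by ring
  have hνv : ∑ i, ((inner ℝ ν (e i) : ℝ) * v i) * ∑ j, (inner ℝ ν (e j) * v j)
      = inner ℝ ν (frameMap e v) ^ 2 := by
    rw [← Finset.sum_mul, ← sq, frameMap_apply]
    simp only [inner_sum, real_inner_smul_right]
    congr 1
    exact Finset.sum_congr rfl fun i _ => by ring
  unfold pertRicci
  rw [hA, hB, hC]
  simp only [ricciJet_one_zero (fun k => inner ℝ ν (e k))
    (fun i j => η p * inner ℝ (L (e i)) (L (e j))) (fun i j => by rw [real_inner_comm]) (x 2) hs]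
  simp only [real_inner_self_eq_norm_sq, ← Finset.mul_sum]
  calc _ = ∑ i, ∑ j, ((n - 1) * ((if i = j then (1 : ℝ) else 0) * v i * v j)
        - x 2 / 2 * η p * (inner ℝ (L (e i)) (L (e j)) * v i * v j)
        - x 2 / 2 * (η p * ∑ k, ‖L (e k)‖ ^ 2) *
          (((inner ℝ ν (e i) : ℝ) * v i) * (inner ℝ ν (e j) * v j))) :=
        Finset.sum_congr rfl fun i _ => Finset.sum_congr rfl fun j _ => by ring
    _ = _ := by
        simp only [Finset.sum_sub_distrib, ← Finset.mul_sum, hLv, hνv]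
        simp only [ite_mul, one_mul, zero_mul, Finset.sum_ite_eq, Finset.mem_univ, if_true, ← sq, hv]
        ring

lemma pertRicci_smul (η : E → ℝ) (L : E →L[ℝ] E') (ν p : E) (e : Fin n → E) (x : Fin 3 → ℝ) (c : ℝ)
    (v : EuclideanSpace ℝ (Fin n)) : pertRicci η L ν p e x (c • v) = c ^ 2 * pertRicci η L ν p e x v := by
  simp only [pertRicci, Finset.mul_sum, PiLp.smul_apply, smul_eq_mul]
  exact Finset.sum_congr rfl fun i _ => Finset.sum_congr rfl fun j _ => by ring

/-- The bracket subtracted in `pertRicci_eq` is nonnegative, so negative x 2 only helps. For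
positive x 2 the bracket is at most T‖v‖², since η p ≤ 1 ≤ T, the trace is at most T, and `hL`
bounds the two components of v together. -/
lemma pertRicci_pos {η : E → ℝ} {L : E →L[ℝ] E'} {ν p : E} {e : Fin n → E} (hpe : IsFrame p e)
    (hν : ‖ν‖ = 1) (hL : ∀ x, ‖L x‖ ^ 2 + inner ℝ ν x ^ 2 ≤ ‖x‖ ^ 2) (hη : 0 ≤ η p) (hη1 : η p ≤ 1)
    {T κ : ℝ} (hT : 1 ≤ T) (hκ : 0 ≤ κ) (hκT : κ * T < 2 * (n - 1))
    {x : Fin 3 → ℝ} (hx0 : x 0 = 0) (hx1 : x 1 = 0) (hxκ : x 2 ≤ κ)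
    (hx2 : x 2 = 0 ∨ (inner ℝ ν p = (0 : ℝ) ∧ η p * ∑ k, ‖L (e k)‖ ^ 2 ≤ T))
    {v : EuclideanSpace ℝ (Fin n)} (hv : v ≠ 0) : 0 < pertRicci η L ν p e x v := by
  have hLν : L ν = 0 := by
    have := hL ν
    rw [real_inner_self_eq_norm_sq, hν] at this
    have h1 : ‖L ν‖ ^ 2 = 0 := le_antisymm (by linarith) (sq_nonneg _)
    simpa using h1
  rw [pertRicci_eq hpe hν hLν hx0 hx1 (hx2.imp_right And.left)]
  have hv' : 0 < ‖v‖ ^ 2 := by positivity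
  have hn : 0 < (n - 1 : ℝ) := by nlinarith
  have hV : ‖frameMap e v‖ ^ 2 = ‖v‖ ^ 2 := by
    rw [← real_inner_self_eq_norm_sq, hpe.inner_frameMap, real_inner_self_eq_norm_sq]
  have h1 := hL (frameMap e v)
  rw [hV] at h1
  have hτ : 0 ≤ η p * ∑ k, ‖L (e k)‖ ^ 2 := mul_nonneg hη (Finset.sum_nonneg fun k _ => sq_nonneg _)
  have hA : 0 ≤ ‖L (frameMap e v)‖ ^ 2 := sq_nonneg _
  have hB : 0 ≤ (inner ℝ ν (frameMap e v) : ℝ) ^ 2 := sq_nonneg _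
  set a := ‖L (frameMap e v)‖ ^ 2
  set b := (inner ℝ ν (frameMap e v) : ℝ) ^ 2
  set τ := η p * ∑ k, ‖L (e k)‖ ^ 2
  have hab : 0 ≤ η p * a + b * τ := by positivity
  rcases le_or_gt (x 2) 0 with h | h
  · nlinarith [mul_nonneg (neg_nonneg.2 h) hab, mul_pos hn hv']
  · have hτT : τ ≤ T := (hx2.resolve_left h.ne').2
    have h2 : η p * a + b * τ ≤ T * ‖v‖ ^ 2 := by
      have h3 : η p * a ≤ T * a := mul_le_mul_of_nonneg_right (hη1.trans hT) hA
      have h4 : b * τ ≤ b * T := mul_le_mul_of_nonneg_left hτT hB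
      nlinarith [mul_le_mul_of_nonneg_left h1 (zero_le_one.trans hT)]
    have h5 : x 2 * (η p * a + b * τ) ≤ κ * (T * ‖v‖ ^ 2) := mul_le_mul hxκ h2 hab hκ
    nlinarith [mul_lt_mul_of_pos_right hκT hv']

end Positivity

/-! ### Continuity of the curvature in all parameters, and positivity by compactness -/

section Compactness

variable {n : ℕ} {E E' : Type*} [NormedAddCommGroup E] [InnerProductSpace ℝ E]
  [NormedAddCommGroup E'] [InnerProductSpace ℝ E']

lemma continuous_ricciJet (i j : Fin n) :
    Continuous fun w : Matrix (Fin n) (Fin n) ℝ × (Fin n → Fin n → Fin n → ℝ) ×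
      (Fin n → Fin n → Fin n → Fin n → ℝ) => ricciJet w.1 w.2.1 w.2.2 i j := by
  have hA : ∀ a b, Continuous fun w : Matrix (Fin n) (Fin n) ℝ × (Fin n → Fin n → Fin n → ℝ) ×
      (Fin n → Fin n → Fin n → Fin n → ℝ) => w.1 a b := fun a b => by fun_prop
  have hB : ∀ a b c, Continuous fun w : Matrix (Fin n) (Fin n) ℝ × (Fin n → Fin n → Fin n → ℝ) ×
      (Fin n → Fin n → Fin n → Fin n → ℝ) => w.2.1 a b c := fun a b c => by fun_prop
  have hC : ∀ a b c d, Continuous fun w : Matrix (Fin n) (Fin n) ℝ × (Fin n → Fin n → Fin n → ℝ) ×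
      (Fin n → Fin n → Fin n → Fin n → ℝ) => w.2.2 a b c d := fun a b c d => by fun_prop
  have hch : ∀ k i j, Continuous fun w : Matrix (Fin n) (Fin n) ℝ × (Fin n → Fin n → Fin n → ℝ) ×
      (Fin n → Fin n → Fin n → Fin n → ℝ) => christoffelJet w.1 w.2.1 k i j := fun k i j =>
    continuous_const.mul (continuous_finsetSum _ fun l _ =>
      (hA _ _).mul (((hB _ _ _).add (hB _ _ _)).sub (hB _ _ _)))
  have hd : ∀ m k i j, Continuous fun w : Matrix (Fin n) (Fin n) ℝ × (Fin n → Fin n → Fin n → ℝ) ×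
      (Fin n → Fin n → Fin n → Fin n → ℝ) => christoffelDerivJet w.1 w.2.1 w.2.2 m k i j := fun m k i j =>
    continuous_const.mul (continuous_finsetSum _ fun l _ =>
      ((continuous_finsetSum _ fun a _ => continuous_finsetSum _ fun b _ =>
        ((hA _ _).mul (hB _ _ _)).mul (hA _ _)).neg.mul
          (((hB _ _ _).add (hB _ _ _)).sub (hB _ _ _))).add
      ((hA _ _).mul (((hC _ _ _ _).add (hC _ _ _ _)).sub (hC _ _ _ _))))
  exact (continuous_finsetSum _ fun k _ => (hd _ _ _ _).sub (hd _ _ _ _)).add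
    (continuous_finsetSum _ fun k _ => continuous_finsetSum _ fun l _ =>
      ((hch _ _ _).mul (hch _ _ _)).sub ((hch _ _ _).mul (hch _ _ _)))

lemma continuousOn_ricciJet {Z : Type*} [TopologicalSpace Z] {s : Set Z} {A : Z → Matrix (Fin n) (Fin n) ℝ}
    {B : Z → Fin n → Fin n → Fin n → ℝ} {C : Z → Fin n → Fin n → Fin n → Fin n → ℝ}
    (hA : ContinuousOn A s) (hB : Continuous B) (hC : Continuous C) (i j : Fin n) :
    ContinuousOn (fun z => ricciJet (A z) (B z) (C z) i j) s := by
  have h : ContinuousOn (fun z => (A z, B z, C z)) s :=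
    hA.prodMk (hB.continuousOn.prodMk hC.continuousOn)
  have h' := (continuous_ricciJet i j).comp_continuousOn h
  exact h'

lemma continuousOn_matrix_inv {Z ι : Type*} [TopologicalSpace Z] [Fintype ι] [DecidableEq ι]
    {A : Z → Matrix ι ι ℝ} {s : Set Z} (hA : ContinuousOn A s) (hdet : ∀ z ∈ s, (A z).det ≠ 0) :
    ContinuousOn (fun z => (A z)⁻¹) s := by
  simp only [Matrix.inv_def, Ring.inverse_eq_inv']
  have h1 : Continuous fun M : Matrix ι ι ℝ => M.det := continuous_id.matrix_det
  have h2 : Continuous fun M : Matrix ι ι ℝ => M.adjugate := continuous_id.matrix_adjugate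
  exact ((h1.comp_continuousOn hA).inv₀ hdet).smul (h2.comp_continuousOn hA)

section

variable {η : E → ℝ}

lemma continuous_stereoTensor_zero (hη : ContDiff ℝ ∞ η) (L : E →L[ℝ] E') (i j : Fin n) :
    Continuous fun z : E × (Fin n → E) => stereoTensor η L z.1 z.2 i j 0 :=
  continuous_uncurry_left (f := fun z : E × (Fin n → E) => stereoTensor η L z.1 z.2 i j)
    (contDiff_stereoTensor_uncurry hη L i j) 0

lemma continuous_partialDeriv_stereoTensor_zero (hη : ContDiff ℝ ∞ η) (L : E →L[ℝ] E') (k i j : Fin n) :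
    Continuous fun z : E × (Fin n → E) => partialDeriv k (stereoTensor η L z.1 z.2 i j) 0 :=
  continuous_uncurry_left (f := fun z : E × (Fin n → E) => partialDeriv k (stereoTensor η L z.1 z.2 i j))
    (contDiff_partialDeriv_uncurry (f := fun z : E × (Fin n → E) => stereoTensor η L z.1 z.2 i j)
      (contDiff_stereoTensor_uncurry hη L i j) k) 0

lemma continuous_partialDeriv_partialDeriv_stereoTensor_zero (hη : ContDiff ℝ ∞ η) (L : E →L[ℝ] E') (l k i j : Fin n) :
    Continuous fun z : E × (Fin n → E) =>
      partialDeriv l (partialDeriv k (stereoTensor η L z.1 z.2 i j)) 0 :=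
  continuous_uncurry_left (f := fun z : E × (Fin n → E) =>
    partialDeriv l (partialDeriv k (stereoTensor η L z.1 z.2 i j)))
    (contDiff_partialDeriv_uncurry (f := fun z : E × (Fin n → E) =>
      partialDeriv k (stereoTensor η L z.1 z.2 i j))
    (contDiff_partialDeriv_uncurry (f := fun z : E × (Fin n → E) => stereoTensor η L z.1 z.2 i j)
      (contDiff_stereoTensor_uncurry hη L i j) k) l) 0

lemma continuous_partialDeriv_stereoHeight_zero (ν : E) (k : Fin n) :
    Continuous fun z : E × (Fin n → E) => partialDeriv k (stereoHeight ν z.1 z.2) 0 :=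
  continuous_uncurry_left (f := fun z : E × (Fin n → E) => partialDeriv k (stereoHeight ν z.1 z.2))
    (contDiff_partialDeriv_uncurry (f := fun z : E × (Fin n → E) => stereoHeight ν z.1 z.2)
      (contDiff_stereoHeight_uncurry ν) k) 0

lemma continuous_partialDeriv_partialDeriv_stereoHeight_zero (ν : E) (l k : Fin n) :
    Continuous fun z : E × (Fin n → E) =>
      partialDeriv l (partialDeriv k (stereoHeight ν z.1 z.2)) 0 :=
  continuous_uncurry_left (f := fun z : E × (Fin n → E) =>
    partialDeriv l (partialDeriv k (stereoHeight ν z.1 z.2)))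
    (contDiff_partialDeriv_uncurry (f := fun z : E × (Fin n → E) =>
      partialDeriv k (stereoHeight ν z.1 z.2))
    (contDiff_partialDeriv_uncurry (f := fun z : E × (Fin n → E) => stereoHeight ν z.1 z.2)
      (contDiff_stereoHeight_uncurry ν) k) l) 0

lemma continuous_pertMatrix (hη : ContDiff ℝ ∞ η) (L : E →L[ℝ] E') :
    Continuous fun z : (E × (Fin n → E)) × (Fin 3 → ℝ) => pertMatrix η L z.1.1 z.1.2 (z.2 0) := by
  refine continuous_matrix fun i j => continuous_const.add (Continuous.mul (by fun_prop) ?_)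
  exact (continuous_stereoTensor_zero hη L i j).comp continuous_fst

lemma continuous_pertJetOne (hη : ContDiff ℝ ∞ η) (L : E →L[ℝ] E') (ν : E) :
    Continuous fun z : (E × (Fin n → E)) × (Fin 3 → ℝ) => pertJetOne η L ν z.1.1 z.1.2 z.2 := by
  refine continuous_pi fun k => continuous_pi fun i => continuous_pi fun j => ?_
  unfold pertJetOne
  refine .add (.mul (.mul (by fun_prop) ?_) ?_) (.mul (by fun_prop) ?_)
  · exact (continuous_partialDeriv_stereoHeight_zero ν k).comp continuous_fst
  · exact (continuous_stereoTensor_zero hη L i j).comp continuous_fst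
  · exact (continuous_partialDeriv_stereoTensor_zero hη L k i j).comp continuous_fst

lemma continuous_pertJetTwo (hη : ContDiff ℝ ∞ η) (L : E →L[ℝ] E') (ν : E) :
    Continuous fun z : (E × (Fin n → E)) × (Fin 3 → ℝ) => pertJetTwo η L ν z.1.1 z.1.2 z.2 := by
  refine continuous_pi fun l => continuous_pi fun k => continuous_pi fun i => continuous_pi fun j => ?_
  have h1 : ∀ k, Continuous fun z : (E × (Fin n → E)) × (Fin 3 → ℝ) =>
      partialDeriv k (stereoHeight ν z.1.1 z.1.2) 0 := fun k =>
    (continuous_partialDeriv_stereoHeight_zero ν k).comp continuous_fst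
  have h2 : ∀ k, Continuous fun z : (E × (Fin n → E)) × (Fin 3 → ℝ) =>
      partialDeriv k (stereoTensor η L z.1.1 z.1.2 i j) 0 := fun k =>
    (continuous_partialDeriv_stereoTensor_zero hη L k i j).comp continuous_fst
  have h3 : Continuous fun z : (E × (Fin n → E)) × (Fin 3 → ℝ) =>
      stereoTensor η L z.1.1 z.1.2 i j 0 :=
    (continuous_stereoTensor_zero hη L i j).comp continuous_fst
  unfold pertJetTwo
  refine continuous_const.add (.add (.add (.add (.mul (.add (.mul (.mul ?_ (h1 l)) (h1 k))
    (.mul ?_ ?_)) h3) (.mul (.mul ?_ (h1 k)) (h2 l))) (.mul (.mul ?_ (h1 l)) (h2 k))) (.mul ?_ ?_))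
  · fun_prop
  · fun_prop
  · exact (continuous_partialDeriv_partialDeriv_stereoHeight_zero ν l k).comp continuous_fst
  · fun_prop
  · fun_prop
  · fun_prop
  · exact (continuous_partialDeriv_partialDeriv_stereoTensor_zero hη L l k i j).comp continuous_fst

lemma continuousOn_pertRicci (hη : ContDiff ℝ ∞ η) (L : E →L[ℝ] E') (ν : E) (hη0 : ∀ x, 0 ≤ η x) :
    ContinuousOn (fun z : (E × (Fin n → E)) × (Fin 3 → ℝ) × EuclideanSpace ℝ (Fin n) =>
      pertRicci η L ν z.1.1 z.1.2 z.2.1 z.2.2) {z | 0 ≤ z.2.1 0} := by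
  have hpr : Continuous fun z : (E × (Fin n → E)) × (Fin 3 → ℝ) × EuclideanSpace ℝ (Fin n) =>
      (z.1, z.2.1) := by fun_prop
  have hA : Continuous fun z : (E × (Fin n → E)) × (Fin 3 → ℝ) × EuclideanSpace ℝ (Fin n) =>
      pertMatrix η L z.1.1 z.1.2 (z.2.1 0) := (continuous_pertMatrix hη L).comp hpr
  have hB : Continuous fun z : (E × (Fin n → E)) × (Fin 3 → ℝ) × EuclideanSpace ℝ (Fin n) =>
      pertJetOne η L ν z.1.1 z.1.2 z.2.1 := (continuous_pertJetOne hη L ν).comp hpr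
  have hC : Continuous fun z : (E × (Fin n → E)) × (Fin 3 → ℝ) × EuclideanSpace ℝ (Fin n) =>
      pertJetTwo η L ν z.1.1 z.1.2 z.2.1 := (continuous_pertJetTwo hη L ν).comp hpr
  have hAinv : ContinuousOn (fun z : (E × (Fin n → E)) × (Fin 3 → ℝ) × EuclideanSpace ℝ (Fin n) =>
      (pertMatrix η L z.1.1 z.1.2 (z.2.1 0))⁻¹) {z | 0 ≤ z.2.1 0} :=
    continuousOn_matrix_inv hA.continuousOn
      fun z hz => (det_pertMatrix_pos (hη0 _) L z.1.2 hz).ne'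
  unfold pertRicci
  refine continuousOn_finsetSum _ fun i _ => continuousOn_finsetSum _ fun j _ => ?_
  exact ((continuousOn_ricciJet hAinv hB hC i j).mul (by fun_prop)).mul (by fun_prop)

end

lemma isClosed_isFrame : IsClosed {z : E × (Fin n → E) | IsFrame z.1 z.2} := by
  have : {z : E × (Fin n → E) | IsFrame z.1 z.2} = {z | ‖z.1‖ = 1} ∩
      ({z | ∀ i j, inner ℝ (z.2 i) (z.2 j) = if i = j then (1 : ℝ) else 0} ∩
      ({z | ∀ i, inner ℝ (z.2 i) z.1 = (0 : ℝ)} ∩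
      {z | ∀ x y : E, ∑ k, inner ℝ (z.2 k) x * inner ℝ (z.2 k) y
        = inner ℝ x y - inner ℝ x z.1 * inner ℝ y z.1})) := by
    ext z
    exact ⟨fun h => ⟨h.1, h.2, h.3, h.4⟩, fun h => ⟨h.1, h.2.1, h.2.2.1, h.2.2.2⟩⟩
  rw [this]
  refine (isClosed_eq (by fun_prop) (by fun_prop)).inter (.inter ?_ (.inter ?_ ?_))
  · simp only [Set.ofPred_forall]
    exact isClosed_iInter fun i => isClosed_iInter fun j => isClosed_eq (by fun_prop) (by fun_prop)
  · simp only [Set.ofPred_forall]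
    exact isClosed_iInter fun i => isClosed_eq (by fun_prop) (by fun_prop)
  · simp only [Set.ofPred_forall]
    exact isClosed_iInter fun i => isClosed_iInter fun j => isClosed_eq (by fun_prop) (by fun_prop)

lemma IsFrame.norm_eq {p : E} {e : Fin n → E} (h : IsFrame p e) (i : Fin n) : ‖e i‖ = 1 := by
  have := h.inner_eq i i
  rw [if_pos rfl, real_inner_self_eq_norm_sq] at this
  nlinarith [norm_nonneg (e i)]

/-- The Ricci curvature stays positive when the first two entries of the jet and the height are small. -/
lemma exists_pertRicci_pos [FiniteDimensional ℝ E] {η : E → ℝ} (hη : ContDiff ℝ ∞ η)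
    (hη0 : ∀ x, 0 ≤ η x) (hη1 : ∀ x, η x ≤ 1) {L : E →L[ℝ] E'} {ν : E}
    (hν : ‖ν‖ = 1) (hL : ∀ x, ‖L x‖ ^ 2 + inner ℝ ν x ^ 2 ≤ ‖x‖ ^ 2)
    {T κ R : ℝ} (hT : 1 ≤ T) (hκ : 0 ≤ κ) (hκT : κ * T < 2 * (n - 1))
    (hτ : ∀ (p : E) (e : Fin n → E), IsFrame p e → inner ℝ ν p = (0 : ℝ) →
      η p * ∑ k, ‖L (e k)‖ ^ 2 ≤ T) :
    ∃ ρ > 0, ∀ (p : E) (e : Fin n → E) (x : Fin 3 → ℝ) (v : EuclideanSpace ℝ (Fin n)),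
      IsFrame p e → 0 ≤ x 0 → x 0 < ρ → |x 1| < ρ → |x 2| ≤ R → x 2 ≤ κ →
      |(inner ℝ ν p : ℝ)| < ρ → v ≠ 0 → 0 < pertRicci η L ν p e x v := by
  -- The bound R on |x 2| serves compactness only; the sign of the curvature is controlled by the
  -- one-sided bound κ.
  let S : Set ((E × (Fin n → E)) × (Fin 3 → ℝ) × EuclideanSpace ℝ (Fin n)) :=
    {z | IsFrame z.1.1 z.1.2} ∩ ({z | 0 ≤ z.2.1 0} ∩ ({z | z.2.1 0 ≤ 1} ∩ ({z | |z.2.1 1| ≤ 1} ∩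
      ({z | |z.2.1 2| ≤ R} ∩ ({z | z.2.1 2 ≤ κ} ∩ {z | ‖z.2.2‖ = 1})))))
  have hSc : IsClosed S := by
    refine (isClosed_isFrame.preimage continuous_fst).inter (.inter ?_ (.inter ?_ (.inter ?_
      (.inter ?_ (.inter ?_ ?_)))))
    · exact isClosed_le (by fun_prop) (by fun_prop)
    · exact isClosed_le (by fun_prop) (by fun_prop)
    · exact isClosed_le (by fun_prop) (by fun_prop)
    · exact isClosed_le (by fun_prop) (by fun_prop)
    · exact isClosed_le (by fun_prop) (by fun_prop)
    · exact isClosed_eq (by fun_prop) (by fun_prop)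
  have hSb : Bornology.IsBounded S := by
    refine (isBounded_iff_forall_norm_le).2 ⟨max 1 R, ?_⟩
    rintro ⟨⟨p, e⟩, x, v⟩ ⟨h1, h2, h3, h4, h5, h6, h7⟩
    have hx : ∀ i, ‖x i‖ ≤ max 1 R := by
      intro i
      fin_cases i
      · exact le_max_of_le_left (abs_le.2 ⟨(by norm_num : (-1 : ℝ) ≤ 0).trans h2, h3⟩)
      · exact le_max_of_le_left h4
      · exact le_max_of_le_right h5
    refine norm_prod_le_iff.2 ⟨norm_prod_le_iff.2 ⟨?_, ?_⟩, norm_prod_le_iff.2 ⟨?_, ?_⟩⟩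
    · exact le_max_of_le_left h1.norm_base.le
    · exact (pi_norm_le_iff_of_nonneg (by positivity)).2 fun i =>
        le_max_of_le_left (h1.norm_eq i).le
    · exact (pi_norm_le_iff_of_nonneg (by positivity)).2 hx
    · exact le_max_of_le_left (le_of_eq h7)
  have hSk : IsCompact S := Metric.isCompact_of_isClosed_isBounded hSc hSb
  have hcont : ContinuousOn (fun z : (E × (Fin n → E)) × (Fin 3 → ℝ) × EuclideanSpace ℝ (Fin n) =>
      pertRicci η L ν z.1.1 z.1.2 z.2.1 z.2.2) S :=
    (continuousOn_pertRicci hη L ν hη0).mono fun z hz => hz.2.1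
  have hK : IsCompact (S ∩ {z | pertRicci η L ν z.1.1 z.1.2 z.2.1 z.2.2 ≤ 0}) :=
    hSk.of_isClosed_subset (hcont.preimage_isClosed_of_isClosed hSc isClosed_Iic) Set.inter_subset_left
  -- f measures the deviation from the limiting situation. Points of nonpositive curvature form a
  -- compact set on which f cannot vanish, by `pertRicci_pos`, so f has a positive lower bound
  -- there.
  let f : (E × (Fin n → E)) × (Fin 3 → ℝ) × EuclideanSpace ℝ (Fin n) → ℝ :=
    fun z => max (z.2.1 0) (max |z.2.1 1| |(inner ℝ ν z.1.1 : ℝ)|)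
  have hf : Continuous f := by fun_prop
  obtain ⟨ρ, hρ, hρ'⟩ : ∃ ρ > 0, ∀ z ∈ S ∩ {z | pertRicci η L ν z.1.1 z.1.2 z.2.1 z.2.2 ≤ 0}, ρ ≤ f z := by
    rcases Set.eq_empty_or_nonempty (S ∩ {z | pertRicci η L ν z.1.1 z.1.2 z.2.1 z.2.2 ≤ 0}) with h | h
    · exact ⟨1, one_pos, by simp [h]⟩
    · obtain ⟨z, hz, hmin⟩ := hK.exists_isMinOn h hf.continuousOn
      refine ⟨f z, ?_, fun w hw => hmin hw⟩
      by_contra hle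
      have hle' : f z ≤ 0 := not_lt.1 hle
      obtain ⟨⟨h1, h2, h3, h4, h5, h6, h7⟩, h8⟩ := hz
      have e1 : z.2.1 0 = 0 := le_antisymm ((le_max_left _ _).trans hle') h2
      have e2 : z.2.1 1 = 0 := abs_nonpos_iff.1 (((le_max_left _ _).trans (le_max_right _ _)).trans hle')
      have e3 : (inner ℝ ν z.1.1 : ℝ) = 0 :=
        abs_nonpos_iff.1 (((le_max_right _ _).trans (le_max_right _ _)).trans hle')
      have hv : z.2.2 ≠ 0 := by
        rw [← norm_ne_zero_iff, show ‖z.2.2‖ = 1 from h7]; exact one_ne_zero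
      exact absurd (pertRicci_pos h1 hν hL (hη0 _) (hη1 _) hT hκ hκT e1 e2 h6
        (Or.inr ⟨e3, hτ _ _ h1 e3⟩) hv) (not_lt.2 h8)
  refine ⟨min ρ 1, lt_min hρ one_pos, fun p e x v hpe h0 h0' h1 h2 hκ' hs hv => ?_⟩
  have hv' : 0 < ‖v‖ := norm_pos_iff.2 hv
  have hw : ‖(‖v‖⁻¹ • v)‖ = 1 := by
    rw [norm_smul, norm_inv, norm_norm, inv_mul_cancel₀ hv'.ne']
  have hpos : 0 < pertRicci η L ν p e x (‖v‖⁻¹ • v) := by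
    by_contra hle
    have h3 := hρ' ((p, e), x, ‖v‖⁻¹ • v) ⟨⟨hpe, h0, (h0'.trans_le (min_le_right _ _)).le,
      (h1.trans_le (min_le_right _ _)).le, h2, hκ', hw⟩, not_lt.1 hle⟩
    exact absurd h3 (not_le.2 (max_lt (h0'.trans_le (min_le_left _ _))
      (max_lt (h1.trans_le (min_le_left _ _)) (hs.trans_le (min_le_left _ _)))))
  rw [pertRicci_smul] at hpos
  exact pos_of_mul_pos_right hpos (by positivity)

end Compactness

/-! ### A profile function with one-sided control of the second derivative -/

section Profile

lemma exists_primitive {f : ℝ → ℝ} (hf : ContDiff ℝ ∞ f) :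
    ∃ F : ℝ → ℝ, ContDiff ℝ ∞ F ∧ deriv F = f ∧ ∀ x, F x = ∫ t in (0 : ℝ)..x, f t := by
  have hd : ∀ x, HasDerivAt (fun x => ∫ t in (0 : ℝ)..x, f t) (f x) x := fun x =>
    intervalIntegral.integral_hasDerivAt_right (hf.continuous.intervalIntegrable _ _)
      (hf.continuous.stronglyMeasurableAtFilter _ _) hf.continuous.continuousAt
  have hd' : deriv (fun x => ∫ t in (0 : ℝ)..x, f t) = f := funext fun x => (hd x).deriv
  refine ⟨_, contDiff_infty_iff_deriv.2 ⟨fun x => (hd x).differentiableAt, ?_⟩, hd', fun x => rfl⟩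
  rw [hd']; exact hf

/-- A smooth step from `0` to `1` in the interval `(c - R, c + R)`, with slope at most `1 / (2 r)`. -/
lemma exists_smooth_step {c r R : ℝ} (hr : 0 < r) (hrR : r < R) (hc : R ≤ c) :
    ∃ k : ℝ → ℝ, ContDiff ℝ ∞ k ∧ (∀ x, x ≤ c - R → k x = 0) ∧ (∀ x, c + R ≤ x → k x = 1) ∧
      (∀ x, 0 ≤ k x) ∧ (∀ x, k x ≤ 1) ∧ (∀ x, 0 ≤ deriv k x) ∧ (∀ x, deriv k x ≤ 1 / (2 * r)) := by
  -- k is the primitive of a bump of integral 1. The bump is at most the inverse of the length 2r of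
  -- its inner interval, which bounds the slope. Since 0 ≤ c - R, integrating from 0 captures the
  -- whole support.
  let b : ContDiffBump c := ⟨r, R, hr, hrR⟩
  obtain ⟨k, hk, hk', hki⟩ := exists_primitive (b.contDiff_normed (μ := MeasureTheory.volume) (n := ⊤))
  have hmono : Monotone k := monotone_of_deriv_nonneg (hk.differentiable (by simp)) fun x => by
    rw [hk']; exact b.nonneg_normed x
  have hsupp : ∀ x, x ≤ c - R → b.normed MeasureTheory.volume x = 0 := by
    intro x hx
    have : x ∉ Function.support (b.normed MeasureTheory.volume) := by
      rw [b.support_normed_eq, Metric.mem_ball, Real.dist_eq, not_lt]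
      exact le_abs.2 (Or.inr (by change R ≤ _; linarith))
    simpa using this
  have h0 : ∀ x, x ≤ c - R → k x = 0 := by
    intro x hx
    rw [hki]
    refine intervalIntegral.integral_zero_ae (Filter.Eventually.of_forall fun t ht => hsupp t ?_)
    exact (Set.uIoc_subset_uIcc ht).2.trans (max_le (by linarith) hx)
  have h1 : ∀ x, c + R ≤ x → k x = 1 := by
    intro x hx
    rw [hki, intervalIntegral.integral_eq_integral_of_support_subset, b.integral_normed]
    rw [b.support_normed_eq, Real.ball_eq_Ioo]
    intro t ht
    have ht1 : c - R < t := ht.1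
    have ht2 : t < c + R := ht.2
    exact ⟨by linarith, by linarith⟩
  refine ⟨k, hk, h0, h1, fun x => ?_, fun x => ?_, fun x => ?_, fun x => ?_⟩
  · rw [← h0 (min x (c - R)) (min_le_right _ _)]
    exact hmono (min_le_left _ _)
  · rw [← h1 (max x (c + R)) (le_max_right _ _)]
    exact hmono (le_max_left _ _)
  · rw [hk']; exact b.nonneg_normed x
  · rw [hk']
    refine (b.normed_le_div_measure_closedBall_rIn MeasureTheory.volume x).trans (le_of_eq ?_)
    rw [MeasureTheory.measureReal_def, Real.volume_closedBall, ENNReal.toReal_ofReal (by positivity)]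

/-- χ' climbs from 0 at 0.36 to 2 at 1 with slope at most 2/(2·0.31) < 3.3, keeps the value 2 up to
1.055 and falls to 0 before 1.1. The fall is very steep, which is harmless as χ'' is bounded only
from above. The remaining half is the mirror image in 1.125, which preserves χ'' and ends the
support at 2.25 - 0.36 = 1.89. -/
lemma exists_profile : ∃ χ : ℝ → ℝ, ContDiff ℝ ∞ χ ∧ (∀ x, 0 ≤ χ x) ∧
    (∀ x, x ≤ 0.36 → χ x = 0) ∧ (∀ x, 1.89 ≤ x → χ x = 0) ∧ deriv χ 1 = 2 ∧
    ∀ x, deriv (deriv χ) x ≤ 3.3 := by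
  obtain ⟨k, hk, hk0, hk1, hkn, hkl, hkd, hkd'⟩ :=
    exists_smooth_step (c := 0.68) (r := 0.31) (R := 0.32) (by norm_num) (by norm_num) (by norm_num)
  obtain ⟨l, hl, hl0, hl1, hln, hll, hld, -⟩ :=
    exists_smooth_step (c := 1.075) (r := 0.01) (R := 0.02) (by norm_num) (by norm_num) (by norm_num)
  have hD : ContDiff ℝ ∞ fun x => 2 * (k x - l x) := contDiff_const.mul (hk.sub hl)
  obtain ⟨K, hK, hK', hKi⟩ := exists_primitive hD
  have hDn : ∀ x, 0 ≤ 2 * (k x - l x) := by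
    intro x
    rcases le_total x 1.055 with h | h
    · rw [hl0 x (by norm_num at h ⊢; linarith)]; linarith [hkn x]
    · rw [hk1 x (by norm_num at h ⊢; linarith)]; linarith [hll x]
  have hD0 : ∀ x, x ≤ 0.36 → 2 * (k x - l x) = 0 := fun x h => by
    rw [hk0 x (by norm_num at h ⊢; linarith), hl0 x (by norm_num at h ⊢; linarith)]; norm_num
  have hD1 : ∀ x, 1.1 ≤ x → 2 * (k x - l x) = 0 := fun x h => by
    rw [hk1 x (by norm_num at h ⊢; linarith), hl1 x (by norm_num at h ⊢; linarith)]; norm_num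
  have hKm : Monotone K := monotone_of_deriv_nonneg (hK.differentiable (by simp)) fun x => by
    rw [hK']; exact hDn x
  have hK0 : ∀ x, x ≤ 0.36 → K x = 0 := fun x hx => by
    rw [hKi]
    refine intervalIntegral.integral_zero_ae (Filter.Eventually.of_forall fun t ht => hD0 t ?_)
    exact (Set.uIoc_subset_uIcc ht).2.trans (max_le (by norm_num) hx)
  have hK1 : ∀ x, 1.1 ≤ x → K x = K 2.25 := fun x hx => by
    rw [← sub_eq_zero, hKi, hKi, intervalIntegral.integral_interval_sub_left
      (hD.continuous.intervalIntegrable _ _) (hD.continuous.intervalIntegrable _ _)]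
    refine intervalIntegral.integral_zero_ae (Filter.Eventually.of_forall fun t ht => hD1 t ?_)
    exact (le_min (by norm_num) hx).trans (Set.uIoc_subset_uIcc ht).1
  have hKn : ∀ x, 0 ≤ K x := fun x => by
    rw [← hK0 (min x 0.36) (min_le_right _ _)]
    exact hKm (min_le_left _ _)
  have hr : ContDiff ℝ ∞ fun x : ℝ => 2.25 - x := by fun_prop
  have hd : ∀ {f : ℝ → ℝ}, ContDiff ℝ ∞ f → ∀ x, HasDerivAt f (deriv f x) x := fun hf x =>
    (hf.differentiable (by simp) x).hasDerivAt
  have hdr : ∀ {f : ℝ → ℝ}, ContDiff ℝ ∞ f → ∀ x,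
      HasDerivAt (fun x => f (2.25 - x)) (-deriv f (2.25 - x)) x := fun hf x => by
    simpa using (hd hf (2.25 - x)).comp_const_sub 2.25 x
  -- For x ≤ 1.15 this function is K x, and for x ≥ 1.1 it is the mirror image K (2.25 - x); the
  -- subtracted constant is the common plateau value.
  have hχ' : deriv (fun x => K x + K (2.25 - x) - K 2.25)
      = fun x => 2 * (k x - l x) - 2 * (k (2.25 - x) - l (2.25 - x)) := by
    funext x
    rw [(((hd hK x).fun_add (hdr hK x)).sub_const (K 2.25)).deriv, hK']
    ring
  refine ⟨fun x => K x + K (2.25 - x) - K 2.25, (hK.add (hK.comp hr)).sub contDiff_const,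
    fun x => ?_, fun x hx => ?_, fun x hx => ?_, ?_, fun x => ?_⟩
  · rcases le_total x 1.125 with h | h
    · simp only [hK1 (2.25 - x) (by norm_num at h ⊢; linarith)]; linarith [hKn x]
    · simp only [hK1 x (by norm_num at h ⊢; linarith)]; linarith [hKn (2.25 - x)]
  · simp only [hK0 x hx, hK1 (2.25 - x) (by norm_num at hx ⊢; linarith)]; ring
  · simp only [hK0 (2.25 - x) (by norm_num at hx ⊢; linarith), hK1 x (by norm_num at hx ⊢; linarith)]
    ring
  · rw [hχ']
    simp only [hD1 (2.25 - 1) (by norm_num), hk1 1 (by norm_num), hl0 1 (by norm_num)]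
    norm_num
  · rw [hχ', (((hd hD x)).fun_sub (hdr hD x)).deriv]
    have hDd : ∀ x, deriv (fun x => 2 * (k x - l x)) x = 2 * (deriv k x - deriv l x) := fun x =>
      (((hd hk x).fun_sub (hd hl x)).const_mul 2).deriv
    have hDb : ∀ x, deriv (fun x => 2 * (k x - l x)) x ≤ 3.3 := fun x => by
      rw [hDd]
      have := hkd' x
      have := hld x
      norm_num at *
      linarith
    have hDz : ∀ x, 1.12 ≤ x → deriv (fun x => 2 * (k x - l x)) x = 0 := fun x hx => by
      have : (fun x => 2 * (k x - l x)) =ᶠ[nhds x] fun _ => 0 := by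
        filter_upwards [lt_mem_nhds (show (1.1 : ℝ) < x by norm_num at hx ⊢; linarith)] with y hy
        exact hD1 y hy.le
      rw [this.deriv_eq, deriv_const]
    rcases le_total x 1.125 with h | h
    · rw [hDz (2.25 - x) (by norm_num at h ⊢; linarith)]; linarith [hDb x]
    · rw [hDz x (by norm_num at h ⊢; linarith)]; linarith [hDb (2.25 - x)]

end Profile

/-! ### Covariant acceleration for the perturbed metric -/

section Acceleration

variable {n : ℕ}

/-- The terms containing L p come from the second derivative of the parametrization, which points
along p. -/
lemma partialDeriv_stereoTensor_zero {E E' : Type*} [NormedAddCommGroup E] [InnerProductSpace ℝ E]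
    [NormedAddCommGroup E'] [InnerProductSpace ℝ E'] {F : E → ℝ} (hF : ContDiff ℝ ∞ F) (L : E →L[ℝ] E')
    (p : E) (e : Fin n → E) (k i j : Fin n) :
    partialDeriv k (stereoTensor F L p e i j) 0 = fderiv ℝ F p (e k) * inner ℝ (L (e i)) (L (e j))
      - F p * ((if i = k then (1 : ℝ) else 0) * inner ℝ (L p) (L (e j))
        + (if j = k then (1 : ℝ) else 0) * inner ℝ (L (e i)) (L p)) := by
  have hX := contDiff_stereoParam p e
  have hT : ∀ i, ContDiff ℝ ∞ fun y => fderiv ℝ (stereoParam p e) y (coordVec i) := fun i =>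
    (hX.fderiv_right (m := ∞) (by simp)).clm_apply contDiff_const
  have hLT : ∀ i, HasFDerivAt (fun y => L (fderiv ℝ (stereoParam p e) y (coordVec i))) _ 0 := fun i =>
    L.hasFDerivAt.comp (0 : EuclideanSpace ℝ (Fin n)) ((hT i).differentiable (by simp) 0).hasFDerivAt
  have hFX : HasFDerivAt (fun y => F (stereoParam p e y)) _ 0 :=
    (hF.differentiable (by simp) (stereoParam p e 0)).hasFDerivAt.comp (0 : EuclideanSpace ℝ (Fin n))
      (hX.differentiable (by simp) 0).hasFDerivAt
  have h : HasFDerivAt (stereoTensor F L p e i j) _ 0 := hFX.mul ((hLT i).inner ℝ (hLT j))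
  have hin : ∀ a : Fin n, (inner ℝ (coordVec a) (coordVec k) : ℝ) = if a = k then 1 else 0 := fun a => by
    simp [EuclideanSpace.inner_single_left, PiLp.single_apply]
  have hT0 : ∀ a : Fin n, fderiv ℝ (stereoParam p e) 0 (coordVec a) = e a := fun a => by
    rw [hasFDerivAt_stereoParam_zero, ← frameMap_apply, frameMap_coordVec]
  rw [partialDeriv, h.fderiv]
  simp only [add_apply, smul_apply, ContinuousLinearMap.comp_apply, ContinuousLinearMap.prod_apply,
    fderivInnerCLM_apply, fderiv_fderiv_stereoParam_zero, hT0, hin, stereoParam_zero, map_smul,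
    map_neg, neg_smul, inner_neg_left, inner_neg_right, real_inner_smul_left, real_inner_smul_right,
    smul_eq_mul]
  ring

/-- The coordinates of the orthogonal projection in the frame `e`. -/
def frameCoord {E : Type*} [NormedAddCommGroup E] [InnerProductSpace ℝ E] (e : Fin n → E) :
    E →L[ℝ] EuclideanSpace ℝ (Fin n) :=
  ∑ k, (innerSL ℝ (e k)).smulRight (coordVec k)

lemma frameCoord_apply {E : Type*} [NormedAddCommGroup E] [InnerProductSpace ℝ E] (e : Fin n → E)
    (x : E) (k : Fin n) : frameCoord e x k = inner ℝ (e k) x := by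
  simp [frameCoord, Pi.single_apply]

lemma extChartAt_eq_smul (p q : Sph n) :
    extChartAt (𝓡 n) p q = (2 / (1 + inner ℝ (p : EuclideanSpace ℝ (Fin (n + 1)))
      (q : EuclideanSpace ℝ (Fin (n + 1)))) : ℝ) •
        frameCoord (sphFrame p) (q : EuclideanSpace ℝ (Fin (n + 1))) := by
  ext k
  rw [extChartAt_apply_eq, PiLp.smul_apply, frameCoord_apply, smul_eq_mul]
  ring

lemma contDiff_coe_curve {c : ℝ → Sph n} (hc : ContMDiff 𝓘(ℝ, ℝ) (𝓡 n) ∞ c) :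
    ContDiff ℝ ∞ fun s => (c s : EuclideanSpace ℝ (Fin (n + 1))) :=
  (contMDiff_coe_sph.comp hc).contDiff

lemma inner_curve_deriv {c : ℝ → Sph n} (hc : ContMDiff 𝓘(ℝ, ℝ) (𝓡 n) ∞ c) (t : ℝ) :
    inner ℝ (c t : EuclideanSpace ℝ (Fin (n + 1)))
      (deriv (fun s => (c s : EuclideanSpace ℝ (Fin (n + 1)))) t) = (0 : ℝ) := by
  have hC := contDiff_coe_curve hc
  have h := ((hC.differentiable (by simp) t).hasDerivAt).norm_sq
  have h1 : (fun s => ‖(c s : EuclideanSpace ℝ (Fin (n + 1)))‖ ^ 2) = fun _ => 1 := by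
    funext s; rw [norm_eq_of_mem_sphere]; norm_num
  rw [h1] at h
  have := h.unique (hasDerivAt_const t 1)
  linarith

lemma inner_curve_deriv_deriv {c : ℝ → Sph n} (hc : ContMDiff 𝓘(ℝ, ℝ) (𝓡 n) ∞ c) (t : ℝ) :
    inner ℝ (c t : EuclideanSpace ℝ (Fin (n + 1)))
      (deriv (deriv fun s => (c s : EuclideanSpace ℝ (Fin (n + 1)))) t)
      = -‖deriv (fun s => (c s : EuclideanSpace ℝ (Fin (n + 1)))) t‖ ^ 2 := by
  have hC := contDiff_coe_curve hc
  have hC' : ContDiff ℝ ∞ (deriv fun s => (c s : EuclideanSpace ℝ (Fin (n + 1)))) :=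
    (contDiff_infty_iff_deriv.1 hC).2
  have h := (hC.differentiable (by simp) t).hasDerivAt.inner ℝ (hC'.differentiable (by simp) t).hasDerivAt
  rw [funext (inner_curve_deriv hc)] at h
  have := h.unique (hasDerivAt_const t 0)
  rw [real_inner_self_eq_norm_sq] at this
  linarith

/-- The coordinates are 2⟨e,q⟩/(1+⟨p,q⟩). Along a curve through p the denominator is 2 up to second
order while ⟨e,q⟩ vanishes at p, so the chart agrees to second order with orthogonal projection to
the frame. -/
lemma deriv_extChartAt_curve {c : ℝ → Sph n} (hc : ContMDiff 𝓘(ℝ, ℝ) (𝓡 n) ∞ c) (t : ℝ) :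
    velocity (n := n) c t = frameCoord (sphFrame (c t))
        (deriv (fun s => (c s : EuclideanSpace ℝ (Fin (n + 1)))) t) ∧
      deriv (deriv fun s => extChartAt (𝓡 n) (c t) (c s)) t = frameCoord (sphFrame (c t))
        (deriv (deriv fun s => (c s : EuclideanSpace ℝ (Fin (n + 1)))) t) := by
  set C : ℝ → EuclideanSpace ℝ (Fin (n + 1)) := fun s => (c s : EuclideanSpace ℝ (Fin (n + 1))) with hCdef
  have hC : ContDiff ℝ ∞ C := contDiff_coe_curve hc
  have hC' : ContDiff ℝ ∞ (deriv C) := (contDiff_infty_iff_deriv.1 hC).2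
  have hd : ∀ s, HasDerivAt C (deriv C s) s := fun s => (hC.differentiable (by simp) s).hasDerivAt
  have hd' : ∀ s, HasDerivAt (deriv C) (deriv (deriv C) s) s := fun s =>
    (hC'.differentiable (by simp) s).hasDerivAt
  have hΦ : frameCoord (sphFrame (c t)) (C t) = 0 := by
    ext k
    rw [frameCoord_apply]
    exact (isFrame_sphFrame (c t)).inner_base k
  have hpp : (inner ℝ (C t) (C t) : ℝ) = 1 := by
    rw [real_inner_self_eq_norm_sq]
    simp [hCdef]
  have hpd : (inner ℝ (C t) (deriv C t) : ℝ) = 0 := inner_curve_deriv hc t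
  have hin : ∀ s, HasDerivAt (fun s => 1 + (inner ℝ (C t) (C s) : ℝ)) (inner ℝ (C t) (deriv C s)) s := by
    intro s
    simpa using ((hasDerivAt_const s (C t)).inner ℝ (hd s)).const_add 1
  have hin' : HasDerivAt (fun s => (inner ℝ (C t) (deriv C s) : ℝ)) (inner ℝ (C t) (deriv (deriv C) t)) t := by
    simpa using ((hasDerivAt_const t (C t)).inner ℝ (hd' t))
  have hz : ∀ s, HasDerivAt (fun s => frameCoord (sphFrame (c t)) (C s))
      (frameCoord (sphFrame (c t)) (deriv C s)) s := fun s =>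
    (frameCoord (sphFrame (c t))).hasFDerivAt.comp_hasDerivAt s (hd s)
  have hz' : HasDerivAt (fun s => frameCoord (sphFrame (c t)) (deriv C s))
      (frameCoord (sphFrame (c t)) (deriv (deriv C) t)) t :=
    (frameCoord (sphFrame (c t))).hasFDerivAt.comp_hasDerivAt t (hd' t)
  have hy : (fun s => extChartAt (𝓡 n) (c t) (c s)) = fun s =>
      (2 * (1 + (inner ℝ (C t) (C s) : ℝ))⁻¹) • frameCoord (sphFrame (c t)) (C s) := by
    funext s
    rw [extChartAt_eq_smul, div_eq_mul_inv]
  have hne : ∀ᶠ s in nhds t, 1 + (inner ℝ (C t) (C s) : ℝ) ≠ 0 :=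
    (hin t).continuousAt.eventually_ne (by rw [hpp]; norm_num)
  have hyd : ∀ s, 1 + (inner ℝ (C t) (C s) : ℝ) ≠ 0 → HasDerivAt (fun s =>
      (2 * (1 + (inner ℝ (C t) (C s) : ℝ))⁻¹) • frameCoord (sphFrame (c t)) (C s))
      ((2 * (1 + (inner ℝ (C t) (C s) : ℝ))⁻¹) • frameCoord (sphFrame (c t)) (deriv C s)
        + (2 * (-(inner ℝ (C t) (deriv C s) : ℝ) / (1 + (inner ℝ (C t) (C s) : ℝ)) ^ 2)) •
          frameCoord (sphFrame (c t)) (C s)) s := fun s hs =>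
    (((hin s).fun_inv hs).const_mul 2).fun_smul (hz s)
  have hnet : 1 + (inner ℝ (C t) (C t) : ℝ) ≠ 0 := by rw [hpp]; norm_num
  constructor
  · rw [velocity, hy, (hyd t hnet).deriv, hΦ, hpp]
    norm_num
  · rw [hy]
    have hev := hne.mono fun s hs => (hyd s hs).deriv
    rw [Filter.EventuallyEq.deriv_eq hev]
    have h1 := (((hin t).fun_inv hnet).const_mul 2).fun_smul hz'
    have h2 := ((hin'.fun_neg.fun_div ((hin t).fun_pow 2) (pow_ne_zero 2 hnet)).const_mul 2).fun_smul (hz t)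
    rw [(h1.fun_add h2).deriv, hΦ, hpp, hpd]
    norm_num

lemma IsFrame.frameMap_frameCoord {E : Type*} [NormedAddCommGroup E] [InnerProductSpace ℝ E]
    {p : E} {e : Fin n → E} (h : IsFrame p e) (x : E) :
    frameMap e (frameCoord e x) = x - (inner ℝ x p : ℝ) • p := by
  rw [frameMap_apply]
  simp only [frameCoord_apply, h.sum_smul]

end Acceleration

/-! ### Covariant acceleration expressed by the ambient derivatives of a curve -/

section CovariantAcceleration

variable {n : ℕ} {E' : Type*} [NormedAddCommGroup E'] [InnerProductSpace ℝ E']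
  (F : EuclideanSpace ℝ (Fin (n + 1)) → ℝ) (hF : ContDiff ℝ ∞ F) (hF0 : ∀ x, 0 ≤ F x)
  (L : EuclideanSpace ℝ (Fin (n + 1)) →L[ℝ] E')

lemma metricMatrix_pertMetric_eq (p : Sph n) (i j : Fin n) :
    (fun y => metricMatrix (pertMetric F hF hF0 L) p y i j)
      = fun y => 16 * (‖y‖ ^ 2 + 4)⁻¹ ^ 2 * (if i = j then 1 else 0)
        + stereoTensor F L (p : EuclideanSpace ℝ (Fin (n + 1))) (sphFrame p) i j y := by
  funext y
  rw [metricMatrix_pertMetric, (isFrame_sphFrame p).inner_fderiv_stereoParam, stereoTensor]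
  have : (inner ℝ (coordVec i) (coordVec j) : ℝ) = if i = j then 1 else 0 := by
    simp [EuclideanSpace.inner_single_left, PiLp.single_apply]
  rw [this]

lemma metricMatrix_pertMetric_center (p : Sph n) :
    metricMatrix (pertMetric F hF hF0 L) p 0
      = pertMatrix F L (p : EuclideanSpace ℝ (Fin (n + 1))) (sphFrame p) 1 := by
  ext i j
  refine (congrFun (metricMatrix_pertMetric_eq F hF hF0 L p i j) 0).trans ?_
  rw [pertMatrix, Matrix.of_apply]
  norm_num

lemma partialDeriv_metricMatrix_pertMetric_center (p : Sph n) (k i j : Fin n) :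
    partialDeriv k (fun z => metricMatrix (pertMetric F hF hF0 L) p z i j) 0
      = partialDeriv k (stereoTensor F L (p : EuclideanSpace ℝ (Fin (n + 1))) (sphFrame p) i j) 0 := by
  rw [metricMatrix_pertMetric_eq,
    partialDeriv_add (contDiff_conformal _) (contDiff_stereoTensor L hF _ _ i j),
    partialDeriv_conformal]
  simp

-- Hypothesis `h` is the Koszul formula for the form ⟨·,·⟩ + F⟨L·,L·⟩ in the ambient space, tested
-- on tangent vectors x only: the covariant acceleration is the tangential part of the ambient one.
-- It determines w because the Gram matrix is invertible.
variable {F L} in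
lemma covAcceleration_pertMetric {c : ℝ → Sph n} (hc : ContMDiff 𝓘(ℝ, ℝ) (𝓡 n) ∞ c) (t : ℝ)
    {u a w : EuclideanSpace ℝ (Fin (n + 1))}
    (hu : u = deriv (fun s => (c s : EuclideanSpace ℝ (Fin (n + 1)))) t)
    (ha : a = deriv (deriv fun s => (c s : EuclideanSpace ℝ (Fin (n + 1)))) t)
    (hw : inner ℝ w (c t : EuclideanSpace ℝ (Fin (n + 1))) = (0 : ℝ))
    (h : ∀ x, inner ℝ x (c t : EuclideanSpace ℝ (Fin (n + 1))) = (0 : ℝ) →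
      inner ℝ x w + F (c t) * inner ℝ (L x) (L w) = inner ℝ x a + F (c t) * inner ℝ (L x) (L a)
      + fderiv ℝ F (c t) u * inner ℝ (L u) (L x) - 1 / 2 * fderiv ℝ F (c t) x * ‖L u‖ ^ 2) :
    covAcceleration (pertMetric F hF hF0 L) c t = frameCoord (sphFrame (c t)) w := by
  set p : EuclideanSpace ℝ (Fin (n + 1)) := (c t : EuclideanSpace ℝ (Fin (n + 1))) with hp
  set e := sphFrame (c t) with he
  have hpe : IsFrame p e := isFrame_sphFrame (c t)
  have hup : inner ℝ u p = (0 : ℝ) := by rw [hu, real_inner_comm]; exact inner_curve_deriv hc t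
  have hap : inner ℝ a p = -‖u‖ ^ 2 := by
    rw [hu, ha, real_inner_comm]; exact inner_curve_deriv_deriv hc t
  obtain ⟨hV, hY⟩ := deriv_extChartAt_curve hc t
  rw [← hu] at hV
  rw [← ha] at hY
  set V := frameCoord e u with hVdef
  have hVu : frameMap e V = u := by rw [hVdef, hpe.frameMap_frameCoord, hup, zero_smul, sub_zero]
  have hVV : ∑ i, V i * V i = ‖u‖ ^ 2 := by
    rw [← hVu, ← real_inner_self_eq_norm_sq, hpe.inner_frameMap, PiLp.inner_apply]
    rfl
  have hsum : ∀ (f : EuclideanSpace ℝ (Fin (n + 1)) →L[ℝ] ℝ) (z : EuclideanSpace ℝ (Fin n)),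
      ∑ i, z i * f (e i) = f (frameMap e z) := fun f z => by
    simp [frameMap_apply, map_sum]
  have hdet : (pertMatrix F L p e 1).det ≠ 0 := (det_pertMatrix_pos (hF0 p) L e zero_le_one).ne'
  have hG : ∀ (z : EuclideanSpace ℝ (Fin n)) (l : Fin n), ∑ j, pertMatrix F L p e 1 l j * z j
      = z l + F p * inner ℝ (L (e l)) (L (frameMap e z)) := fun z l => by
    have h1 := hsum ((innerSL ℝ (L (e l))).comp L) z
    simp only [ContinuousLinearMap.comp_apply, innerSL_apply_apply] at h1
    rw [← h1, Finset.mul_sum]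
    simp only [pertMatrix, Matrix.of_apply, stereoTensor_zero, add_mul, Finset.sum_add_distrib,
      ite_mul, one_mul, zero_mul, Finset.sum_ite_eq, Finset.mem_univ, if_true]
    congr 1
    exact Finset.sum_congr rfl fun j _ => by ring
  -- The Christoffel symbols of the first kind contracted twice with the velocity. The term in L p
  -- is an effect of the chart; in `hkey` it cancels against the component of a along p, since ⟨a,p⟩
  -- = -‖u‖².
  let ξ : Fin n → ℝ := fun l => fderiv ℝ F p u * inner ℝ (L u) (L (e l))
    - F p * ‖u‖ ^ 2 * inner ℝ (L p) (L (e l)) - 1 / 2 * fderiv ℝ F p (e l) * ‖L u‖ ^ 2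
  have hξ : ∀ l, ∑ i, ∑ j, (partialDeriv i (stereoTensor F L p e j l) 0
      + partialDeriv j (stereoTensor F L p e i l) 0 - partialDeriv l (stereoTensor F L p e i j) 0)
        * V i * V j = 2 * ξ l := fun l => by
    have hD := hsum (fderiv ℝ F p) V
    have hb := hsum ((innerSL ℝ (L p)).comp L) V
    have hLe := hsum ((innerSL ℝ (L (e l))).comp L) V
    have hLu := hsum ((innerSL ℝ (L u)).comp L) V
    have hLL : ∑ i, ∑ j, (inner ℝ (L (e i)) (L (e j)) : ℝ) * (V i * V j) = ‖L u‖ ^ 2 := by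
      rw [← real_inner_self_eq_norm_sq, ← hVu, frameMap_apply]
      simp only [map_sum, map_smul, sum_inner, inner_sum, real_inner_smul_left, real_inner_smul_right]
      rw [Finset.sum_comm]
      exact Finset.sum_congr rfl fun i _ => Finset.sum_congr rfl fun j _ => by ring
    simp only [ContinuousLinearMap.comp_apply, innerSL_apply_apply, hVu] at hD hb hLe hLu
    have hb' : ∀ i, (inner ℝ (L (e i)) (L p) : ℝ) = inner ℝ (L p) (L (e i)) := fun i => real_inner_comm _ _
    have hl' : ∀ i, (inner ℝ (L (e i)) (L (e l)) : ℝ) = inner ℝ (L (e l)) (L (e i)) :=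
      fun i => real_inner_comm _ _
    simp only [partialDeriv_stereoTensor_zero hF, hb', hl']
    calc _ = ∑ i, ∑ j, ((V i * fderiv ℝ F p (e i)) * (V j * inner ℝ (L (e l)) (L (e j)))
          + (V i * inner ℝ (L (e l)) (L (e i))) * (V j * fderiv ℝ F p (e j))
          - 2 * F p * inner ℝ (L p) (L (e l)) * ((if i = j then V i * V j else 0))
          - F p * ((if l = i then V i else 0) * (V j * inner ℝ (L p) (L (e j))))
          - F p * ((V i * inner ℝ (L p) (L (e i))) * (if l = j then V j else 0))
          - fderiv ℝ F p (e l) * (inner ℝ (L (e i)) (L (e j)) * (V i * V j))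
          + F p * ((if l = i then V i else 0) * (V j * inner ℝ (L p) (L (e j))))
          + F p * ((V i * inner ℝ (L p) (L (e i))) * (if l = j then V j else 0))) := by
            refine Finset.sum_congr rfl fun i _ => Finset.sum_congr rfl fun j _ => ?_
            simp only [eq_comm (a := j), eq_comm (b := l)]
            split_ifs <;> ring
      _ = _ := by
            simp only [Finset.sum_add_distrib, Finset.sum_sub_distrib, ← Finset.mul_sum,
              ← Finset.sum_mul, hLL, hD, hLe, hb]
            simp only [Finset.sum_ite_eq, Finset.mem_univ, if_true, hVV, ξ, real_inner_comm (L u)]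
            ring
  have hkey : ∀ l, ∑ j, pertMatrix F L p e 1 l j * frameCoord e w j
      = ∑ j, pertMatrix F L p e 1 l j * frameCoord e a j + ξ l := fun l => by
    rw [hG, hG, hpe.frameMap_frameCoord, hpe.frameMap_frameCoord, hw, hap, frameCoord_apply,
      frameCoord_apply]
    have := h (e l) (hpe.inner_base l)
    simp only [zero_smul, sub_zero, map_sub, map_smul, inner_sub_right, real_inner_smul_right, ξ,
      real_inner_comm (L p)]
    linear_combination this
  have hmul : (pertMatrix F L p e 1).mulVec (fun j => frameCoord e w j)
      = (pertMatrix F L p e 1).mulVec (fun j => frameCoord e a j) + ξ := funext hkey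
  have hinv := congrArg (pertMatrix F L p e 1)⁻¹.mulVec hmul
  rw [Matrix.mulVec_add, Matrix.mulVec_mulVec, Matrix.mulVec_mulVec,
    Matrix.nonsing_inv_mul _ hdet.isUnit, Matrix.one_mulVec, Matrix.one_mulVec] at hinv
  ext k
  refine Eq.trans ?_ (congrFun hinv k).symm
  rw [Pi.add_apply, covAcceleration]
  simp only [hV, hY, extChartAt_self_eq_zero, christoffel, metricMatrix_pertMetric_center,
    partialDeriv_metricMatrix_pertMetric_center]
  congr 1
  rw [Matrix.mulVec, dotProduct]
  have h2 : ∀ l, ξ l = (1 / 2) * (2 * ξ l) := fun l => by ring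
  conv_rhs => enter [2, l]; rw [h2 l, ← hξ l]
  simp only [Finset.mul_sum, Finset.sum_mul]
  rw [Finset.sum_congr rfl fun i _ => Finset.sum_comm, Finset.sum_comm]
  exact Finset.sum_congr rfl fun l _ => Finset.sum_congr rfl fun i _ =>
    Finset.sum_congr rfl fun j _ => by ring

end CovariantAcceleration

/-! ### The shifted sphere is totally geodesic -/

section TotallyGeodesic

variable {n : ℕ} {W : Submodule ℝ (EuclideanSpace ℝ (Fin (n + 1)))} {ν : EuclideanSpace ℝ (Fin (n + 1))}
  {θ : ℝ}

lemma mem_shift_iff (hν : ν ∈ Wᗮ) (hθ : 0 < Real.cos θ) {p : Sph n} :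
    p ∈ shift (subSphere W) ν θ ↔
      (p : EuclideanSpace ℝ (Fin (n + 1))) = W.starProjection p + Real.sin θ • ν ∧
        ‖W.starProjection (p : EuclideanSpace ℝ (Fin (n + 1)))‖ = Real.cos θ := by
  constructor
  · rintro ⟨y, hy, h⟩
    have hP : W.starProjection (p : EuclideanSpace ℝ (Fin (n + 1))) =
        Real.cos θ • (y : EuclideanSpace ℝ (Fin (n + 1))) := by
      rw [h, map_add, map_smul, map_smul, Submodule.starProjection_eq_self_iff.2 hy,
        (Submodule.starProjection_apply_eq_zero_iff _).2 hν, smul_zero, add_zero]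
    rw [hP]
    refine ⟨h, ?_⟩
    rw [norm_smul, norm_eq_of_mem_sphere, mul_one, Real.norm_of_nonneg hθ.le]
  · rintro ⟨h1, h2⟩
    refine ⟨⟨(Real.cos θ)⁻¹ • W.starProjection (p : EuclideanSpace ℝ (Fin (n + 1))), ?_⟩, ?_, ?_⟩
    · rw [mem_sphere_zero_iff_norm, norm_smul, h2, norm_inv, Real.norm_of_nonneg hθ.le,
        inv_mul_cancel₀ hθ.ne']
    · exact W.smul_mem _ (W.starProjection_apply_mem _)
    · rw [smul_inv_smul₀ hθ.ne']
      exact h1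

lemma frameCoord_mem_tangentVectors (hν : ν ∈ Wᗮ) (hν1 : ‖ν‖ = 1) (hθ : 0 < Real.cos θ) {p : Sph n}
    (hp : p ∈ shift (subSphere W) ν θ) {w : EuclideanSpace ℝ (Fin (n + 1))} (hw : w ∈ W)
    (hwp : inner ℝ w (p : EuclideanSpace ℝ (Fin (n + 1))) = (0 : ℝ)) :
    frameCoord (sphFrame p) w ∈ tangentVectors n (shift (subSphere W) ν θ) p := by
  obtain ⟨y, hy, hpy⟩ := id hp
  have hy1 : ‖(y : EuclideanSpace ℝ (Fin (n + 1)))‖ = 1 := norm_eq_of_mem_sphere y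
  have hwν : (inner ℝ w ν : ℝ) = 0 := hν w hw
  have hwy : (inner ℝ (y : EuclideanSpace ℝ (Fin (n + 1))) w : ℝ) = 0 := by
    rw [hpy, inner_add_right, real_inner_smul_right, real_inner_smul_right, hwν, mul_zero,
      add_zero] at hwp
    rw [real_inner_comm]
    exact (mul_eq_zero.1 hwp).resolve_left hθ.ne'
  -- Rational parametrization of the great circle through y in the direction w. It needs no division
  -- by ‖w‖, so w = 0 is not a special case; k is chosen to make the norm of `z` equal to 1.
  set k := ‖w‖ ^ 2 / (2 * Real.cos θ) ^ 2 with hk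
  have hk0 : 0 ≤ k := by positivity
  have hpos : ∀ s : ℝ, 0 < 1 + s ^ 2 * k := fun s => by positivity
  let z : ℝ → EuclideanSpace ℝ (Fin (n + 1)) := fun s =>
    (1 + s ^ 2 * k)⁻¹ • ((1 - s ^ 2 * k) • (y : EuclideanSpace ℝ (Fin (n + 1)))
      + (s / Real.cos θ) • w)
  have hzW : ∀ s, z s ∈ W := fun s =>
    W.smul_mem _ (W.add_mem (W.smul_mem _ hy) (W.smul_mem _ hw))
  have hz1 : ∀ s, ‖z s‖ = 1 := fun s => by
    have h1 : ‖(1 - s ^ 2 * k) • (y : EuclideanSpace ℝ (Fin (n + 1))) + (s / Real.cos θ) • w‖ ^ 2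
        = (1 + s ^ 2 * k) ^ 2 := by
      rw [norm_add_sq_real, norm_smul, norm_smul, real_inner_smul_left, real_inner_smul_right, hwy,
        hy1, mul_pow, mul_pow, Real.norm_eq_abs, sq_abs, Real.norm_eq_abs, sq_abs, hk]
      field_simp
      ring
    rw [norm_smul, (sq_eq_sq₀ (norm_nonneg _) (hpos s).le).1 h1, norm_inv,
      Real.norm_of_nonneg (hpos s).le, inv_mul_cancel₀ (hpos s).ne']
  have hzν : ∀ s, (inner ℝ (z s) ν : ℝ) = 0 := fun s => hν _ (hzW s)
  let γ : ℝ → EuclideanSpace ℝ (Fin (n + 1)) := fun s => Real.cos θ • z s + Real.sin θ • ν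
  have hγ1 : ∀ s, γ s ∈ Metric.sphere (0 : EuclideanSpace ℝ (Fin (n + 1))) 1 := fun s => by
    rw [mem_sphere_zero_iff_norm, ← sq_eq_sq₀ (norm_nonneg _) zero_le_one, norm_add_sq_real,
      norm_smul _ (z s), norm_smul _ ν, real_inner_smul_left, real_inner_smul_right, hzν, hz1, hν1, mul_one, mul_one,
      Real.norm_eq_abs, sq_abs, Real.norm_eq_abs, sq_abs]
    have := Real.sin_sq_add_cos_sq θ
    linarith
  have hzd : ContDiff ℝ ∞ z := by
    have h1 : ContDiff ℝ ∞ fun s : ℝ => s ^ 2 * k := (contDiff_id.pow 2).mul contDiff_const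
    exact ((contDiff_const.add h1).inv fun s => (hpos s).ne').smul
      (((contDiff_const.sub h1).smul contDiff_const).add ((contDiff_id.div_const _).smul contDiff_const))
  have hγd : ContDiff ℝ ∞ γ := (hzd.const_smul (Real.cos θ)).add contDiff_const
  have := Fact.mk (@finrank_euclideanSpace_fin ℝ _ (n + 1))
  have hc : ContMDiff 𝓘(ℝ, ℝ) (𝓡 n) ∞ (Set.codRestrict γ _ hγ1) := hγd.contMDiff.codRestrict_sphere hγ1
  have hc0 : Set.codRestrict γ _ hγ1 0 = p := by
    refine Subtype.ext ?_
    rw [Set.val_codRestrict_apply, hpy]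
    simp [γ, z]
  have hder : HasDerivAt γ w 0 := by
    have h1 : HasDerivAt (fun s : ℝ => s ^ 2 * k) 0 0 := by
      simpa using ((hasDerivAt_id (0 : ℝ)).pow 2).mul_const k
    have h2 := (h1.const_add 1).fun_inv (hpos 0).ne'
    have h3 := ((h1.const_sub 1).smul_const (y : EuclideanSpace ℝ (Fin (n + 1)))).fun_add
      (((hasDerivAt_id (0 : ℝ)).div_const (Real.cos θ)).smul_const w)
    have h4 := ((h2.fun_smul h3).const_smul (Real.cos θ)).add_const (Real.sin θ • ν)
    refine h4.congr_deriv ?_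
    simp [smul_smul, hθ.ne']
  refine ⟨Set.codRestrict γ _ hγ1, hc, fun t => ⟨⟨z t, by simpa using hz1 t⟩, hzW t, rfl⟩, hc0, ?_⟩
  have h := (deriv_extChartAt_curve hc 0).1
  simp only [Set.val_codRestrict_apply] at h
  rw [h, hc0, hder.deriv]

/-- `hab` says that cos²θ(1+F), the squared radius of the parallel spheres, is critical at θ. It
cancels the only possible normal component of the acceleration, the one in the direction of
increasing θ; in the remaining directions there is none because dF is a multiple of ⟨ν,·⟩. -/
lemma isTotallyGeodesic_shift (hν : ν ∈ Wᗮ) (hν1 : ‖ν‖ = 1) (hθ : 0 < Real.cos θ)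
    {F : EuclideanSpace ℝ (Fin (n + 1)) → ℝ} (hF : ContDiff ℝ ∞ F) (hF0 : ∀ x, 0 ≤ F x) {a b : ℝ}
    (ha : ∀ p ∈ shift (subSphere W) ν θ, F p = a)
    (hb : ∀ p ∈ shift (subSphere W) ν θ, ∀ x, fderiv ℝ F p x = b * inner ℝ ν x)
    (hab : 2 * (1 + a) * Real.sin θ = b * Real.cos θ ^ 2) :
    IsTotallyGeodesic (pertMetric F hF hF0 W.starProjection) (shift (subSphere W) ν θ) := by
  intro c hc hcN t
  have hP : ∀ s, (c s : EuclideanSpace ℝ (Fin (n + 1))) = W.starProjection (c s) + Real.sin θ • ν :=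
    fun s => ((mem_shift_iff hν hθ).1 (hcN s)).1
  have hC := contDiff_coe_curve hc
  have hC' := (contDiff_infty_iff_deriv.1 hC).2
  have h1 : ∀ s, deriv (fun s => (c s : EuclideanSpace ℝ (Fin (n + 1)))) s
      = W.starProjection (deriv (fun s => (c s : EuclideanSpace ℝ (Fin (n + 1)))) s) := fun s => by
    have h := (W.starProjection.hasFDerivAt.comp_hasDerivAt s
      (hC.differentiable (by simp) s).hasDerivAt).add_const (Real.sin θ • ν)
    refine Eq.trans ?_ h.deriv
    congr 1
    funext s
    exact hP s
  have h2 : deriv (deriv fun s => (c s : EuclideanSpace ℝ (Fin (n + 1)))) t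
      = W.starProjection (deriv (deriv fun s => (c s : EuclideanSpace ℝ (Fin (n + 1)))) t) := by
    have h := W.starProjection.hasFDerivAt.comp_hasDerivAt t
      (hC'.differentiable (by simp) t).hasDerivAt
    refine Eq.trans ?_ h.deriv
    congr 1
    funext s
    exact h1 s
  have hup := inner_curve_deriv_deriv hc t
  have huW := h1 t
  set u := deriv (fun s => (c s : EuclideanSpace ℝ (Fin (n + 1)))) t with hu
  set x₂ := deriv (deriv fun s => (c s : EuclideanSpace ℝ (Fin (n + 1)))) t with hx₂
  set p : EuclideanSpace ℝ (Fin (n + 1)) := (c t : EuclideanSpace ℝ (Fin (n + 1))) with hp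
  set q := W.starProjection p with hq
  have hqW : q ∈ W := W.starProjection_apply_mem _
  have hqn : ‖q‖ = Real.cos θ := ((mem_shift_iff hν hθ).1 (hcN t)).2
  have hpq : p = q + Real.sin θ • ν := hP t
  have hself : ∀ x y : EuclideanSpace ℝ (Fin (n + 1)), y ∈ W →
      (inner ℝ (W.starProjection x) y : ℝ) = inner ℝ x y := fun x y hy => by
    rw [W.inner_starProjection_left_eq_right, Submodule.starProjection_eq_self_iff.2 hy]
  have huW' : u ∈ W := by rw [huW]; exact W.starProjection_apply_mem _
  have hxW' : x₂ ∈ W := by rw [h2]; exact W.starProjection_apply_mem _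
  -- The intrinsic acceleration of the curve in a round sphere of radius cos θ: the ambient
  -- acceleration with its centripetal part removed.
  set w := x₂ + (‖u‖ ^ 2 / Real.cos θ ^ 2) • q with hw
  have hwW : w ∈ W := W.add_mem hxW' (W.smul_mem _ hqW)
  have hwp : inner ℝ w p = (0 : ℝ) := by
    have h3 : (inner ℝ q p : ℝ) = Real.cos θ ^ 2 := by
      rw [hpq, inner_add_right, real_inner_smul_right, hν q hqW, real_inner_self_eq_norm_sq, hqn]
      ring
    rw [hw, inner_add_left, real_inner_smul_left, h3, real_inner_comm, hup]
    field_simp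
    ring
  have hacc := covAcceleration_pertMetric hF hF0 (L := W.starProjection) hc t hu hx₂ hwp ?_
  · rw [hacc]
    exact frameCoord_mem_tangentVectors hν hν1 hθ (hcN t) hwW hwp
  · intro x hx
    have huν : (inner ℝ ν u : ℝ) = 0 := by rw [real_inner_comm]; exact hν u huW'
    have hxq : (inner ℝ x q : ℝ) = -Real.sin θ * inner ℝ ν x := by
      change inner ℝ x p = (0 : ℝ) at hx
      rw [hpq, inner_add_right, real_inner_smul_right, real_inner_comm ν] at hx
      linarith
    rw [hb _ (hcN t), hb _ (hcN t), ha _ (hcN t), hself x _ (W.starProjection_apply_mem _),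
      hself x _ (W.starProjection_apply_mem _), Submodule.starProjection_eq_self_iff.2 hwW, ← h2, huν,
      ← huW, hw, inner_add_right, real_inner_smul_right, hxq]
    have hcos := hθ.ne'
    field_simp
    linear_combination (-‖u‖ ^ 2 * inner ℝ ν x) * hab

end TotallyGeodesic

/-! ### The shifted sphere is round -/

section Round

variable {n m : ℕ} {W : Submodule ℝ (EuclideanSpace ℝ (Fin (n + 1)))} {ν : EuclideanSpace ℝ (Fin (n + 1))}
  {θ : ℝ}

lemma inclDeriv_sphereMapDeriv {f : Sph m → Sph n} (hf : ContMDiff (𝓡 m) (𝓡 n) ∞ f)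
    {A : EuclideanSpace ℝ (Fin (m + 1)) →L[ℝ] EuclideanSpace ℝ (Fin (n + 1))}
    {b : EuclideanSpace ℝ (Fin (n + 1))}
    (hA : ∀ x, (f x : EuclideanSpace ℝ (Fin (n + 1))) = A x + b) (x : Sph m)
    (u : EuclideanSpace ℝ (Fin m)) :
    inclDeriv (f x) (sphereMapDeriv n f x u) = A (inclDeriv x u) := by
  have hg : HasFDerivAt (fun z : EuclideanSpace ℝ (Fin (m + 1)) => A z + b) A
      (x : EuclideanSpace ℝ (Fin (m + 1))) := A.hasFDerivAt.add_const b
  have h1 : (fun y : Sph n => (y : EuclideanSpace ℝ (Fin (n + 1)))) ∘ f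
      = (fun z : EuclideanSpace ℝ (Fin (m + 1)) => A z + b) ∘
        fun x : Sph m => (x : EuclideanSpace ℝ (Fin (m + 1))) := by
    funext y; exact hA y
  have h2 := mfderiv_comp (I' := 𝓡 n) x (contMDiff_coe_sph.mdifferentiableAt (by simp))
    (hf.mdifferentiableAt (x := x) (by simp))
  have h3 := mfderiv_comp (I' := 𝓘(ℝ, EuclideanSpace ℝ (Fin (m + 1)))) x
    (hg.differentiableAt.mdifferentiableAt) (contMDiff_coe_sph.mdifferentiableAt (x := x) (by simp))
  rw [h1, h3, mfderiv_eq_fderiv, hg.fderiv] at h2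
  exact (congrArg (fun B => B u) h2).symm

/-- Tangent vectors of the shifted sphere lie in W, where the projection is the identity, and F is
constant there. The induced metric is thus 1 + a times that of a sphere of radius cos θ. -/
lemma isRoundSphere_shift (hW : Module.finrank ℝ W = m + 1) (hν : ν ∈ Wᗮ) (hν1 : ‖ν‖ = 1)
    (hθ : 0 < Real.cos θ) {F : EuclideanSpace ℝ (Fin (n + 1)) → ℝ} (hF : ContDiff ℝ ∞ F)
    (hF0 : ∀ x, 0 ≤ F x) {a : ℝ} (ha0 : 0 ≤ a) (ha : ∀ p ∈ shift (subSphere W) ν θ, F p = a) :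
    IsRoundSphere (pertMetric F hF hF0 W.starProjection) m (shift (subSphere W) ν θ) := by
  let ι : EuclideanSpace ℝ (Fin (m + 1)) ≃ₗᵢ[ℝ] W :=
    ((stdOrthonormalBasis ℝ W).reindex (finCongr hW)).repr.symm
  let A : EuclideanSpace ℝ (Fin (m + 1)) →L[ℝ] EuclideanSpace ℝ (Fin (n + 1)) :=
    Real.cos θ • W.subtypeL.comp (ι.toContinuousLinearEquiv : EuclideanSpace ℝ (Fin (m + 1)) →L[ℝ] W)
  have hA : ∀ x, A x = Real.cos θ • (ι x : EuclideanSpace ℝ (Fin (n + 1))) := fun x => rfl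
  have hAW : ∀ x, A x ∈ W := fun x => W.smul_mem _ (ι x).2
  have hAA : ∀ x y, (inner ℝ (A x) (A y) : ℝ) = Real.cos θ ^ 2 * inner ℝ x y := fun x y => by
    rw [hA, hA, real_inner_smul_left, real_inner_smul_right, ← Submodule.coe_inner, ι.inner_map_map]
    ring
  have hf1 : ∀ x : Sph m, A x + Real.sin θ • ν ∈ Metric.sphere (0 : EuclideanSpace ℝ (Fin (n + 1))) 1 := by
    intro x
    rw [mem_sphere_zero_iff_norm, ← sq_eq_sq₀ (norm_nonneg _) zero_le_one, norm_add_sq_real,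
      real_inner_smul_right, hν _ (hAW x), ← real_inner_self_eq_norm_sq, hAA,
      real_inner_self_eq_norm_sq, norm_eq_of_mem_sphere, norm_smul, hν1, Real.norm_eq_abs, mul_pow, sq_abs]
    have := Real.sin_sq_add_cos_sq θ
    linarith
  have := Fact.mk (@finrank_euclideanSpace_fin ℝ _ (n + 1))
  have hfs : ContMDiff (𝓡 m) 𝓘(ℝ, EuclideanSpace ℝ (Fin (n + 1))) ∞
      fun x : Sph m => A x + Real.sin θ • ν :=
    ((A.contDiff.add contDiff_const).contMDiff).comp contMDiff_coe_sph
  have hf : ContMDiff (𝓡 m) (𝓡 n) ∞ (Set.codRestrict (fun x : Sph m => A x + Real.sin θ • ν) _ hf1) :=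
    hfs.codRestrict_sphere hf1
  refine ⟨Real.cos θ * √(1 + a), mul_pos hθ (Real.sqrt_pos.2 (by linarith)), _, hf, ?_, ?_, ?_⟩
  · intro x y hxy
    have h := congrArg (Subtype.val) hxy
    simp only [Set.val_codRestrict_apply, add_left_inj, hA] at h
    exact Subtype.ext (ι.injective (Subtype.ext (smul_right_injective _ hθ.ne' h)))
  · ext p
    constructor
    · rintro ⟨x, rfl⟩
      refine ⟨⟨ι x, ?_⟩, (ι x).2, rfl⟩
      rw [mem_sphere_zero_iff_norm, ← Submodule.coe_norm, ι.norm_map, norm_eq_of_mem_sphere]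
    · rintro ⟨y, hy, h⟩
      refine ⟨⟨ι.symm ⟨y, hy⟩, ?_⟩, Subtype.ext ?_⟩
      · rw [mem_sphere_zero_iff_norm, ι.symm.norm_map]
        exact norm_eq_of_mem_sphere y
      · rw [Set.val_codRestrict_apply, hA, h, ι.apply_symm_apply]
  · intro x u v
    rw [metricForm_pertMetric, inclDeriv_sphereMapDeriv hf (A := A) (b := Real.sin θ • ν) (fun x => rfl),
      inclDeriv_sphereMapDeriv hf (A := A) (b := Real.sin θ • ν) (fun x => rfl),
      Submodule.starProjection_eq_self_iff.2 (hAW _), Submodule.starProjection_eq_self_iff.2 (hAW _),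
      hAA, roundForm, mul_pow, Real.sq_sqrt (by linarith), ha]
    · ring
    · refine ⟨⟨ι x, ?_⟩, (ι x).2, rfl⟩
      rw [mem_sphere_zero_iff_norm, ← Submodule.coe_norm, ι.norm_map, norm_eq_of_mem_sphere]

end Round

/-! ### Distances from great subspheres -/

section Distance

variable {n : ℕ}

/-- The nearest point is the normalized projection of p; a nonzero projection also guarantees that
the subsphere is nonempty. -/
lemma roundDist_subSphere (V : Submodule ℝ (EuclideanSpace ℝ (Fin (n + 1)))) (p : Sph n)
    (hp : V.starProjection (p : EuclideanSpace ℝ (Fin (n + 1))) ≠ 0) :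
    roundDist p (subSphere V)
      = Real.arccos ‖V.starProjection (p : EuclideanSpace ℝ (Fin (n + 1)))‖ := by
  set q := V.starProjection (p : EuclideanSpace ℝ (Fin (n + 1))) with hq
  have hqV : q ∈ V := V.starProjection_apply_mem _
  have hin : ∀ y ∈ V, (inner ℝ (p : EuclideanSpace ℝ (Fin (n + 1))) y : ℝ) = inner ℝ q y := fun y hy => by
    rw [hq, V.inner_starProjection_left_eq_right, Submodule.starProjection_eq_self_iff.2 hy]
  have hangle : ∀ y : Sph n, y ∈ subSphere V → InnerProductGeometry.angle
      (p : EuclideanSpace ℝ (Fin (n + 1))) (y : EuclideanSpace ℝ (Fin (n + 1)))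
      = Real.arccos (inner ℝ q (y : EuclideanSpace ℝ (Fin (n + 1)))) := fun y hy => by
    rw [InnerProductGeometry.angle, norm_eq_of_mem_sphere, norm_eq_of_mem_sphere, hin _ hy, mul_one,
      div_one]
  have hqn : ‖q‖ ≠ 0 := norm_ne_zero_iff.2 hp
  let y₀ : subSphere V := ⟨⟨‖q‖⁻¹ • q, by
    rw [mem_sphere_zero_iff_norm, norm_smul, norm_inv, norm_norm, inv_mul_cancel₀ hqn]⟩,
    V.smul_mem _ hqV⟩
  have : Nonempty (subSphere V) := ⟨y₀⟩
  refine le_antisymm ?_ (le_ciInf fun y => ?_)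
  · refine (ciInf_le ⟨0, ?_⟩ y₀).trans (le_of_eq ?_)
    · rintro _ ⟨y, rfl⟩
      exact InnerProductGeometry.angle_nonneg _ _
    · rw [hangle _ y₀.2]
      congr 1
      change inner ℝ q (‖q‖⁻¹ • q) = ‖q‖
      rw [real_inner_smul_right, real_inner_self_eq_norm_sq]
      field_simp
  · rw [hangle _ y.2]
    refine Real.antitone_arccos ((real_inner_le_norm _ _).trans (le_of_eq ?_))
    rw [norm_eq_of_mem_sphere, mul_one]

lemma eq_orthogonal_span_singleton {E : Type*} [NormedAddCommGroup E] [InnerProductSpace ℝ E]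
    [FiniteDimensional ℝ E] {V : Submodule ℝ E} {ν : E} (hν : ν ∈ Vᗮ) (hν1 : ‖ν‖ = 1)
    (hV : Module.finrank ℝ V + 1 = Module.finrank ℝ E) : V = (ℝ ∙ ν)ᗮ := by
  have hν0 : ν ≠ 0 := norm_ne_zero_iff.1 (by rw [hν1]; exact one_ne_zero)
  refine Submodule.eq_of_le_of_finrank_eq (fun x hx => ?_) ?_
  · exact Submodule.mem_orthogonal_singleton_iff_inner_left.2 (hν x hx)
  · have h := (ℝ ∙ ν).finrank_add_finrank_orthogonal
    rw [finrank_span_singleton hν0] at h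
    omega

lemma roundDist_equator {V : Submodule ℝ (EuclideanSpace ℝ (Fin (n + 1)))}
    {ν : EuclideanSpace ℝ (Fin (n + 1))} (hν : ν ∈ Vᗮ) (hν1 : ‖ν‖ = 1) (hV : Module.finrank ℝ V = n)
    {p : Sph n} (h0 : 0 ≤ inner ℝ ν (p : EuclideanSpace ℝ (Fin (n + 1))))
    (h1 : inner ℝ ν (p : EuclideanSpace ℝ (Fin (n + 1))) < 1) :
    roundDist p (subSphere V) = Real.arcsin (inner ℝ ν (p : EuclideanSpace ℝ (Fin (n + 1)))) := by
  obtain rfl := eq_orthogonal_span_singleton hν hν1 (by rw [hV, finrank_euclideanSpace_fin])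
  have hq : (ℝ ∙ ν)ᗮ.starProjection (p : EuclideanSpace ℝ (Fin (n + 1)))
      = p - (inner ℝ ν (p : EuclideanSpace ℝ (Fin (n + 1))) : ℝ) • ν :=
    coe_orthogonalProjectionOnto_orthogonal_unit hν1 _
  have hn : ‖(ℝ ∙ ν)ᗮ.starProjection (p : EuclideanSpace ℝ (Fin (n + 1)))‖ ^ 2
      = 1 - inner ℝ ν (p : EuclideanSpace ℝ (Fin (n + 1))) ^ 2 := by
    rw [hq, norm_sub_sq_real, norm_smul, hν1, real_inner_smul_right, norm_eq_of_mem_sphere,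
      Real.norm_eq_abs, mul_one, sq_abs, real_inner_comm]
    ring
  rw [roundDist_subSphere, Real.arcsin_eq_arccos h0, ← hn, Real.sqrt_sq (norm_nonneg _)]
  intro h
  rw [h] at hn
  norm_num at hn
  nlinarith

end Distance

/-! ### The complement of `W` and `ν` -/

section Transverse

variable {E : Type*} [NormedAddCommGroup E] [InnerProductSpace ℝ E] [FiniteDimensional ℝ E]
  {W : Submodule ℝ E} {ν : E}

/-- The component of a vector orthogonal to `W` and to the unit vector `ν ∈ Wᗮ`. -/
def transversePart (W : Submodule ℝ E) (ν : E) : E →L[ℝ] E :=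
  ContinuousLinearMap.id ℝ E - W.starProjection - (innerSL ℝ ν).smulRight ν

lemma transversePart_apply (x : E) :
    transversePart W ν x = x - W.starProjection x - (inner ℝ ν x : ℝ) • ν := rfl

lemma norm_sq_transversePart (hν : ν ∈ Wᗮ) (hν1 : ‖ν‖ = 1) (x : E) :
    ‖W.starProjection x‖ ^ 2 + inner ℝ ν x ^ 2 + ‖transversePart W ν x‖ ^ 2 = ‖x‖ ^ 2 := by
  have h1 : (inner ℝ x (W.starProjection x) : ℝ) = ‖W.starProjection x‖ ^ 2 := by
    rw [← real_inner_self_eq_norm_sq, W.inner_starProjection_left_eq_right,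
      Submodule.starProjection_eq_self_iff.2 (W.starProjection_apply_mem _)]
  have h2 : (inner ℝ (W.starProjection x) ν : ℝ) = 0 := hν _ (W.starProjection_apply_mem _)
  rw [transversePart_apply, norm_sub_sq_real, norm_sub_sq_real, inner_sub_left, real_inner_smul_right,
    real_inner_smul_right, h1, h2, norm_smul, hν1, Real.norm_eq_abs, mul_one, sq_abs,
    real_inner_comm ν x]
  ring

/-- The trace of the projection over p^⊥ is its full trace dim W minus the contribution of p. -/
lemma IsFrame.sum_norm_sq_starProjection {n : ℕ} {p : E} {e : Fin n → E} (h : IsFrame p e)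
    (W : Submodule ℝ E) :
    ∑ k, ‖W.starProjection (e k)‖ ^ 2 = Module.finrank ℝ W - ‖W.starProjection p‖ ^ 2 := by
  let b := stdOrthonormalBasis ℝ W
  have hb : ∀ x : E, ‖W.starProjection x‖ ^ 2 = ∑ i, (inner ℝ (b i : E) x : ℝ) ^ 2 := fun x => by
    have h1 := b.sum_sq_norm_inner_right (W.orthogonalProjectionOnto x)
    have h2 : ‖W.starProjection x‖ = ‖W.orthogonalProjectionOnto x‖ := rfl
    rw [h2, ← h1]
    refine Finset.sum_congr rfl fun i _ => ?_
    rw [Submodule.inner_orthogonalProjectionOnto_eq_of_mem_left, Real.norm_eq_abs, sq_abs]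
  have h3 : ∀ i, ∑ k, (inner ℝ (b i : E) (e k) : ℝ) ^ 2 = 1 - inner ℝ (b i : E) p ^ 2 := fun i => by
    have h4 := h.parseval (b i) (b i)
    have h5 : (inner ℝ (b i : E) (b i : E) : ℝ) = 1 := by
      rw [← Submodule.coe_inner, real_inner_self_eq_norm_sq, b.norm_eq_one, one_pow]
    rw [h5] at h4
    simp only [sq, ← h4, real_inner_comm (b i : E)]
  simp only [hb]
  rw [Finset.sum_comm]
  simp [h3]

end Transverse

/-! ### Rescaled profiles -/

section Profile

/-- The function `c r² χ(s / r)`. -/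
def rescale (χ : ℝ → ℝ) (c r s : ℝ) : ℝ := c * r ^ 2 * χ (s / r)

variable {χ : ℝ → ℝ}

lemma contDiff_rescale (hχ : ContDiff ℝ ∞ χ) (c r : ℝ) : ContDiff ℝ ∞ (rescale χ c r) :=
  contDiff_const.mul (hχ.comp (contDiff_id.div_const r))

/-- Value and slope tend to 0 with r while the second derivative keeps its size: the regime of
`exists_pertRicci_pos`. -/
lemma twoJet_rescale (hχ : ContDiff ℝ ∞ χ) (c : ℝ) {r : ℝ} (hr : r ≠ 0) (s : ℝ) :
    twoJet (rescale χ c r) s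
      = ![c * r ^ 2 * χ (s / r), c * r * deriv χ (s / r), c * deriv (deriv χ) (s / r)] := by
  have hχ' : ContDiff ℝ ∞ (deriv χ) := (contDiff_infty_iff_deriv.1 hχ).2
  have hd : ∀ {f : ℝ → ℝ}, ContDiff ℝ ∞ f → ∀ a s, deriv (fun s => a * f (s / r)) s
      = a / r * deriv f (s / r) := fun {f} hf a s => by
    have h := ((hf.differentiable (by simp) (s / r)).hasDerivAt.comp s
      ((hasDerivAt_id s).div_const r)).const_mul a
    refine h.deriv.trans ?_
    ring
  have h1 : deriv (rescale χ c r) = fun s => c * r * deriv χ (s / r) := by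
    funext s
    refine (hd hχ (c * r ^ 2) s).trans ?_
    field_simp
  rw [twoJet, h1, hd hχ', rescale, mul_div_cancel_right₀ c hr]

lemma exists_twoJet_bound (hχ : ContDiff ℝ ∞ χ) {a b : ℝ} (ha : ∀ x ≤ a, χ x = 0) (hb : ∀ x ≥ b, χ x = 0) :
    (∃ M > 0, ∀ x i, |twoJet χ x i| ≤ M) ∧ ∀ x, x ∉ Set.Icc a b → twoJet χ x = 0 := by
  have hχ' : ContDiff ℝ ∞ (deriv χ) := (contDiff_infty_iff_deriv.1 hχ).2
  have hχ'' : ContDiff ℝ ∞ (deriv (deriv χ)) := (contDiff_infty_iff_deriv.1 hχ').2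
  have hs : tsupport χ ⊆ Set.Icc a b := by
    refine closure_minimal (fun x hx => ⟨?_, ?_⟩) isClosed_Icc
    · exact le_of_lt (not_le.1 fun h => hx (ha x h))
    · exact le_of_lt (not_le.1 fun h => hx (hb x h))
  have hs' : tsupport (deriv χ) ⊆ Set.Icc a b :=
    (closure_minimal support_deriv_subset (isClosed_tsupport χ)).trans hs
  have hc : HasCompactSupport χ := isCompact_Icc.of_isClosed_subset (isClosed_tsupport _) hs
  constructor
  · obtain ⟨M₀, h₀⟩ := hc.exists_bound_of_continuous hχ.continuous
    obtain ⟨M₁, h₁⟩ := hc.deriv.exists_bound_of_continuous hχ'.continuous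
    obtain ⟨M₂, h₂⟩ := hc.deriv.deriv.exists_bound_of_continuous hχ''.continuous
    refine ⟨max (max M₀ M₁) (max M₂ 1), by positivity, fun x i => ?_⟩
    fin_cases i
    · exact (h₀ x).trans (by simp)
    · exact (h₁ x).trans (by simp)
    · exact (h₂ x).trans (by simp)
  · intro x hx
    have e0 : χ x = 0 := image_eq_zero_of_notMem_tsupport fun h => hx (hs h)
    have e1 : deriv χ x = 0 := image_eq_zero_of_notMem_tsupport fun h => hx (hs' h)
    have e2 : deriv (deriv χ) x = 0 := by
      by_contra h
      exact hx (hs' (support_deriv_subset h))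
    ext i
    fin_cases i
    · exact e0
    · exact e1
    · exact e2

end Profile

/-! ### The deformation -/

section Deformation

/-- Equality with 1 on a neighbourhood makes the derivative of η vanish along the shifted sphere. -/
lemma exists_transverse_cutoff {E : Type*} [NormedAddCommGroup E] [InnerProductSpace ℝ E]
    [FiniteDimensional ℝ E] (W : Submodule ℝ E) (ν : E) {r : ℝ} (hr : 0 < r) :
    ∃ η : E → ℝ, ContDiff ℝ ∞ η ∧ (∀ x, 0 ≤ η x) ∧ (∀ x, η x ≤ 1) ∧
      (∀ x, transversePart W ν x = 0 → η =ᶠ[nhds x] fun _ => 1) ∧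
      ∀ x, η x ≠ 0 → ‖transversePart W ν x‖ < r := by
  let f : ContDiffBump (0 : E) := ⟨r / 2, r, by linarith, by linarith⟩
  refine ⟨fun x => f (transversePart W ν x), f.contDiff.comp (transversePart W ν).contDiff,
    fun x => f.nonneg, fun x => f.le_one, fun x hx => ?_, fun x hx => ?_⟩
  · have h := f.eventuallyEq_one
    have h' : Filter.Tendsto (transversePart W ν) (nhds x) (nhds 0) := by
      simpa only [hx] using (transversePart W ν).continuous.tendsto x
    exact h'.eventually h
  · have h : transversePart W ν x ∈ Function.support f := hx
    rw [f.support_eq] at h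
    exact mem_ball_zero_iff.1 h

/-- At height 0 on the support of η, p is almost in W: ‖Pp‖² ≥ 1 - r². So the trace over p^⊥ is
about m instead of m + 1, a gain that is essential for small m. -/
lemma transverse_cutoff_trace_le {E : Type*} [NormedAddCommGroup E] [InnerProductSpace ℝ E]
    [FiniteDimensional ℝ E] {W : Submodule ℝ E} {ν : E} (hν : ν ∈ Wᗮ) (hν1 : ‖ν‖ = 1) {r : ℝ}
    {η : E → ℝ} (hη1 : ∀ x, η x ≤ 1)
    (hηr : ∀ x, η x ≠ 0 → ‖transversePart W ν x‖ < r) {m n : ℕ} (hW : Module.finrank ℝ W = m + 1)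
    {p : E} {e : Fin n → E} (hpe : IsFrame p e) (hp : inner ℝ ν p = (0 : ℝ)) :
    η p * ∑ k, ‖W.starProjection (e k)‖ ^ 2 ≤ m + r ^ 2 := by
  by_cases h : η p = 0
  · rw [h, zero_mul]
    positivity
  · have h1 := norm_sq_transversePart hν hν1 p
    rw [hp, hpe.norm_base] at h1
    have h2 : ‖transversePart W ν p‖ ^ 2 ≤ r ^ 2 :=
      pow_le_pow_left₀ (norm_nonneg _) (hηr p h).le 2
    have h3 : 0 ≤ ∑ k, ‖W.starProjection (e k)‖ ^ 2 := Finset.sum_nonneg fun k _ => sq_nonneg _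
    have h4 : ∑ k, ‖W.starProjection (e k)‖ ^ 2 ≤ m + r ^ 2 := by
      rw [hpe.sum_norm_sq_starProjection, hW]
      push_cast
      linarith
    exact (mul_le_of_le_one_left h3 (hη1 p)).trans h4

/-- As ε → 0 the ratios sin ε / sin 3ε and sin 6ε / sin 3ε tend to 1/3 < 0.36 and 2 > 1.89, so the
support of the profile fits strictly between the radii ε and 6ε. -/
lemma exists_small_angle {τ : ℝ} (hτ : 0 < τ) : ∃ ε₀ > 0, ∀ ε : ℝ, 0 < ε → ε < ε₀ →
    0 < Real.sin (3 * ε) ∧ Real.sin (3 * ε) < τ ∧ 0 < Real.cos (3 * ε) ∧ 6 * ε < 1 ∧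
      Real.sin ε < 0.36 * Real.sin (3 * ε) ∧ 1.89 * Real.sin (3 * ε) < Real.sin (6 * ε) := by
  refine ⟨min (τ / 3) (1 / 100), by positivity, fun ε hε hlt => ?_⟩
  have h1 : ε < τ / 3 := hlt.trans_le (min_le_left _ _)
  have h2 : ε < 1 / 100 := hlt.trans_le (min_le_right _ _)
  have hs : 0 < Real.sin ε := Real.sin_pos_of_pos_of_lt_pi hε (by linarith [Real.pi_gt_three])
  have hs3 : 0 < Real.sin (3 * ε) :=
    Real.sin_pos_of_pos_of_lt_pi (by linarith) (by linarith [Real.pi_gt_three])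
  have hle : Real.sin ε < ε := Real.sin_lt hε
  have hle3 : Real.sin (3 * ε) < 3 * ε := Real.sin_lt (by linarith)
  have hcos := Real.one_sub_sq_div_two_le_cos (x := 3 * ε)
  have hcos' : 0.99 < Real.cos (3 * ε) := by nlinarith
  refine ⟨hs3, by linarith, by linarith, by linarith, ?_, ?_⟩
  · rw [Real.sin_three_mul]
    have : Real.sin ε ^ 2 < 0.01 := by nlinarith
    nlinarith
  · have : 6 * ε = 2 * (3 * ε) := by ring
    rw [this, Real.sin_two_mul]
    nlinarith

/-- With value c s² X and slope 2cs at height s, the equation for c is the criticality condition of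
`isTotallyGeodesic_shift`. The bound 34/33 is tuned to 3.3 · 34/33 = 3.4. -/
lemma exists_coupling {s X M : ℝ} (hX0 : 0 ≤ X) (hXM : X ≤ M) (hs : 0 < s)
    (hsM : s < 1 / (34 * (1 + M))) :
    ∃ c, 1 ≤ c ∧ c ≤ 34 / 33 ∧ c * (1 - s ^ 2 * (1 + X)) = 1 := by
  have hM : 0 < 34 * (1 + M) := by linarith
  rw [lt_div_iff₀ hM] at hsM
  have hs1 : s < 1 := by nlinarith
  have h1 : s ^ 2 * (1 + X) ≤ 1 / 34 := by
    have : s ^ 2 * (1 + X) ≤ s * (1 + M) := by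
      refine mul_le_mul ?_ (by linarith) (by linarith) hs.le
      nlinarith
    linarith
  have h0 : 0 ≤ s ^ 2 * (1 + X) := by positivity
  have hpos : 0 < 1 - s ^ 2 * (1 + X) := by linarith
  refine ⟨(1 - s ^ 2 * (1 + X))⁻¹, (one_le_inv₀ hpos).2 (by linarith), ?_, inv_mul_cancel₀ hpos.ne'⟩
  rw [inv_le_comm₀ hpos (by norm_num)]
  linarith

lemma fderiv_profile_of_eventuallyEq_one {E : Type*} [NormedAddCommGroup E] [InnerProductSpace ℝ E]
    {φ : ℝ → ℝ} (hφ : ContDiff ℝ ∞ φ) {η : E → ℝ} {ν p : E} (h : η =ᶠ[nhds p] fun _ => 1) (x : E) :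
    fderiv ℝ (fun x => φ (inner ℝ ν x) * η x) p x = deriv φ (inner ℝ ν p) * inner ℝ ν x := by
  have h1 : (fun x => φ (inner ℝ ν x) * η x) =ᶠ[nhds p] fun x => φ (innerSL ℝ ν x) := by
    filter_upwards [h] with y hy
    rw [hy, mul_one, innerSL_apply_apply]
  have h2 : HasDerivAt φ (deriv φ (innerSL ℝ ν p)) (innerSL ℝ ν p) :=
    (hφ.differentiable (by simp) _).hasDerivAt
  have h3 := h2.comp_hasFDerivAt p (innerSL ℝ ν).hasFDerivAt
  rw [h1.fderiv_eq]
  refine (congrArg (fun A => A x) h3.fderiv).trans ?_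
  simp

/-- The distance to the equator is the arcsine of the height. The distance to S has cosine ‖Pp‖, and
‖Pp‖² = 1 - height² - ‖transverse part‖² > 1 - 2σ² ≥ cos²δ. -/
lemma mem_annulus_inter_nbhd {n : ℕ} {W What : Submodule ℝ (EuclideanSpace ℝ (Fin (n + 1)))}
    (hle : W ≤ What) {ν : EuclideanSpace ℝ (Fin (n + 1))} (hν : ν ∈ Whatᗮ) (hν1 : ‖ν‖ = 1)
    (hWhat : Module.finrank ℝ What = n) {a b δ σ : ℝ} (ha : 0 < a) (hab : a < b) (hb : b ≤ 1) (hδ : 0 < δ)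
    (hδ1 : δ ≤ 1) (hσ : 2 * σ ^ 2 ≤ Real.sin δ ^ 2) {p : Sph n}
    (h1 : Real.sin a < inner ℝ ν (p : EuclideanSpace ℝ (Fin (n + 1))))
    (h2 : inner ℝ ν (p : EuclideanSpace ℝ (Fin (n + 1))) < Real.sin b)
    (h3 : inner ℝ ν (p : EuclideanSpace ℝ (Fin (n + 1))) ≤ σ)
    (h4 : ‖transversePart W ν (p : EuclideanSpace ℝ (Fin (n + 1)))‖ < σ) :
    p ∈ annulus a b (subSphere What) ∩ nbhd δ (subSphere W) := by
  have hπ := Real.pi_gt_three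
  set s : ℝ := inner ℝ ν (p : EuclideanSpace ℝ (Fin (n + 1))) with hs
  have hs0 : 0 < s := (Real.sin_pos_of_pos_of_lt_pi ha (by linarith)).trans h1
  have hs1 : s < 1 := h2.trans_le (Real.sin_le_one b)
  refine ⟨?_, ?_⟩
  · have hd := roundDist_equator hν hν1 hWhat hs0.le hs1
    exact ⟨by rw [hd]; exact (Real.lt_arcsin_iff_sin_lt' ⟨by linarith, by linarith⟩).2 h1,
      by rw [hd]; exact (Real.arcsin_lt_iff_lt_sin' ⟨by linarith, by linarith⟩).2 h2⟩
  · have h5 := norm_sq_transversePart (Submodule.orthogonal_le hle hν) hν1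
      (p : EuclideanSpace ℝ (Fin (n + 1)))
    rw [norm_eq_of_mem_sphere, ← hs] at h5
    have h6 : s ^ 2 ≤ σ ^ 2 := pow_le_pow_left₀ hs0.le h3 2
    have h7 : ‖transversePart W ν (p : EuclideanSpace ℝ (Fin (n + 1)))‖ ^ 2 < σ ^ 2 :=
      pow_lt_pow_left₀ h4 (norm_nonneg _) two_ne_zero
    have h8 := Real.sin_sq_add_cos_sq δ
    have hcos : 0 < Real.cos δ := Real.cos_pos_of_mem_Ioo ⟨by linarith, by linarith⟩
    have h9 : Real.cos δ < ‖W.starProjection (p : EuclideanSpace ℝ (Fin (n + 1)))‖ := by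
      refine lt_of_pow_lt_pow_left₀ 2 (norm_nonneg _) ?_
      linarith
    have h10 : ‖W.starProjection (p : EuclideanSpace ℝ (Fin (n + 1)))‖ ≤ 1 := by
      refine (sq_le_one_iff₀ (norm_nonneg _)).1 ?_
      nlinarith [sq_nonneg s, sq_nonneg ‖transversePart W ν (p : EuclideanSpace ℝ (Fin (n + 1)))‖]
    change roundDist p (subSphere W) < δ
    rw [roundDist_subSphere W p (norm_pos_iff.1 (hcos.trans h9))]
    calc _ < Real.arccos (Real.cos δ) := Real.arccos_lt_arccos (by linarith) h9 h10
      _ = δ := Real.arccos_cos hδ.le (by linarith)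

end Deformation

/-! ### Positive Ricci curvature of the rescaled deformation -/

section Deformation

/-- For small `s` the metric `⟨v, w⟩ + c s² χ(⟨ν, x⟩ / s) η(x) ⟨P v, P w⟩` has positive Ricci
curvature. -/
lemma exists_hasPositiveRicci {m : ℕ} (hm : 1 ≤ m)
    {W : Submodule ℝ (EuclideanSpace ℝ (Fin (2 * m + 1 + 1)))} (hW : Module.finrank ℝ W = m + 1)
    {ν : EuclideanSpace ℝ (Fin (2 * m + 1 + 1))} (hν : ν ∈ Wᗮ) (hν1 : ‖ν‖ = 1)
    {η : EuclideanSpace ℝ (Fin (2 * m + 1 + 1)) → ℝ} (hη : ContDiff ℝ ∞ η) (hη0 : ∀ x, 0 ≤ η x)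
    (hη1 : ∀ x, η x ≤ 1) (hηr : ∀ x, η x ≠ 0 → ‖transversePart W ν x‖ < 1 / 3)
    {χ : ℝ → ℝ} (hχ : ContDiff ℝ ∞ χ) (hχ0 : ∀ x, 0 ≤ χ x) {a b M : ℝ} (ha : 0 ≤ a) (hb : b ≤ 2)
    (hM0 : 0 < M) (hM : ∀ x i, |twoJet χ x i| ≤ M) (hsupp : ∀ x, x ∉ Set.Icc a b → twoJet χ x = 0)
    (hχ2 : ∀ x, deriv (deriv χ) x ≤ 3.3) :
    ∃ τ > 0, ∀ c s : ℝ, 1 ≤ c → c ≤ 34 / 33 → 0 < s → s < τ →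
      ∀ h0 : ∀ x : EuclideanSpace ℝ (Fin (2 * m + 1 + 1)), 0 ≤ rescale χ c s (inner ℝ ν x) * η x,
        HasPositiveRicci (pertMetric _ (contDiff_profile (contDiff_rescale hχ c s) hη) h0
          W.starProjection) := by
  have hm' : (1 : ℝ) ≤ m := by exact_mod_cast hm
  have hL : ∀ x, ‖W.starProjection x‖ ^ 2 + inner ℝ ν x ^ 2 ≤ ‖x‖ ^ 2 := fun x => by
    nlinarith [norm_sq_transversePart hν hν1 x, sq_nonneg ‖transversePart W ν x‖]
  have hT : (1 : ℝ) ≤ m + (1 / 3) ^ 2 := by linarith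
  -- The decisive inequality 3.4 (m + 1/9) < 4m; the case m = 1 is the tightest, with 34/9 < 4.
  have hκT : (3.4 : ℝ) * (m + (1 / 3) ^ 2) < 2 * ((2 * m + 1 : ℕ) - 1) := by
    push_cast
    linarith
  have hτ : ∀ (p : EuclideanSpace ℝ (Fin (2 * m + 1 + 1)))
      (e : Fin (2 * m + 1) → EuclideanSpace ℝ (Fin (2 * m + 1 + 1))), IsFrame p e →
      inner ℝ ν p = (0 : ℝ) → η p * ∑ k, ‖W.starProjection (e k)‖ ^ 2 ≤ m + (1 / 3) ^ 2 :=
    fun p e hpe hp => transverse_cutoff_trace_le hν hν1 hη1 hηr hW hpe hp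
  obtain ⟨ρ, hρ, H⟩ := exists_pertRicci_pos hη hη0 hη1 hν1 hL hT (by norm_num) hκT hτ (R := 2 * M)
  refine ⟨min 1 (ρ / (2 * (M + 1))), by positivity, fun c s hc1 hc2 hs hsτ h0 => ?_⟩
  have hs1 : s < 1 := hsτ.trans_le (min_le_left _ _)
  have hs2 := hsτ.trans_le (min_le_right _ _)
  rw [lt_div_iff₀ (by positivity)] at hs2
  have hφ0 : ∀ t, 0 ≤ rescale χ c s t := fun t => by
    have := hχ0 (t / s)
    unfold rescale
    positivity
  intro p v hv
  rw [ricci_pertMetric (contDiff_rescale hχ c s) hη h0 hφ0 hη0, twoJet_rescale hχ c hs.ne']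
  set t : ℝ := inner ℝ ν (p : EuclideanSpace ℝ (Fin (2 * m + 1 + 1)))
  -- Inside the support the height is at most 2s, hence small. Outside, the two-jet vanishes and the
  -- curvature is that of the round sphere at any height.
  by_cases ht : t / s ∈ Set.Icc a b
  · obtain ⟨ht1, ht2⟩ := ht
    rw [le_div_iff₀ hs] at ht1
    rw [div_le_iff₀ hs] at ht2
    have b0 : |χ (t / s)| ≤ M := hM (t / s) 0
    have b1 : |deriv χ (t / s)| ≤ M := hM (t / s) 1
    have b2 : |deriv (deriv χ) (t / s)| ≤ M := hM (t / s) 2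
    have hsM : 0 < s * M := mul_pos hs hM0
    refine H _ _ _ _ (isFrame_sphFrame p) ?_ ?_ ?_ ?_ ?_ ?_ hv
    · exact hφ0 t
    · change c * s ^ 2 * χ (t / s) < ρ
      have h1 : c * s ^ 2 * χ (t / s) ≤ 2 * s * M := by
        refine mul_le_mul ?_ ((le_abs_self _).trans b0) (hχ0 _) (by positivity)
        nlinarith
      nlinarith
    · change |c * s * deriv χ (t / s)| < ρ
      rw [abs_mul, abs_of_pos (by positivity : 0 < c * s)]
      have h1 : c * s * |deriv χ (t / s)| ≤ 2 * s * M :=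
        mul_le_mul (by nlinarith) b1 (abs_nonneg _) (by positivity)
      nlinarith
    · change |c * deriv (deriv χ) (t / s)| ≤ 2 * M
      rw [abs_mul, abs_of_pos (by positivity : 0 < c)]
      exact mul_le_mul (by linarith) b2 (abs_nonneg _) (by positivity)
    · change c * deriv (deriv χ) (t / s) ≤ 3.4
      have := mul_le_mul_of_nonneg_left (hχ2 (t / s)) (by positivity : 0 ≤ c)
      linarith
    · have ht0 : 0 ≤ t := (mul_nonneg ha hs.le).trans ht1
      rw [abs_of_nonneg ht0]
      nlinarith
  · have hz := hsupp _ ht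
    have z0 : χ (t / s) = 0 := congrFun hz 0
    have z1 : deriv χ (t / s) = 0 := congrFun hz 1
    have z2 : deriv (deriv χ) (t / s) = 0 := congrFun hz 2
    rw [z0, z1, z2]
    exact pertRicci_pos (isFrame_sphFrame p) hν1 hL (hη0 _) (hη1 _) hT (by norm_num : (0 : ℝ) ≤ 3.4)
      hκT (by simp) (by simp) (by simp; norm_num) (Or.inl (by simp)) hv

end Deformation

end SphereUnlink

end

/-! ### Choice of the parameters and proof of the theorem -/

open SphereUnlink in
theorem mainTheorem11 (m : ℕ) (hm : 1 ≤ m)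
    (W What : Submodule ℝ (EuclideanSpace ℝ (Fin (2 * m + 1 + 1))))
    (hW : Module.finrank ℝ W = m + 1)
    (hWhat : Module.finrank ℝ What = 2 * m + 1)
    (hle : W ≤ What)
    (ν : EuclideanSpace ℝ (Fin (2 * m + 1 + 1)))
    (hν : ν ∈ Whatᗮ) (hν1 : ‖ν‖ = 1)
    (δ : ℝ) (hδ : 0 < δ) :
    ∃ ε₀ : ℝ, 0 < ε₀ ∧ ∀ ε : ℝ, 0 < ε → ε < ε₀ →
      ∃ g : SmoothMetric (2 * m + 1) (Sph (2 * m + 1)),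
        HasPositiveRicci g ∧
        (∀ p : Sph (2 * m + 1),
          p ∉ annulus ε (6 * ε) (subSphere What) ∩ nbhd δ (subSphere W) →
          ∀ v w : EuclideanSpace ℝ (Fin (2 * m + 1)), metricForm g p v w = roundForm p v w) ∧
        IsRoundSphere g m (shift (subSphere W) ν (3 * ε)) ∧
        IsTotallyGeodesic g (shift (subSphere W) ν (3 * ε)) := by
  have hνW : ν ∈ Wᗮ := Submodule.orthogonal_le hle hν
  obtain ⟨χ, hχ, hχ0, hχa, hχb, hχ1, hχ2⟩ := exists_profile
  obtain ⟨⟨M, hM0, hM⟩, hsupp⟩ := exists_twoJet_bound hχ hχa hχb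
  -- Shrinking δ to at most 1 keeps the angle in the range where sine and cosine control distances.
  have hδ' : 0 < min δ 1 := lt_min hδ one_pos
  have hδπ : min δ 1 < Real.pi := (min_le_right _ _).trans_lt (by linarith [Real.pi_gt_three])
  have hsin : 0 < Real.sin (min δ 1) := Real.sin_pos_of_pos_of_lt_pi hδ' hδπ
  -- The factor 1/3 gives both σ ≤ 1/3, the transverse radius needed for the trace bound, and 2σ² ≤
  -- sin², needed to stay inside the neighbourhood of S.
  set σ := Real.sin (min δ 1) / 3 with hσ
  have hσ0 : 0 < σ := by positivity
  have hσ3 : σ ≤ 1 / 3 := by linarith [Real.sin_le_one (min δ 1)]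
  have hσ2 : 2 * σ ^ 2 ≤ Real.sin (min δ 1) ^ 2 := by
    rw [hσ, div_pow]
    nlinarith [sq_nonneg (Real.sin (min δ 1))]
  obtain ⟨η, hη, hη0, hη1, hηone, hηr⟩ := exists_transverse_cutoff W ν hσ0
  obtain ⟨τ, hτ, hric⟩ := exists_hasPositiveRicci hm hW hνW hν1 hη hη0 hη1
    (fun x hx => (hηr x hx).trans_le hσ3) hχ hχ0 (by norm_num) (by norm_num) hM0 hM hsupp hχ2
  -- Three smallness conditions on s = sin 3ε: τ for the Ricci curvature, σ/2 so that heights up to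
  -- 1.89 s stay below σ, and the last one for the existence of c.
  obtain ⟨ε₀, hε₀, hsmall⟩ := exists_small_angle
    (lt_min hτ (lt_min (half_pos hσ0) (by positivity : 0 < 1 / (34 * (1 + M)))))
  refine ⟨ε₀, hε₀, fun ε hε hεlt => ?_⟩
  obtain ⟨hs, hsτ, hcos, h6, hlow, hhigh⟩ := hsmall ε hε hεlt
  set s := Real.sin (3 * ε) with hsdef
  have hs1 : s < τ := hsτ.trans_le (min_le_left _ _)
  have hs2 : s < σ / 2 := hsτ.trans_le ((min_le_right _ _).trans (min_le_left _ _))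
  have hs3 : s < 1 / (34 * (1 + M)) := hsτ.trans_le ((min_le_right _ _).trans (min_le_right _ _))
  obtain ⟨c, hc1, hc2, hc⟩ := exists_coupling (hχ0 1) ((le_abs_self _).trans (hM 1 0)) hs hs3
  have hφ0 : ∀ t, 0 ≤ rescale χ c s t := fun t => by
    have := hχ0 (t / s)
    unfold rescale
    positivity
  have h0 : ∀ x : EuclideanSpace ℝ (Fin (2 * m + 1 + 1)), 0 ≤ rescale χ c s (inner ℝ ν x) * η x :=
    fun x => mul_nonneg (hφ0 _) (hη0 x)
  have hφ := contDiff_rescale hχ c s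
  have hjet := twoJet_rescale hχ c hs.ne' s
  rw [div_self hs.ne', hχ1] at hjet
  have hN : ∀ p ∈ shift (subSphere W) ν (3 * ε),
      inner ℝ ν (p : EuclideanSpace ℝ (Fin (2 * m + 1 + 1))) = s ∧
        η =ᶠ[nhds (p : EuclideanSpace ℝ (Fin (2 * m + 1 + 1)))] fun _ => 1 := fun p hp => by
    have h1 := ((mem_shift_iff hνW hcos).1 hp).1
    have h2 : inner ℝ ν (p : EuclideanSpace ℝ (Fin (2 * m + 1 + 1))) = s := by
      rw [h1, inner_add_right, real_inner_smul_right, real_inner_self_eq_norm_sq, hν1, real_inner_comm,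
        hνW _ (W.starProjection_apply_mem _)]
      ring
    refine ⟨h2, hηone _ ?_⟩
    rw [transversePart_apply, h2, sub_sub, ← h1, sub_self]
  have hFa : ∀ p ∈ shift (subSphere W) ν (3 * ε),
      rescale χ c s (inner ℝ ν (p : EuclideanSpace ℝ (Fin (2 * m + 1 + 1)))) * η p = c * s ^ 2 * χ 1 :=
    fun p hp => by
      rw [(hN p hp).1, (hN p hp).2.eq_of_nhds, mul_one, rescale, div_self hs.ne']
  refine ⟨pertMetric _ (contDiff_profile hφ hη) h0 W.starProjection, hric c s hc1 hc2 hs hs1 h0, ?_,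
    isRoundSphere_shift hW hνW hν1 hcos _ h0 (mul_nonneg (by positivity) (hχ0 1)) hFa,
    isTotallyGeodesic_shift hνW hν1 hcos _ h0 (b := c * s * 2) hFa ?_ ?_⟩
  · intro p hp v w
    have hF : rescale χ c s (inner ℝ ν (p : EuclideanSpace ℝ (Fin (2 * m + 1 + 1)))) * η p = 0 := by
      by_contra hne
      obtain ⟨hne1, hne2⟩ := mul_ne_zero_iff.1 hne
      have hne3 := (mul_ne_zero_iff.1 hne1).2
      have hlo := not_le.1 fun h => hne3 (hχa _ h)
      have hhi := not_le.1 fun h => hne3 (hχb _ h)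
      rw [lt_div_iff₀ hs] at hlo
      rw [div_lt_iff₀ hs] at hhi
      have hmem := mem_annulus_inter_nbhd hle hν hν1 hWhat hε (by linarith) h6.le hδ' (min_le_right _ _)
        hσ2 (hlow.trans hlo) (hhi.trans hhigh) (by linarith) (hηr _ hne2)
      have hdist : roundDist p (subSphere W) < min δ 1 := hmem.2
      exact hp ⟨hmem.1, hdist.trans_le (min_le_left _ _)⟩
    rw [metricForm_pertMetric, hF, zero_mul, add_zero, roundForm]
  · intro p hp x
    rw [fderiv_profile_of_eventuallyEq_one hφ (hN p hp).2, (hN p hp).1]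
    congr 1
    exact congrFun hjet 1
  -- With a = c s² χ(1) and b = 2cs, the condition for total geodesy is 2s times the equation `hc`.
  · have := Real.sin_sq_add_cos_sq (3 * ε)
    rw [← hsdef] at this ⊢
    have hcc : Real.cos (3 * ε) ^ 2 = 1 - s ^ 2 := by linarith
    rw [hcc]
    linear_combination (-2 * s) * hc
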